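/- Let $a_1<a_2<a_3<a_4$ be real numbers, $P(x)=\prod_{i=1}^4(x-a_i)$, $\sigma=\frac14\sum_{i=1}^4 a_i$, and $$L\psi=(P\psi')'+2(x-\sigma)^2\psi .$$ For $1\le j\le 3$ let $D_{j,\max}$ be the set of $\psi:(a_j,a_{j+1})\to\mathbb{C}$ such that $\psi$ and $P\psi'$ are absolutely continuous on all compact subintervals of $(a_j,a_{j+1})$ and $\psi,L\psi\in L^2(a_j,a_{j+1})$. Put $[u,v]=u\,P\bar v'-\bar v\,Pu'$, and let $$u(y)=1,\qquad v(y)=\sum_{i=1}^4\Big(\prod_{j\ne i}\frac1{a_i-a_j}\Big)\ln|y-a_i| .$$ For $k\in\{1,2\}$ consider the operator $\psi\mapsto L\psi$ in $L^2(a_k,a_{k+2})$ whose domain consists of all $\psi$ with restrictions in $D_{k,\max}$ and $D_{k+1,\max}$ that satisfy the boundary conditions $[\psi,u](a_k^+)=[\psi,u](a_{k+2}^-)=0$ and the transmission conditions $[\psi,u](a_{k+1}^-)=[\psi,u](a_{k+1}^+)$ and $[\psi,v](a_{k+1}^-)=[\psi,v](a_{k+1}^+)$ (all values being one-sided limits).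 Denote this operator by $L_S$ for $k=2$, and by $\tilde L_S$ for $k=1$. Let $$(H_Tf)(x)=\frac1\pi\,\mathrm{p.v.}\!\int_{a_2}^{a_4}\frac{f(y)}{y-x}\,dy,\qquad x\in(a_1,a_3).$$ **Proposition.** Let $f_n\neq0$ be an eigenfunction of $L_S$, $L_Sf_n=\lambda_nf_n$. Then the principal value $(H_Tf_n)(x)$ exists for every $x\in(a_1,a_2)\cup(a_2,a_3)$, $H_Tf_n$ is a nonzero element of $L^2(a_1,a_3)$, and the function $g_n=H_Tf_n/\|H_Tf_n\|_{L^2(a_1,a_3)}$ lies in the domain of $\tilde L_S$ and is an eigenfunction of $\tilde L_S$ with the same eigenvalue: $\tilde L_Sg_n=\lambda_ng_n$. Moreover, $g_n$ is bounded near $a_1$ and near $a_3$, and at $a_2$ it has a logarithmic singularity with continuous coefficients: there are functions $p_1,p_2,q_1,q_2$, analytic at $a_2$, with $g_n(x)=p_1(x)+p_2(x)\ln|x-a_2|$ for $x<a_2$ near $a_2$, $g_n(x)=q_1(x)+q_2(x)\ln|x-a_2|$ for $x>a_2$ near $a_2$, $p_1(a_2)=q_1(a_2)$ and $p_2(a_2)=q_2(a_2)\ne0$.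 -/

import Mathlib

open Set Filter Topology MeasureTheory

namespace TruncHilbert

noncomputable section

/-- The quartic `P(x) = ∏ (x - a_i)`. The points `a_1 < a_2 < a_3 < a_4` of the text are the values
`a 0, a 1, a 2, a 3` of `a : Fin 4 → ℝ`. -/
def P (a : Fin 4 → ℝ) (x : ℝ) : ℝ := ∏ i, (x - a i)

/-- The mean `σ` of the four points. -/
def sigma (a : Fin 4 → ℝ) : ℝ := (∑ i, a i) / 4

/-- The quasi-derivative `P ψ'`. -/
def quasiDeriv (a : Fin 4 → ℝ) (ψ : ℝ → ℂ) (x : ℝ) : ℂ := (P a x : ℂ) * deriv ψ x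

/-- The differential expression `L ψ = (P ψ')' + 2 (x - σ)² ψ`. -/
def L (a : Fin 4 → ℝ) (ψ : ℝ → ℂ) (x : ℝ) : ℂ :=
  deriv (quasiDeriv a ψ) x + 2 * ((x - sigma a : ℝ) : ℂ) ^ 2 * ψ x

/-- `AC_loc` of the open interval `(l, r)`: absolute continuity on all compact subintervals. -/
def ACLoc (f : ℝ → ℂ) (l r : ℝ) : Prop :=
  ∀ c d : ℝ, l < c → c ≤ d → d < r → AbsolutelyContinuousOnInterval f c d

/-- The maximal domain of `L` on the interval `(l, r)`. Only the values of `ψ` on `(l, r)`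
matter. -/
def DMax (a : Fin 4 → ℝ) (l r : ℝ) : Set (ℝ → ℂ) :=
  {ψ | ACLoc ψ l r ∧ ACLoc (quasiDeriv a ψ) l r ∧
    MemLp ψ 2 (volume.restrict (Ioo l r)) ∧ MemLp (L a ψ) 2 (volume.restrict (Ioo l r))}

/-- The Lagrange sesquilinear form `[u, v] = u P v̄' - v̄ P u'`. -/
def lagrange (a : Fin 4 → ℝ) (u v : ℝ → ℂ) (x : ℝ) : ℂ :=
  u x * quasiDeriv a (fun y => starRingEnd ℂ (v y)) x
    - starRingEnd ℂ (v x) * quasiDeriv a u x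

/-- The maximal domain function `u = 1`. -/
def uFun : ℝ → ℂ := fun _ => 1

/-- The maximal domain function `v(y) = ∑_i ∏_{j ≠ i} (a_i - a_j)⁻¹ ln |y - a_i|`. -/
def vFun (a : Fin 4 → ℝ) (y : ℝ) : ℂ :=
  ((∑ i, (∏ j ∈ Finset.univ.erase i, 1 / (a i - a j)) * Real.log |y - a i| : ℝ) : ℂ)

/-- The domain of the self-adjoint realization of `L` on `(l, m) ∪ (m, r)`, where `l < m < r` are
three consecutive points among the `a_i`: functions that lie in the maximal domain on both
subintervals and satisfy the boundary conditions at `l⁺`, `r⁻` and the transmission conditions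
at `m`. -/
def SADomain (a : Fin 4 → ℝ) (l m r : ℝ) : Set (ℝ → ℂ) :=
  {ψ | ψ ∈ DMax a l m ∧ ψ ∈ DMax a m r ∧
    Tendsto (lagrange a ψ uFun) (𝓝[>] l) (𝓝 0) ∧
    Tendsto (lagrange a ψ uFun) (𝓝[<] r) (𝓝 0) ∧
    (∃ c : ℂ, Tendsto (lagrange a ψ uFun) (𝓝[<] m) (𝓝 c) ∧
      Tendsto (lagrange a ψ uFun) (𝓝[>] m) (𝓝 c)) ∧
    (∃ c : ℂ, Tendsto (lagrange a ψ (vFun a)) (𝓝[<] m) (𝓝 c) ∧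
      Tendsto (lagrange a ψ (vFun a)) (𝓝[>] m) (𝓝 c))}

/-- `ψ` is an eigenfunction, with eigenvalue `ev`, of the realization of `L` with domain
`SADomain a l m r`: it lies in the domain, is not the zero element of `L²(l, r)`, and
`L ψ = ev ψ` in `L²(l, r)`. -/
def IsEigenfunction (a : Fin 4 → ℝ) (l m r : ℝ) (ev : ℂ) (ψ : ℝ → ℂ) : Prop :=
  ψ ∈ SADomain a l m r ∧
    ¬ ψ =ᵐ[volume.restrict (Ioo l r)] 0 ∧
    L a ψ =ᵐ[volume.restrict (Ioo l r)] fun x => ev * ψ x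

/-- Eigenfunctions of `L_S`, which acts in `L²(a_2, a_4)`. -/
def IsEigenfunctionLS (a : Fin 4 → ℝ) (ev : ℂ) (ψ : ℝ → ℂ) : Prop :=
  IsEigenfunction a (a 1) (a 2) (a 3) ev ψ

/-- Eigenfunctions of `L̃_S`, which acts in `L²(a_1, a_3)`. -/
def IsEigenfunctionLSTilde (a : Fin 4 → ℝ) (ev : ℂ) (ψ : ℝ → ℂ) : Prop :=
  IsEigenfunction a (a 0) (a 1) (a 2) ev ψ

/-- `(1/π) ∫ f(y) / (y - x) dy` over `y ∈ (a_2, a_4)` with `|y - x| ≥ ε`. -/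
def truncIntegral (a : Fin 4 → ℝ) (f : ℝ → ℂ) (x ε : ℝ) : ℂ :=
  (1 / Real.pi : ℝ) * ∫ y in {y : ℝ | y ∈ Ioo (a 1) (a 3) ∧ ε ≤ |y - x|}, f y / ((y - x : ℝ) : ℂ)

/-- The truncated Hilbert transform with overlap,
`(H_T f)(x) = (1/π) p.v. ∫_{a_2}^{a_4} f(y) / (y - x) dy`, to be considered for
`x ∈ (a_1, a_3)`. -/
def HT (a : Fin 4 → ℝ) (f : ℝ → ℂ) (x : ℝ) : ℂ :=
  limUnder (𝓝[>] (0 : ℝ)) (truncIntegral a f x)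

/-- The norm of `L²(a_1, a_3)`. -/
def normL2 (a : Fin 4 → ℝ) (g : ℝ → ℂ) : ℝ :=
  (eLpNorm g 2 (volume.restrict (Ioo (a 0) (a 2)))).toReal

/-- The normalized image `g = H_T f / ‖H_T f‖`. -/
def normalizedHT (a : Fin 4 → ℝ) (f : ℝ → ℂ) (x : ℝ) : ℂ :=
  HT a f x / (normL2 a (HT a f) : ℂ)

/-- `g` has a logarithmic singularity at `c` and satisfies the transmission conditions there: to the
left of `c`, `g = p₁ + p₂ ln |x - c|`, and to the right, `g = q₁ + q₂ ln |x - c|`, with functions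
`p₁, p₂, q₁, q₂` analytic at `c`, such that the bounded parts `p₁, q₁` and the factors `p₂, q₂` of
the logarithm agree at `c`, the common value of the latter being nonzero. -/
def HasLogSingularity (g : ℝ → ℂ) (c : ℝ) : Prop :=
  ∃ p₁ p₂ q₁ q₂ : ℝ → ℂ,
    AnalyticAt ℝ p₁ c ∧ AnalyticAt ℝ p₂ c ∧ AnalyticAt ℝ q₁ c ∧ AnalyticAt ℝ q₂ c ∧
    (∀ᶠ x in 𝓝[<] c, g x = p₁ x + p₂ x * (Real.log |x - c| : ℝ)) ∧
    (∀ᶠ x in 𝓝[>] c, g x = q₁ x + q₂ x * (Real.log |x - c| : ℝ)) ∧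
    p₁ c = q₁ c ∧ p₂ c = q₂ c ∧ p₂ c ≠ 0

end

end TruncHilbert

namespace TruncHilbert

noncomputable section

/-! The transform is studied through the Cauchy integral `G` of `f`, extended by zero outside `(a 1,
a 3)`. The kernel `1 / (y - z)` is annihilated by `L_z - L_y` (`kernel_identity`), so `L` can be
moved from `z` to `y` and, by Green's formula on the two subintervals, onto `f`. The boundary terms
contain `P f` and `P f'`. The first tends to zero at every endpoint; the second vanishes at `a 1`
and `a 3` and cancels at `a 2`, by the conditions on `[f, u]`. Hence `L G = ev G` off the real axis
(`IsEigenfunctionLS.isSol_cauchy`). By Sokhotski–Plemelj (`exists_plemelj`), the boundary values of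
`G` are `g ± i f` with `g = H_T f`.

Near a zero `c = a i` of `P` the equation has a regular singular point with double exponent zero.
With `φ` the analytic solution, every solution is `φ (A + B T)`, where `T = (log (z - c) + H) /
P'(c)` and `H` is analytic. This holds for `G` in each half plane with the matching branch of the
logarithm. Half the sum and half the difference of the two boundary values give `g = φ (αg + βg τ)`
and `f = φ (αf + βf τ)` to the right of `c`. To the left the branches contribute `±iπ`, so `αg`
changes by `-π βf / P'(c)` and `αf` by `π βg / P'(c)`, while `βg`, `βf` are unchanged
(`IsBoundaryPair.exists_local_form`). By `IsLocalSol.tendsto_lagrange`, `[·, u]` reads off the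
coefficient `β` and `[·, v]` reads off `α` up to a multiple of `β` that is the same on both sides.

This coupling decides everything. A logarithm in `g` is the same thing as a jump of `[f, v]`. There
is no jump at `a 0`, where `f` vanishes on both sides, nor at `a 2`, by the transmission condition,
so `g` is regular at both. At `a 1` the function `f` vanishes on the left, hence `βf = 0`, and `g`
has the same coefficients on both sides, which are the transmission conditions for `g`. If `βg` were
zero there, `f` would vanish to the right of `a 1`, hence on `(a 1, a 2)` by analyticity; the
condition on `[f, v]` at `a 2` carries this over to `(a 2, a 3)`, contradicting `f ≠ 0`
(`IsEigenfunctionLS.exists_log_form`). -/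

/-! ### Regularity: weak solutions are classical -/

lemma AbsolutelyContinuousOnInterval.of_dist_le {X Y : Type*} [PseudoMetricSpace X]
    [PseudoMetricSpace Y] {f : ℝ → X} {g : ℝ → Y} {c d : ℝ}
    (hf : AbsolutelyContinuousOnInterval f c d) (h : ∀ x y, dist (g x) (g y) ≤ dist (f x) (f y)) :
    AbsolutelyContinuousOnInterval g c d :=
  squeeze_zero (fun _ => Finset.sum_nonneg fun _ _ => dist_nonneg)
    (fun _ => Finset.sum_le_sum fun _ _ => h _ _) hf

lemma AbsolutelyContinuousOnInterval.ae_differentiableAt_complex {f : ℝ → ℂ} {c d : ℝ}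
    (hf : AbsolutelyContinuousOnInterval f c d) :
    ∀ᵐ x : ℝ, x ∈ uIcc c d → DifferentiableAt ℝ f x := by
  have hre : AbsolutelyContinuousOnInterval (fun x => (f x).re) c d :=
    AbsolutelyContinuousOnInterval.of_dist_le hf fun x y => by
      rw [Real.dist_eq, ← Complex.sub_re, dist_eq_norm]; exact Complex.abs_re_le_norm _
  have him : AbsolutelyContinuousOnInterval (fun x => (f x).im) c d :=
    AbsolutelyContinuousOnInterval.of_dist_le hf fun x y => by
      rw [Real.dist_eq, ← Complex.sub_im, dist_eq_norm]; exact Complex.abs_im_le_norm _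
  filter_upwards [hre.ae_differentiableAt, him.ae_differentiableAt] with x h1 h2 hx
  have e : f = fun x => ((f x).re : ℂ) + ((f x).im : ℂ) * Complex.I := by
    funext y; exact (Complex.re_add_im _).symm
  rw [e]
  have h1' := (h1 hx).hasDerivAt.ofReal_comp
  have h2' := (h2 hx).hasDerivAt.ofReal_comp
  exact (h1'.add (h2'.mul_const Complex.I)).differentiableAt

/-- A locally absolutely continuous function with almost everywhere continuous derivative is
continuously differentiable. -/
lemma ACLoc.hasDerivAt {f h : ℝ → ℂ} {l r : ℝ} (hf : ACLoc f l r)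
    (hh : ContinuousOn h (Ioo l r)) (hd : ∀ᵐ x ∂volume.restrict (Ioo l r), deriv f x = h x)
    {x : ℝ} (hx : x ∈ Ioo l r) : HasDerivAt f (h x) x := by
  obtain ⟨c, hlc, hcx⟩ := exists_between hx.1
  obtain ⟨d, hxd, hdr⟩ := exists_between hx.2
  have hcd : c < d := hcx.trans hxd
  have hsub : Icc c d ⊆ Ioo l r := fun y hy => ⟨hlc.trans_le hy.1, hy.2.trans_lt hdr⟩
  have hhc : ContinuousOn h (Icc c d) := hh.mono hsub
  have hF : ∀ y ∈ Ioo c d, HasDerivAt (fun y => ∫ t in c..y, h t) (h y) y := by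
    intro y hy
    have hsm : StronglyMeasurableAtFilter h (𝓝 y) volume :=
      (hh.mono (Ioo_subset_Icc_self.trans hsub)).stronglyMeasurableAtFilter isOpen_Ioo y hy
    exact intervalIntegral.integral_hasDerivAt_right
      ((hhc.mono (Icc_subset_Icc_right hy.2.le)).intervalIntegrable_of_Icc hy.1.le) hsm
      (hhc.continuousAt (Icc_mem_nhds hy.1 hy.2))
  have hac : AbsolutelyContinuousOnInterval f c d := hf c d hlc hcd.le hdr
  -- The difference of `f` and a primitive of `h` is absolutely continuous with derivative zero
  -- almost everywhere, hence constant.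
  have key : ∀ y z, c < y → y ≤ z → z < d →
      f y - (∫ t in c..y, h t) = f z - ∫ t in c..z, h t := by
    intro y z hy hyz hz
    have hFac : AbsolutelyContinuousOnInterval (fun y => ∫ t in c..y, h t) y z := by
      apply ContDiffOn.absolutelyContinuousOnInterval
      rw [uIcc_of_le hyz]
      have hs : Icc y z ⊆ Ioo c d := fun t ht => ⟨hy.trans_le ht.1, ht.2.trans_lt hz⟩
      refine ContDiffOn.mono ?_ hs
      rw [contDiffOn_one_iff_derivWithin (uniqueDiffOn_Ioo c d)]
      refine ⟨fun t ht => (hF t ht).differentiableAt.differentiableWithinAt, ?_⟩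
      exact (hhc.mono Ioo_subset_Icc_self).congr fun t ht =>
        (hF t ht).hasDerivWithinAt.derivWithin (uniqueDiffOn_Ioo c d t ht)
    have hsubac := (hf y z (hlc.trans hy) hyz (hz.trans hdr)).sub hFac
    obtain ⟨C, hC⟩ := hsubac.const_of_ae_hasDerivAt_zero (by
      rw [ae_restrict_iff' measurableSet_Ioo] at hd
      filter_upwards [AbsolutelyContinuousOnInterval.ae_differentiableAt_complex hac, hd]
        with t ht1 ht2 ht
      rw [uIcc_of_le hyz] at ht
      have htcd : t ∈ Ioo c d := ⟨hy.trans_le ht.1, ht.2.trans_lt hz⟩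
      have h1 := (ht1 (by rw [uIcc_of_le hcd.le]; exact Ioo_subset_Icc_self htcd)).hasDerivAt
      rw [ht2 (hsub (Ioo_subset_Icc_self htcd))] at h1
      simpa using h1.sub (hF t htcd))
    rw [uIcc_of_le hyz] at hC
    exact (hC y ⟨le_rfl, hyz⟩).trans (hC z ⟨hyz, le_rfl⟩).symm
  have hev : f =ᶠ[𝓝 x] fun y => (∫ t in c..y, h t) + (f x - ∫ t in c..x, h t) := by
    filter_upwards [Ioo_mem_nhds hcx hxd] with y hy
    rcases le_total x y with hxy | hxy
    · rw [key x y hcx hxy hy.2]; ring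
    · rw [← key y x hy.1 hxy hxd]; ring
  exact ((hF x ⟨hcx, hxd⟩).add_const _).congr_of_eventuallyEq hev

lemma P_ne_zero_iff {a : Fin 4 → ℝ} {x : ℝ} : P a x ≠ 0 ↔ ∀ i, x ≠ a i := by
  simp [P, Finset.prod_ne_zero_iff, sub_ne_zero]

lemma continuous_P (a : Fin 4 → ℝ) : Continuous (P a) := by
  unfold P; fun_prop

/-- On an interval free of zeros of `P`, the elements of the maximal domain that satisfy
`L ψ = ev ψ` almost everywhere are classical solutions. -/
lemma DMax.hasDerivAt {a : Fin 4 → ℝ} {l r : ℝ} {ψ : ℝ → ℂ} {ev : ℂ} (hψ : ψ ∈ DMax a l r)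
    (hP : ∀ x ∈ Ioo l r, P a x ≠ 0)
    (hL : L a ψ =ᵐ[volume.restrict (Ioo l r)] fun x => ev * ψ x) {x : ℝ} (hx : x ∈ Ioo l r) :
    HasDerivAt ψ (quasiDeriv a ψ x / P a x) x ∧
      HasDerivAt (quasiDeriv a ψ) ((ev - 2 * ((x : ℂ) - sigma a) ^ 2) * ψ x) x := by
  have hcont : ∀ f : ℝ → ℂ, ACLoc f l r → ContinuousOn f (Ioo l r) := by
    intro f hf x hx
    obtain ⟨c, hlc, hcx⟩ := exists_between hx.1
    obtain ⟨d, hxd, hdr⟩ := exists_between hx.2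
    have h := (hf c d hlc (hcx.trans hxd).le hdr).continuousOn
    rw [uIcc_of_le (hcx.trans hxd).le] at h
    exact (h.continuousAt (Icc_mem_nhds hcx hxd)).continuousWithinAt
  have hPc : ContinuousOn (fun x => (P a x : ℂ)) (Ioo l r) :=
    (Complex.continuous_ofReal.comp (continuous_P a)).continuousOn
  have hP' : ∀ x ∈ Ioo l r, (P a x : ℂ) ≠ 0 := fun x hx => by exact_mod_cast hP x hx
  refine ⟨hψ.1.hasDerivAt (h := fun x => quasiDeriv a ψ x / P a x)
    ((hcont _ hψ.2.1).div hPc hP') ?_ hx,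
    hψ.2.1.hasDerivAt (h := fun x => (ev - 2 * ((x : ℂ) - sigma a) ^ 2) * ψ x)
      (ContinuousOn.mul (by fun_prop) (hcont _ hψ.1)) ?_ hx⟩
  -- This holds at every point of the interval, by definition of `quasiDeriv`; only the second
  -- equation uses `L ψ = ev ψ`.
  · filter_upwards [ae_restrict_mem measurableSet_Ioo] with y hy
    rw [quasiDeriv, mul_div_cancel_left₀ _ (hP' y hy)]
  · filter_upwards [hL] with y hy
    rw [L] at hy
    push_cast at hy
    linear_combination hy

/-! ### Cauchy integrals and the Sokhotski–Plemelj formulas -/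

/-- The Cauchy integral `(1/π) ∫ f(y) / (y - z) dy`. -/
def cauchy (f : ℝ → ℂ) (z : ℂ) : ℂ := (1 / Real.pi : ℝ) * ∫ y : ℝ, f y / ((y : ℂ) - z)

/-- A primitive is `log (t² + η²) / 2 + i arctan (t / η)`, and its first term is even, so it drops
out on a symmetric interval. As `η → 0±` the remaining term tends to `±iπ`, the jump in the Plemelj
formulas. -/
lemma integral_inv_sub_mul_I {δ η : ℝ} (hδ : 0 < δ) (hη : η ≠ 0) (x : ℝ) :
    ∫ y in Icc (x - δ) (x + δ), (1 : ℂ) / ((y : ℂ) - (x + η * Complex.I)) =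
      2 * Complex.I * (Real.arctan (δ / η) : ℝ) := by
  have hpos : ∀ t : ℝ, 0 < t ^ 2 + η ^ 2 := fun t => by positivity
  have hne : ∀ t : ℝ, (t : ℂ) - η * Complex.I ≠ 0 := by
    intro t h
    have := congrArg Complex.im h
    simp at this
    exact hη this
  have hd : ∀ t : ℝ, HasDerivAt (fun t : ℝ => ((1 / 2 * Real.log (t ^ 2 + η ^ 2) : ℝ) : ℂ) +
      ((Real.arctan (t / η) : ℝ) : ℂ) * Complex.I) (1 / ((t : ℂ) - η * Complex.I)) t := by
    intro t
    have h1 : HasDerivAt (fun t : ℝ => 1 / 2 * Real.log (t ^ 2 + η ^ 2))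
        (t / (t ^ 2 + η ^ 2)) t := by
      have := ((((hasDerivAt_id t).pow 2).add_const (η ^ 2)).log (hpos t).ne').const_mul (1 / 2)
      refine this.congr_deriv ?_
      have := (hpos t).ne'
      simp
      field_simp
    have h2 : HasDerivAt (fun t : ℝ => Real.arctan (t / η)) (η / (t ^ 2 + η ^ 2)) t := by
      refine (((hasDerivAt_id t).div_const η).arctan).congr_deriv ?_
      have := (hpos t).ne'
      simp only [id]
      have h3 : 1 + (t / η) ^ 2 ≠ 0 := by positivity
      field_simp
      ring
    refine (h1.ofReal_comp.add (h2.ofReal_comp.mul_const Complex.I)).congr_deriv ?_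
    have h3 : ((t ^ 2 + η ^ 2 : ℝ) : ℂ) ≠ 0 := by exact_mod_cast (hpos t).ne'
    have h4 := hne t
    push_cast at h3 ⊢
    rw [div_mul_eq_mul_div, ← add_div, div_eq_div_iff h3 h4]
    linear_combination (-(η : ℂ) ^ 2) * Complex.I_sq
  have hint : ∫ t in (-δ)..δ, (1 : ℂ) / ((t : ℂ) - η * Complex.I) =
      2 * Complex.I * (Real.arctan (δ / η) : ℝ) := by
    rw [intervalIntegral.integral_eq_sub_of_hasDerivAt (fun t _ => hd t)]
    · rw [neg_div, Real.arctan_neg, neg_sq]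
      push_cast
      ring
    · apply Continuous.intervalIntegrable
      exact continuous_const.div (by fun_prop) hne
  rw [integral_Icc_eq_integral_Ioc, ← intervalIntegral.integral_of_le (by linarith), ← hint]
  have := intervalIntegral.integral_comp_sub_right (a := x - δ) (b := x + δ)
    (fun t : ℝ => (1 : ℂ) / ((t : ℂ) - η * Complex.I)) x
  rw [show x - δ - x = -δ by ring, show x + δ - x = δ by ring] at this
  rw [← this]
  congr 1
  funext y
  push_cast
  ring

lemma norm_sub_le_norm_sub_mul_I (x y η : ℝ) :
    ‖((y - x : ℝ) : ℂ)‖ ≤ ‖(y : ℂ) - (x + η * Complex.I)‖ := by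
  have := Complex.abs_re_le_norm ((y : ℂ) - (x + η * Complex.I))
  rw [Complex.norm_real, Real.norm_eq_abs]
  simpa using this

lemma ofReal_sub_ne_zero {z : ℂ} (hz : z.im ≠ 0) (y : ℝ) : (y : ℂ) - z ≠ 0 := by
  intro h
  have := congrArg Complex.im h
  simp at this
  exact hz this

/-- Existence of the principal value and the Sokhotski–Plemelj formulas at a point of
differentiability. -/
lemma exists_plemelj {f : ℝ → ℂ} (hf : Integrable f) {x : ℝ} (hx : DifferentiableAt ℝ f x) :
    ∃ g : ℂ,
      Tendsto (fun ε : ℝ => ((1 / Real.pi : ℝ) : ℂ) *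
        ∫ y in {y : ℝ | ε ≤ |y - x|}, f y / ((y - x : ℝ) : ℂ)) (𝓝[>] 0) (𝓝 g) ∧
      Tendsto (fun η : ℝ => cauchy f (x + η * Complex.I)) (𝓝[>] 0) (𝓝 (g + Complex.I * f x)) ∧
      Tendsto (fun η : ℝ => cauchy f (x - η * Complex.I)) (𝓝[>] 0)
        (𝓝 (g - Complex.I * f x)) := by
  obtain ⟨C, hC⟩ := hx.isBigO_sub.bound
  obtain ⟨δ, hδ, hball⟩ := Metric.eventually_nhds_iff.1 hC
  set S : Set ℝ := Icc (x - δ / 2) (x + δ / 2) with hS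
  have hδ2 : 0 < δ / 2 := by linarith
  have hSm : MeasurableSet S := measurableSet_Icc
  have hSmem : ∀ y, y ∈ S ↔ |y - x| ≤ δ / 2 := by
    intro y; rw [hS, mem_Icc, abs_le]; constructor <;> rintro ⟨h1, h2⟩ <;> constructor <;> linarith
  -- The value `f x` is subtracted on a window symmetric about `x`. The quotient `ρ` of the
  -- remainder by `y - x` is integrable: differentiability bounds it inside the window, and outside
  -- `|y - x|` is bounded below. For `e` itself the truncated integral vanishes by symmetry and the
  -- Cauchy integral is an explicit arctangent.
  set e : ℝ → ℂ := S.indicator fun _ => f x with he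
  set ρ : ℝ → ℂ := fun y => (f y - e y) / ((y - x : ℝ) : ℂ) with hρ
  have heq : ∀ y, f y = ρ y * ((y - x : ℝ) : ℂ) + e y := by
    intro y
    by_cases hy : y = x
    · subst hy
      have : y ∈ S := by rw [hSmem]; simp; linarith
      simp [he, this]
    · have : ((y - x : ℝ) : ℂ) ≠ 0 := by exact_mod_cast sub_ne_zero.2 hy
      rw [hρ]; field_simp; ring
  have heint : Integrable e := (integrable_indicator_iff hSm).2 (by simp [hS])
  have hρm : AEStronglyMeasurable ρ := by
    simp_rw [hρ, div_eq_mul_inv]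
    exact (hf.aestronglyMeasurable.sub heint.aestronglyMeasurable).mul
      (by fun_prop : Measurable fun y : ℝ => ((y - x : ℝ) : ℂ)⁻¹).aestronglyMeasurable
  have hρint : Integrable ρ := by
    refine Integrable.mono' (g := fun y => S.indicator (fun _ => |C|) y + ‖f y‖ * (δ / 2)⁻¹)
      (((integrable_indicator_iff hSm).2 (by simp [hS])).add (hf.norm.mul_const _)) hρm ?_
    refine Eventually.of_forall fun y => ?_
    have hn : ‖ρ y‖ = ‖f y - e y‖ / |y - x| := by
      rw [hρ]; simp only [norm_div, Complex.norm_real, Real.norm_eq_abs]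
    rw [hn]
    by_cases hy : y ∈ S
    · have h1 : ‖f y - f x‖ ≤ C * ‖y - x‖ :=
        hball (by rw [Real.dist_eq]; have := (hSmem y).1 hy; linarith)
      simp only [he, indicator_of_mem hy]
      have h2 : ‖f y - f x‖ / |y - x| ≤ |C| := by
        apply div_le_of_le_mul₀ (abs_nonneg _) (abs_nonneg _)
        rw [Real.norm_eq_abs] at h1
        exact h1.trans (mul_le_mul_of_nonneg_right (le_abs_self _) (abs_nonneg _))
      have h3 : 0 ≤ ‖f y‖ * (δ / 2)⁻¹ := by positivity
      linarith
    · simp only [he, indicator_of_notMem hy, sub_zero, zero_add]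
      rw [div_eq_mul_inv]
      rw [hSmem, not_le] at hy
      gcongr
  have hcau : ∀ η : ℝ, η ≠ 0 → cauchy f (x + η * Complex.I) = ((1 / Real.pi : ℝ) : ℂ) *
      ((∫ y : ℝ, ρ y * (((y - x : ℝ) : ℂ) / ((y : ℂ) - (x + η * Complex.I)))) +
        f x * (2 * Complex.I * (Real.arctan (δ / 2 / η) : ℝ))) := by
    intro η hη
    have hz : ((x : ℂ) + η * Complex.I).im ≠ 0 := by simpa using hη
    have hne := ofReal_sub_ne_zero hz
    have hcont : Continuous fun y : ℝ => ((y : ℂ) - (x + η * Complex.I)) := by fun_prop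
    rw [cauchy, ← integral_inv_sub_mul_I hδ2 hη x, ← integral_const_mul (f x),
      ← integral_indicator hSm, ← integral_add]
    · congr 1
      refine integral_congr_ae (Eventually.of_forall fun y => ?_)
      dsimp only
      have := hne y
      rw [heq y]
      by_cases hy : y ∈ S
      · simp only [he, indicator_of_mem hy]; field_simp
      · simp only [he, indicator_of_notMem hy]; field_simp; ring
    · refine hρint.mul_bdd (c := 1) ?_ (Eventually.of_forall fun y => ?_)
      · exact ((Complex.continuous_ofReal.comp (continuous_id.sub continuous_const)).div hcont
          hne).aestronglyMeasurable
      · rw [norm_div]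
        exact div_le_one_of_le₀ (norm_sub_le_norm_sub_mul_I x y η) (norm_nonneg _)
    · rw [integrable_indicator_iff hSm]
      apply ContinuousOn.integrableOn_Icc
      exact (continuous_const.mul (continuous_const.div hcont hne)).continuousOn
  -- Dominated by `‖ρ‖`, because `|y - x| ≤ |y - z|` for `z` on the vertical line through `x`.
  have hlim : ∀ u : ℝ → ℝ, Tendsto u (𝓝[>] 0) (𝓝 0) →
      Tendsto (fun η : ℝ => ∫ y : ℝ, ρ y * (((y - x : ℝ) : ℂ) /
        ((y : ℂ) - (x + u η * Complex.I)))) (𝓝[>] 0) (𝓝 (∫ y, ρ y)) := by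
    intro u hu
    refine tendsto_integral_filter_of_dominated_convergence (fun y => ‖ρ y‖) ?_ ?_ hρint.norm ?_
    · refine Eventually.of_forall fun η => hρm.mul ?_
      apply Measurable.aestronglyMeasurable
      fun_prop
    · refine Eventually.of_forall fun η => Eventually.of_forall fun y => ?_
      rw [norm_mul]
      refine mul_le_of_le_one_right (norm_nonneg _) ?_
      rw [norm_div]
      exact div_le_one_of_le₀ (norm_sub_le_norm_sub_mul_I x y _) (norm_nonneg _)
    · have : ∀ᵐ y : ℝ, y ≠ x := by simp [ae_iff]
      filter_upwards [this] with y hy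
      have hyx : ((y - x : ℝ) : ℂ) ≠ 0 := by exact_mod_cast sub_ne_zero.2 hy
      have h1 : Tendsto (fun η => (y : ℂ) - (x + u η * Complex.I)) (𝓝[>] 0)
          (𝓝 ((y - x : ℝ) : ℂ)) := by
        have h2 : Tendsto (fun η => (u η : ℂ)) (𝓝[>] 0) (𝓝 ((0 : ℝ) : ℂ)) :=
          (Complex.continuous_ofReal.tendsto _).comp hu
        have h3 := ((h2.mul_const Complex.I).const_add (x : ℂ)).const_sub (y : ℂ)
        simpa using h3
      have h4 := ((tendsto_const_nhds (x := ((y - x : ℝ) : ℂ))).div h1 hyx).const_mul (ρ y)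
      rwa [div_self hyx, mul_one] at h4
  have hinv : Tendsto (fun η : ℝ => δ / 2 / η) (𝓝[>] 0) atTop := by
    simpa [div_eq_mul_inv] using (tendsto_inv_nhdsGT_zero (𝕜 := ℝ)).const_mul_atTop hδ2
  have harc : Tendsto (fun η : ℝ => Real.arctan (δ / 2 / η)) (𝓝[>] 0) (𝓝 (Real.pi / 2)) :=
    (Real.tendsto_arctan_atTop.mono_right nhdsWithin_le_nhds).comp hinv
  have hpi : (Real.pi : ℂ) ≠ 0 := by exact_mod_cast Real.pi_ne_zero
  have hid : Tendsto (fun η : ℝ => η) (𝓝[>] 0) (𝓝 0) := nhdsWithin_le_nhds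
  -- Both sides of the axis at once: the sign survives only through the oddness of the arctangent.
  have hsgn : ∀ s : ℝ, s = 1 ∨ s = -1 → Tendsto (fun η : ℝ => cauchy f (x + (s * η : ℝ) *
      Complex.I)) (𝓝[>] 0) (𝓝 (((1 / Real.pi : ℝ) : ℂ) * (∫ y, ρ y) + s * Complex.I * f x)) := by
    intro s hs
    have hs0 : s ≠ 0 := by rcases hs with h | h <;> rw [h] <;> norm_num
    have h1 := hlim (fun η => s * η) (by simpa using hid.const_mul s)
    have h2 : Tendsto (fun η : ℝ => (((Real.arctan (δ / 2 / (s * η)) : ℝ)) : ℂ)) (𝓝[>] 0)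
        (𝓝 ((s * (Real.pi / 2) : ℝ) : ℂ)) := by
      refine (Complex.continuous_ofReal.tendsto _).comp ?_
      refine (harc.const_mul s).congr fun η => ?_
      rcases hs with h | h <;> rw [h]
      · simp
      · rw [neg_one_mul, neg_one_mul, div_neg, Real.arctan_neg]
    have h3 := (h1.add ((h2.const_mul (2 * Complex.I)).const_mul (f x))).const_mul
      ((1 / Real.pi : ℝ) : ℂ)
    have h4 : ((1 / Real.pi : ℝ) : ℂ) * ((∫ y, ρ y) + f x * (2 * Complex.I *
        ((s * (Real.pi / 2) : ℝ) : ℂ))) = ((1 / Real.pi : ℝ) : ℂ) * (∫ y, ρ y) +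
        s * Complex.I * f x := by
      push_cast; field_simp
    rw [h4] at h3
    refine h3.congr' ?_
    filter_upwards [self_mem_nhdsWithin] with η hη
    exact (hcau (s * η) (mul_ne_zero hs0 (ne_of_gt hη))).symm
  refine ⟨((1 / Real.pi : ℝ) : ℂ) * ∫ y, ρ y, ?_, ?_, ?_⟩
  · refine Tendsto.const_mul _ ?_
    have hset : ∀ ε : ℝ, MeasurableSet {y : ℝ | ε ≤ |y - x|} := fun ε =>
      measurableSet_le measurable_const (by fun_prop)
    have h1 : Tendsto (fun ε : ℝ => ∫ y in {y : ℝ | ε ≤ |y - x|}, ρ y) (𝓝[>] 0)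
        (𝓝 (∫ y, ρ y)) := by
      simp_rw [← integral_indicator (hset _)]
      refine tendsto_integral_filter_of_dominated_convergence (fun y => ‖ρ y‖) ?_ ?_ hρint.norm ?_
      · exact Eventually.of_forall fun ε => hρm.indicator (hset ε)
      · exact Eventually.of_forall fun ε => Eventually.of_forall fun y =>
          norm_indicator_le_norm_self _ _
      · have : ∀ᵐ y : ℝ, y ≠ x := by simp [ae_iff]
        filter_upwards [this] with y hy
        apply tendsto_const_nhds.congr'
        filter_upwards [nhdsWithin_le_nhds (Iio_mem_nhds (abs_pos.2 (sub_ne_zero.2 hy)))] with ε hε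
        rw [indicator_of_mem]
        exact (mem_Iio.1 hε).le
    refine h1.congr' ?_
    filter_upwards [self_mem_nhdsWithin] with ε hε
    have hε : 0 < ε := hε
    set q : ℝ → ℂ := {y : ℝ | ε ≤ |y - x|}.indicator fun y => e y / ((y - x : ℝ) : ℂ) with hq
    -- Reflection in `x` preserves `e` and the truncation and changes the sign of `y - x`, so `q`
    -- integrates to zero and only `ρ` contributes to the principal value.
    have hodd : ∀ y, q (2 * x - y) = -q y := by
      intro y
      have h1 : |2 * x - y - x| = |y - x| := by rw [← abs_neg]; congr 1; ring
      have h2 : e (2 * x - y) = e y := by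
        simp only [he, indicator, hSmem, h1]
      have h3 : 2 * x - y - x = -(y - x) := by ring
      simp only [hq, indicator, mem_ofPred_eq, h1, h2]
      split_ifs
      · rw [h3]; push_cast; rw [div_neg]
      · simp
    have hq0 : ∫ y, q y = 0 := by
      have h1 := integral_sub_left_eq_self q volume (2 * x)
      simp only [hodd, integral_neg] at h1
      exact self_eq_neg.1 h1.symm
    have hqint : Integrable q := by
      refine Integrable.mono' (heint.norm.mul_const ε⁻¹) ?_ (Eventually.of_forall fun y => ?_)
      · refine AEStronglyMeasurable.indicator ?_ (hset ε)
        simp_rw [div_eq_mul_inv]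
        exact heint.aestronglyMeasurable.mul
          (by fun_prop : Measurable fun y : ℝ => ((y - x : ℝ) : ℂ)⁻¹).aestronglyMeasurable
      · simp only [hq, indicator, mem_ofPred_eq]
        split_ifs with h
        · rw [norm_div, Complex.norm_real, Real.norm_eq_abs, div_eq_mul_inv]
          gcongr
        · simp; positivity
    have hρε : IntegrableOn ρ {y : ℝ | ε ≤ |y - x|} := hρint.integrableOn
    calc ∫ y in {y : ℝ | ε ≤ |y - x|}, ρ y
        = (∫ y in {y : ℝ | ε ≤ |y - x|}, ρ y) +
          ∫ y in {y : ℝ | ε ≤ |y - x|}, e y / ((y - x : ℝ) : ℂ) := by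
          rw [← integral_indicator (f := fun y => e y / ((y - x : ℝ) : ℂ)) (hset ε), hq0, add_zero]
      _ = ∫ y in {y : ℝ | ε ≤ |y - x|}, (ρ y + e y / ((y - x : ℝ) : ℂ)) :=
          (integral_add hρε ((integrable_indicator_iff (hset ε)).1 hqint)).symm
      _ = ∫ y in {y : ℝ | ε ≤ |y - x|}, f y / ((y - x : ℝ) : ℂ) := by
          refine setIntegral_congr_fun (hset ε) fun y hy => ?_
          have hy0 : y - x ≠ 0 := abs_pos.1 (hε.trans_le hy)
          have : ((y - x : ℝ) : ℂ) ≠ 0 := by exact_mod_cast hy0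
          simp only [hρ]
          field_simp
          ring
  · refine (hsgn 1 (Or.inl rfl)).congr' ?_ |>.trans (by simp)
    filter_upwards with η
    rw [one_mul]
  · have h := hsgn (-1) (Or.inr rfl)
    have e1 : ((1 / Real.pi : ℝ) : ℂ) * (∫ y, ρ y) + ((-1 : ℝ) : ℂ) * Complex.I * f x =
        ((1 / Real.pi : ℝ) : ℂ) * (∫ y, ρ y) - Complex.I * f x := by push_cast; ring
    rw [e1] at h
    refine h.congr fun η => ?_
    congr 1
    push_cast
    ring

/-! ### The kernel identity and Green's formula -/

/-- The quartic `P` on the complex plane. -/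
def Pc (a : Fin 4 → ℝ) (z : ℂ) : ℂ := ∏ i, (z - a i)

/-- The derivative of the quartic. -/
def dPc (a : Fin 4 → ℝ) (z : ℂ) : ℂ :=
  ∑ i, ∏ j ∈ Finset.univ.erase i, (z - a j)

lemma Pc_ofReal (a : Fin 4 → ℝ) (x : ℝ) : Pc a x = P a x := by
  simp [Pc, P]

lemma hasDerivAt_Pc (a : Fin 4 → ℝ) (z : ℂ) : HasDerivAt (Pc a) (dPc a z) z := by
  have := HasDerivAt.fun_finsetProd (u := Finset.univ) (f := fun i (z : ℂ) => z - a i)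
    (f' := fun _ => 1) (x := z) (fun i _ => (hasDerivAt_id z).sub_const _)
  change HasDerivAt (fun z => ∏ i, (z - (a i : ℂ))) _ z
  simpa [dPc] using this

lemma Pc_ne_zero_iff {a : Fin 4 → ℝ} {z : ℂ} : Pc a z ≠ 0 ↔ ∀ i, z ≠ a i := by
  simp [Pc, Finset.prod_ne_zero_iff, sub_ne_zero]

lemma Pc_ne_zero_of_im {a : Fin 4 → ℝ} {z : ℂ} (hz : z.im ≠ 0) : Pc a z ≠ 0 :=
  Pc_ne_zero_iff.2 fun i h => hz (by rw [h]; simp)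

lemma dPc_eq (a : Fin 4 → ℝ) (z : ℂ) : dPc a z =
    (z - a 1) * (z - a 2) * (z - a 3) + (z - a 0) * (z - a 2) * (z - a 3) +
    (z - a 0) * (z - a 1) * (z - a 3) + (z - a 0) * (z - a 1) * (z - a 2) := by
  have h0 : (Finset.univ.erase 0 : Finset (Fin 4)) = {1, 2, 3} := by decide
  have h1 : (Finset.univ.erase 1 : Finset (Fin 4)) = {0, 2, 3} := by decide
  have h2 : (Finset.univ.erase 2 : Finset (Fin 4)) = {0, 1, 3} := by decide
  have h3 : (Finset.univ.erase 3 : Finset (Fin 4)) = {0, 1, 2} := by decide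
  rw [dPc, Fin.sum_univ_four, h0, h1, h2, h3]
  simp
  ring

/-- The kernel `1 / (y - z)` satisfies `L_z k = L_y k`. -/
lemma kernel_identity (a : Fin 4 → ℝ) {y z : ℂ} (h : y - z ≠ 0) :
    Pc a z * (2 / (y - z) ^ 3) + dPc a z * (1 / (y - z) ^ 2) + 2 * (z - sigma a) ^ 2 / (y - z) =
    Pc a y * (2 / (y - z) ^ 3) - dPc a y * (1 / (y - z) ^ 2) + 2 * (y - sigma a) ^ 2 / (y - z) := by
  -- The identity is the error formula of the trapezoidal rule for the cubic `P'` between `z` and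
  -- `y`: the error is a multiple of `P'''` at the midpoint, and `P''' = 24 (x - σ)` precisely
  -- because `σ` is the mean of the zeros. This fixes the potential `2 (x - σ)²`.
  rw [dPc_eq, dPc_eq, Pc, Pc, Fin.prod_univ_four, Fin.prod_univ_four, sigma, Fin.sum_univ_four]
  push_cast
  field_simp
  ring

/-- `(s, w)` is a solution on `U` of the first order system `s' = w / P`,
`w' = (ev - 2 (z - σ)²) s`, which is equivalent to `L s = ev s`. -/
def IsSol (a : Fin 4 → ℝ) (ev : ℂ) (U : Set ℂ) (s w : ℂ → ℂ) : Prop :=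
  ∀ z ∈ U, HasDerivAt s (w z / Pc a z) z ∧
    HasDerivAt w ((ev - 2 * (z - sigma a) ^ 2) * s z) z

/-- A disc of half the distance to the real axis stays away from that axis by the other half. This
supplies the uniform majorant for differentiation under the integral. -/
lemma le_norm_sub_of_mem_ball {z z₀ : ℂ} (hz : z ∈ Metric.ball z₀ (|z₀.im| / 2)) (y : ℝ) :
    |z₀.im| / 2 ≤ ‖(y : ℂ) - z‖ := by
  have h1 := Complex.abs_im_le_norm (z - z₀)
  have h2 : ‖z - z₀‖ < |z₀.im| / 2 := by simpa [dist_eq_norm] using hz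
  have h3 := Complex.abs_im_le_norm ((y : ℂ) - z)
  simp only [Complex.sub_im, Complex.ofReal_im, zero_sub, abs_neg] at h1 h3
  have h4 := abs_sub_abs_le_abs_sub z₀.im z.im
  rw [abs_sub_comm] at h4
  linarith

lemma integrable_div_sub_pow {f : ℝ → ℂ} (hf : Integrable f) {z : ℂ} (hz : z.im ≠ 0) (n : ℕ) :
    Integrable fun y : ℝ => f y / ((y : ℂ) - z) ^ n := by
  have hpos : 0 < |z.im| / 2 := by positivity
  simp_rw [div_eq_mul_inv]
  refine hf.mul_bdd (c := ((|z.im| / 2) ^ n)⁻¹) ?_ (Eventually.of_forall fun y => ?_)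
  · exact (by fun_prop : Measurable fun y : ℝ => (((y : ℂ) - z) ^ n)⁻¹).aestronglyMeasurable
  · rw [norm_inv, norm_pow]
    exact inv_anti₀ (by positivity) (pow_le_pow_left₀ hpos.le
      (le_norm_sub_of_mem_ball (Metric.mem_ball_self hpos) y) n)

lemma hasDerivAt_integral_div_sub_pow {f : ℝ → ℂ} (hf : Integrable f) {z : ℂ} (hz : z.im ≠ 0)
    (n : ℕ) : HasDerivAt (fun z : ℂ => ∫ y : ℝ, f y / ((y : ℂ) - z) ^ n)
      (n * ∫ y : ℝ, f y / ((y : ℂ) - z) ^ (n + 1)) z := by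
  have hpos : 0 < |z.im| / 2 := by positivity
  have him : ∀ x ∈ Metric.ball z (|z.im| / 2), ∀ y : ℝ, (y : ℂ) - x ≠ 0 := by
    intro x hx y h
    have := le_norm_sub_of_mem_ball hx y
    rw [h, norm_zero] at this
    linarith
  have hmeas : ∀ (x : ℂ) (m : ℕ), AEStronglyMeasurable (fun y : ℝ => f y / ((y : ℂ) - x) ^ m) := by
    intro x m
    simp_rw [div_eq_mul_inv]
    exact hf.aestronglyMeasurable.mul
      (by fun_prop : Measurable fun y : ℝ => (((y : ℂ) - x) ^ m)⁻¹).aestronglyMeasurable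
  have := (hasDerivAt_integral_of_dominated_loc_of_deriv_le
    (F := fun (x : ℂ) (y : ℝ) => f y / ((y : ℂ) - x) ^ n)
    (F' := fun (x : ℂ) (y : ℝ) => n * (f y / ((y : ℂ) - x) ^ (n + 1)))
    (bound := fun y => n * (‖f y‖ * ((|z.im| / 2) ^ (n + 1))⁻¹))
    (Metric.ball_mem_nhds z hpos) (Eventually.of_forall fun x => hmeas x n)
    (integrable_div_sub_pow hf hz n) ((hmeas z (n + 1)).const_mul _)
    (Eventually.of_forall fun y x hx => ?_) ((hf.norm.mul_const _).const_mul _)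
    (Eventually.of_forall fun y x hx => ?_)).2
  · rwa [integral_const_mul] at this
  · rw [norm_mul, norm_div, norm_pow, Complex.norm_natCast, div_eq_mul_inv]
    gcongr
    exact le_norm_sub_of_mem_ball hx y
  · have h0 := him x hx y
    have h1 := ((((hasDerivAt_id x).const_sub (y : ℂ)).pow n).fun_inv
      (pow_ne_zero n h0)).const_mul (f y)
    simp only [id] at h1
    refine (h1.congr_of_eventuallyEq (Eventually.of_forall fun _ => div_eq_mul_inv _ _)).congr_deriv
      ?_
    rcases n with _ | n
    · simp
    · simp only [Nat.add_sub_cancel, Pi.pow_apply]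
      field_simp
      ring

/-- Green's formula for a solution of `L f = ev f` and the kernel `1 / (y - z)` on an interval. -/
lemma integral_green {a : Fin 4 → ℝ} {ev : ℂ} {l r : ℝ} (hlr : l < r) {f w : ℝ → ℂ}
    (hsol : ∀ x ∈ Ioo l r, HasDerivAt f (w x / P a x) x ∧
      HasDerivAt w ((ev - 2 * ((x : ℂ) - sigma a) ^ 2) * f x) x)
    (hP : ∀ x ∈ Ioo l r, P a x ≠ 0)
    (hf : IntegrableOn f (Ioo l r)) {wl wr : ℂ}
    (hwl : Tendsto w (𝓝[>] l) (𝓝 wl)) (hwr : Tendsto w (𝓝[<] r) (𝓝 wr))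
    (hfl : Tendsto (fun x => (P a x : ℂ) * f x) (𝓝[>] l) (𝓝 0))
    (hfr : Tendsto (fun x => (P a x : ℂ) * f x) (𝓝[<] r) (𝓝 0)) {z : ℂ} (hz : z.im ≠ 0) :
    ∫ y in Ioo l r, f y * (Pc a y * (2 / ((y : ℂ) - z) ^ 3) - dPc a y * (1 / ((y : ℂ) - z) ^ 2) +
      2 * ((y : ℂ) - sigma a) ^ 2 / ((y : ℂ) - z) - ev / ((y : ℂ) - z)) =
      wl / ((l : ℂ) - z) - wr / ((r : ℂ) - z) := by
  have hne := ofReal_sub_ne_zero hz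
  -- `B = f P k' - k w` with `k = 1 / (y - z)`, the concomitant of `f` and `k`. Its derivative is `f
  -- L k - k L f`, which is the integrand since `L f = ev f`.
  set B : ℝ → ℂ := fun y => -((P a y : ℂ) * f y) / ((y : ℂ) - z) ^ 2 - w y / ((y : ℂ) - z) with hB
  have hcinv : ∀ n : ℕ, Continuous fun y : ℝ => (((y : ℂ) - z) ^ n)⁻¹ := fun n =>
    (by fun_prop : Continuous fun y : ℝ => ((y : ℂ) - z) ^ n).inv₀ fun y => pow_ne_zero n (hne y)
  have hlim : ∀ (F : Filter ℝ) (c : ℝ) (v : ℂ), F ≤ 𝓝 c → Tendsto w F (𝓝 v) →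
      Tendsto (fun x => (P a x : ℂ) * f x) F (𝓝 0) → Tendsto B F (𝓝 (-v / ((c : ℂ) - z))) := by
    intro F c v hF hw hPf
    have h1 := (hPf.neg).mul (((hcinv 2).tendsto c).mono_left hF)
    have h2 := hw.mul (((hcinv 1).tendsto c).mono_left hF)
    have h3 := h1.sub h2
    simp only [neg_zero, pow_one, ← div_eq_mul_inv] at h3
    rw [zero_div, zero_sub, ← neg_div] at h3
    exact h3
  have hderiv : ∀ x ∈ Ioo l r, HasDerivAt B (f x * (Pc a x * (2 / ((x : ℂ) - z) ^ 3) -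
      dPc a x * (1 / ((x : ℂ) - z) ^ 2) + 2 * ((x : ℂ) - sigma a) ^ 2 / ((x : ℂ) - z) -
      ev / ((x : ℂ) - z))) x := by
    intro x hx
    obtain ⟨h1, h2⟩ := hsol x hx
    have hPd : HasDerivAt (fun x : ℝ => (P a x : ℂ)) (dPc a x) x := by
      have := (hasDerivAt_Pc a x).comp_ofReal
      simpa only [Pc_ofReal] using this
    have hk : HasDerivAt (fun x : ℝ => (x : ℂ) - z) 1 x := (hasDerivAt_id x).ofReal_comp.sub_const z
    have h3 := (((hPd.mul h1).neg.div (hk.pow 2) (pow_ne_zero 2 (hne x)))).sub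
      (h2.div hk (hne x))
    refine h3.congr_deriv ?_
    have h0 := hne x
    have hPx : (P a x : ℂ) ≠ 0 := by exact_mod_cast hP x hx
    simp only [Pc_ofReal, Pi.neg_apply, Pi.mul_apply, Pi.pow_apply]
    field_simp
    ring
  have hint : IntervalIntegrable (fun x : ℝ => f x * (Pc a x * (2 / ((x : ℂ) - z) ^ 3) -
      dPc a x * (1 / ((x : ℂ) - z) ^ 2) + 2 * ((x : ℂ) - sigma a) ^ 2 / ((x : ℂ) - z) -
      ev / ((x : ℂ) - z))) volume l r := by
    rw [intervalIntegrable_iff_integrableOn_Ioo_of_le hlr.le]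
    have hc1 : Continuous fun x : ℝ => Pc a x := by unfold Pc; fun_prop
    have hc2 : Continuous fun x : ℝ => dPc a x := by unfold dPc; fun_prop
    have hc : Continuous fun x : ℝ => (Pc a x * (2 / ((x : ℂ) - z) ^ 3) -
      dPc a x * (1 / ((x : ℂ) - z) ^ 2) + 2 * ((x : ℂ) - sigma a) ^ 2 / ((x : ℂ) - z) -
      ev / ((x : ℂ) - z)) := by
      have := hcinv 1
      have := hcinv 2
      have := hcinv 3
      simp only [pow_one, div_eq_mul_inv, one_mul] at *
      fun_prop
    obtain ⟨C, hC⟩ := isCompact_Icc.exists_bound_of_continuousOn (s := Icc l r) hc.continuousOn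
    refine Integrable.mul_bdd (c := C) hf hc.aestronglyMeasurable ?_
    filter_upwards [ae_restrict_mem measurableSet_Ioo] with x hx
    exact hC x (Ioo_subset_Icc_self hx)
  have h := intervalIntegral.integral_eq_sub_of_hasDerivAt_of_tendsto hlr hderiv hint
    (hlim _ l wl nhdsWithin_le_nhds hwl hfl) (hlim _ r wr nhdsWithin_le_nhds hwr hfr)
  rw [intervalIntegral.integral_of_le hlr.le, integral_Ioc_eq_integral_Ioo] at h
  rw [h]
  ring

/-! ### Vanishing of `P f` at the zeros of `P` -/

/-- If `(x - c) f'(x)` stays bounded as `x → c⁺`, then `(x - c) f(x) → 0`. -/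
lemma tendsto_sub_mul_nhdsGT {f f' : ℝ → ℂ} {c r C : ℝ} (hr : c < r)
    (hd : ∀ x ∈ Ioo c r, HasDerivAt f (f' x) x)
    (hb : ∀ᶠ x in 𝓝[>] c, ‖((x - c : ℝ) : ℂ) * f' x‖ ≤ C) :
    Tendsto (fun x : ℝ => ((x - c : ℝ) : ℂ) * f x) (𝓝[>] c) (𝓝 0) := by
  obtain ⟨b₀, hb₀, hC⟩ := (mem_nhdsGT_iff_exists_Ioo_subset' hr).1 hb
  have hb₀ : c < b₀ := hb₀
  rw [Metric.tendsto_nhds]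
  intro ε hε
  have hCp : 0 < |C| + 1 := by positivity
  -- On `[x, b]` the derivative is at most `|C| / (x - c)`, so after multiplication by `x - c` the
  -- mean value inequality costs at most `|C| (b - c)`. The first entry of the minimum makes this at
  -- most `ε / 2`; the `+ 1` avoids division by zero. With `b` fixed, the term `(x - c) ‖f b‖` tends
  -- to zero.
  set b := min (c + ε / 2 / (|C| + 1)) (min ((c + b₀) / 2) ((c + r) / 2)) with hbdef
  have hcb : c < b := by
    refine lt_min ?_ (lt_min (by linarith) (by linarith))
    have : 0 < ε / 2 / (|C| + 1) := by positivity
    linarith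
  have hbb₀ : b < b₀ := ((min_le_right _ _).trans (min_le_left _ _)).trans_lt (by linarith)
  have hbr : b < r := ((min_le_right _ _).trans (min_le_right _ _)).trans_lt (by linarith)
  have hbε : (|C| + 1) * (b - c) ≤ ε / 2 := by
    have : b ≤ c + ε / 2 / (|C| + 1) := min_le_left _ _
    rw [mul_comm, ← le_div_iff₀ hCp]
    linarith
  have h0 : Tendsto (fun x : ℝ => (x - c) * ‖f b‖) (𝓝[>] c) (𝓝 0) := by
    have : Tendsto (fun x : ℝ => (x - c) * ‖f b‖) (𝓝 c) (𝓝 ((c - c) * ‖f b‖)) :=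
      ((continuous_id.sub continuous_const).mul continuous_const).tendsto c
    simpa using this.mono_left nhdsWithin_le_nhds
  filter_upwards [Ioo_mem_nhdsGT hcb, h0.eventually (gt_mem_nhds (half_pos hε))] with x hx hx2
  have hxc : 0 < x - c := by linarith [hx.1]
  have hmv : ‖f b - f x‖ ≤ (|C| / (x - c)) * ‖b - x‖ := by
    refine (convex_Icc x b).norm_image_sub_le_of_norm_hasDerivWithin_le (f' := f')
      (fun t ht => (hd t ⟨by linarith [ht.1, hx.1], by linarith [ht.2]⟩).hasDerivWithinAt)
      (fun t ht => ?_) ⟨le_rfl, hx.2.le⟩ ⟨hx.2.le, le_rfl⟩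
    have htc : 0 < t - c := by linarith [ht.1]
    have h1 : ‖((t - c : ℝ) : ℂ) * f' t‖ ≤ C := hC ⟨by linarith, by linarith [ht.2]⟩
    rw [norm_mul, Complex.norm_real, Real.norm_eq_abs, abs_of_pos htc] at h1
    have h2 : ‖f' t‖ ≤ |C| / (t - c) := by
      rw [le_div_iff₀ htc, mul_comm]; exact h1.trans (le_abs_self _)
    exact h2.trans (div_le_div_of_nonneg_left (abs_nonneg _) hxc (by linarith [ht.1]))
  rw [dist_zero_right, norm_mul, Complex.norm_real, Real.norm_eq_abs, abs_of_pos hxc]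
  have h3 : ‖f x‖ ≤ ‖f b‖ + |C| / (x - c) * (b - x) := by
    have h4 := norm_sub_norm_le (f x) (f b)
    rw [norm_sub_rev] at h4
    rw [Real.norm_eq_abs, abs_of_pos (show 0 < b - x by linarith [hx.2])] at hmv
    linarith
  calc (x - c) * ‖f x‖ ≤ (x - c) * (‖f b‖ + |C| / (x - c) * (b - x)) := by gcongr
    _ = (x - c) * ‖f b‖ + |C| * (b - x) := by field_simp
    _ ≤ (x - c) * ‖f b‖ + (|C| + 1) * (b - c) := by
        have : |C| * (b - x) ≤ (|C| + 1) * (b - c) :=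
          mul_le_mul (by linarith) (by linarith) (by linarith [hx.2]) hCp.le
        linarith
    _ < ε := by linarith

lemma tendsto_sub_mul_nhdsLT {f f' : ℝ → ℂ} {c l C : ℝ} (hl : l < c)
    (hd : ∀ x ∈ Ioo l c, HasDerivAt f (f' x) x)
    (hb : ∀ᶠ x in 𝓝[<] c, ‖((x - c : ℝ) : ℂ) * f' x‖ ≤ C) :
    Tendsto (fun x : ℝ => ((x - c : ℝ) : ℂ) * f x) (𝓝[<] c) (𝓝 0) := by
  have hneg : Tendsto (fun x : ℝ => -x) (𝓝[>] (-c)) (𝓝[<] c) := by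
    simpa using tendsto_neg_nhdsGT (a := -c)
  have hneg' : Tendsto (fun x : ℝ => -x) (𝓝[<] c) (𝓝[>] (-c)) := tendsto_neg_nhdsLT
  have h := tendsto_sub_mul_nhdsGT (f := fun x => f (-x)) (f' := fun x => -f' (-x)) (c := -c)
    (r := -l) (C := C) (by linarith) (fun x hx => ?_) ?_
  · refine ((h.comp hneg').neg.congr fun x => ?_).trans (by simp)
    simp only [Function.comp, neg_neg]
    push_cast
    ring
  · have := (hd (-x) ⟨by linarith [hx.2], by linarith [hx.1]⟩).scomp x (hasDerivAt_neg x)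
    simpa [Function.comp_def] using this
  · filter_upwards [hneg.eventually hb] with x hx
    convert hx using 2
    push_cast
    ring

lemma dPc_ne_zero {a : Fin 4 → ℝ} (ha : StrictMono a) (i : Fin 4) : dPc a (a i) ≠ 0 := by
  have h01 := ha (show (0 : Fin 4) < 1 by decide)
  have h12 := ha (show (1 : Fin 4) < 2 by decide)
  have h23 := ha (show (2 : Fin 4) < 3 by decide)
  have key : ∀ x y : ℝ, x ≠ y → ((x : ℂ) - y) ≠ 0 := fun x y h =>
    sub_ne_zero.2 (by exact_mod_cast h)
  rw [dPc_eq]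
  fin_cases i <;> simp only [Fin.zero_eta, Fin.mk_one, Fin.reduceFinMk, sub_self, zero_mul,
    mul_zero, add_zero, zero_add] <;>
  exact mul_ne_zero (mul_ne_zero (key _ _ (by linarith)) (key _ _ (by linarith)))
    (key _ _ (by linarith))

lemma tendsto_P_div (a : Fin 4 → ℝ) (i : Fin 4) :
    Tendsto (fun x : ℝ => (P a x : ℂ) / ((x - a i : ℝ) : ℂ)) (𝓝[≠] (a i)) (𝓝 (dPc a (a i))) := by
  have h1 : HasDerivAt (fun x : ℝ => (P a x : ℂ)) (dPc a (a i)) (a i) := by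
    simpa only [Pc_ofReal] using (hasDerivAt_Pc a (a i)).comp_ofReal
  have h2 := hasDerivAt_iff_tendsto_slope.1 h1
  have h3 : P a (a i) = 0 := Finset.prod_eq_zero (Finset.mem_univ i) (sub_self _)
  refine h2.congr fun x => ?_
  rw [slope_def_module, h3, Complex.ofReal_zero, sub_zero, Complex.real_smul, Complex.ofReal_inv,
    inv_mul_eq_div]

/-- The zeros of `P` are simple, so `P` and `x - a i` are interchangeable up to a factor with
nonzero limit. This converts information on `P f'` and `P f` into the form of the estimates for `x -
c`. -/
lemma tendsto_P_mul_aux {a : Fin 4 → ℝ} (ha : StrictMono a) {i : Fin 4} {f w : ℝ → ℂ} {wl : ℂ}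
    {F : Filter ℝ} (hF : F ≤ 𝓝[≠] (a i)) (hw : Tendsto w F (𝓝 wl)) :
    (∃ C, ∀ᶠ x in F, ‖((x - a i : ℝ) : ℂ) * (w x / P a x)‖ ≤ C) ∧
    (Tendsto (fun x : ℝ => ((x - a i : ℝ) : ℂ) * f x) F (𝓝 0) →
      Tendsto (fun x => (P a x : ℂ) * f x) F (𝓝 0)) := by
  have hq := (tendsto_P_div a i).mono_left hF
  constructor
  · have h1 := (hw.div hq (dPc_ne_zero ha i)).norm
    obtain ⟨C, hC⟩ := h1.isBoundedUnder_le
    refine ⟨C, ?_⟩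
    filter_upwards [hC] with x hx
    refine le_trans (le_of_eq ?_) hx
    simp only [Pi.div_apply]
    congr 1
    rw [div_div_eq_mul_div]
    ring
  · intro h
    have h1 := hq.mul h
    rw [mul_zero] at h1
    refine h1.congr' ?_
    filter_upwards [hF self_mem_nhdsWithin] with x hx
    have : ((x - a i : ℝ) : ℂ) ≠ 0 := by exact_mod_cast sub_ne_zero.2 hx
    field_simp

/-- A finite limit of `P f'` bounds `(x - a i) f'`, which forces `(x - a i) f → 0`. This removes the
terms with `P f` from Green's formula. -/
lemma tendsto_P_mul_nhdsGT {a : Fin 4 → ℝ} (ha : StrictMono a) {i : Fin 4} {r : ℝ} (hr : a i < r)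
    {f w : ℝ → ℂ} {wl : ℂ} (hd : ∀ x ∈ Ioo (a i) r, HasDerivAt f (w x / P a x) x)
    (hw : Tendsto w (𝓝[>] (a i)) (𝓝 wl)) :
    Tendsto (fun x => (P a x : ℂ) * f x) (𝓝[>] (a i)) (𝓝 0) := by
  obtain ⟨⟨C, hC⟩, h⟩ := tendsto_P_mul_aux ha (f := f)
    (nhdsWithin_mono _ fun x (hx : a i < x) => ne_of_gt hx) hw
  exact h (tendsto_sub_mul_nhdsGT hr hd hC)

lemma tendsto_P_mul_nhdsLT {a : Fin 4 → ℝ} (ha : StrictMono a) {i : Fin 4} {l : ℝ} (hl : l < a i)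
    {f w : ℝ → ℂ} {wl : ℂ} (hd : ∀ x ∈ Ioo l (a i), HasDerivAt f (w x / P a x) x)
    (hw : Tendsto w (𝓝[<] (a i)) (𝓝 wl)) :
    Tendsto (fun x => (P a x : ℂ) * f x) (𝓝[<] (a i)) (𝓝 0) := by
  obtain ⟨⟨C, hC⟩, h⟩ := tendsto_P_mul_aux ha (f := f)
    (nhdsWithin_mono _ fun x (hx : x < a i) => ne_of_lt hx) hw
  exact h (tendsto_sub_mul_nhdsLT hl hd hC)

/-! ### Eigenfunctions of `L_S` and the equation for their Cauchy integrals -/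

lemma lagrange_uFun (a : Fin 4 → ℝ) (ψ : ℝ → ℂ) :
    lagrange a ψ uFun = fun x => -quasiDeriv a ψ x := by
  funext x
  simp [lagrange, uFun, quasiDeriv]

lemma P_ne_zero_of_mem {a : Fin 4 → ℝ} (ha : StrictMono a) {x : ℝ} (h : x ∈ Ioo (a 0) (a 1) ∨
    x ∈ Ioo (a 1) (a 2) ∨ x ∈ Ioo (a 2) (a 3)) : P a x ≠ 0 := by
  have h01 := ha (show (0 : Fin 4) < 1 by decide)
  have h12 := ha (show (1 : Fin 4) < 2 by decide)
  have h23 := ha (show (2 : Fin 4) < 3 by decide)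
  rw [P_ne_zero_iff]
  simp only [mem_Ioo] at h
  intro i hi
  fin_cases i <;> simp at hi <;> rcases h with h | h | h <;> linarith

/-- The extension of `f` by zero from `(a_2, a_4)` to the real line. -/
def zeroExt (a : Fin 4 → ℝ) (f : ℝ → ℂ) : ℝ → ℂ := (Ioo (a 1) (a 3)).indicator f

lemma IsEigenfunctionLS.hasDerivAt {a : Fin 4 → ℝ} (ha : StrictMono a) {ev : ℂ} {f : ℝ → ℂ}
    (hf : IsEigenfunctionLS a ev f) {x : ℝ} (hx : x ∈ Ioo (a 1) (a 2) ∨ x ∈ Ioo (a 2) (a 3)) :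
    HasDerivAt f (quasiDeriv a f x / P a x) x ∧
      HasDerivAt (quasiDeriv a f) ((ev - 2 * ((x : ℂ) - sigma a) ^ 2) * f x) x := by
  have h12 := ha (show (1 : Fin 4) < 2 by decide)
  have h23 := ha (show (2 : Fin 4) < 3 by decide)
  obtain ⟨⟨h1, h2, -⟩, -, hL⟩ := hf
  rcases hx with hx | hx
  · exact DMax.hasDerivAt h1 (fun x hx => P_ne_zero_of_mem ha (Or.inr (Or.inl hx)))
      (ae_mono (Measure.restrict_mono (Ioo_subset_Ioo_right h23.le) le_rfl) hL) hx
  · exact DMax.hasDerivAt h2 (fun x hx => P_ne_zero_of_mem ha (Or.inr (Or.inr hx)))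
      (ae_mono (Measure.restrict_mono (Ioo_subset_Ioo_left h12.le) le_rfl) hL) hx

lemma IsEigenfunctionLS.differentiableAt_zeroExt {a : Fin 4 → ℝ} (ha : StrictMono a) {ev : ℂ} {f : ℝ → ℂ}
    (hf : IsEigenfunctionLS a ev f) {x : ℝ} (hx : P a x ≠ 0) :
    DifferentiableAt ℝ (zeroExt a f) x := by
  rw [P_ne_zero_iff] at hx
  have h13 := ha (show (1 : Fin 4) < 3 by decide)
  by_cases hmem : x ∈ Ioo (a 1) (a 3)
  · have : zeroExt a f =ᶠ[𝓝 x] f := by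
      filter_upwards [isOpen_Ioo.mem_nhds hmem] with y hy
      exact indicator_of_mem hy f
    refine DifferentiableAt.congr_of_eventuallyEq ?_ this
    rcases lt_or_gt_of_ne (hx 2) with h | h
    · exact (hf.hasDerivAt ha (Or.inl ⟨hmem.1, h⟩)).1.differentiableAt
    · exact (hf.hasDerivAt ha (Or.inr ⟨h, hmem.2⟩)).1.differentiableAt
  · have hmem' : x ∉ Icc (a 1) (a 3) := fun h =>
      hmem ⟨lt_of_le_of_ne h.1 (hx 1).symm, lt_of_le_of_ne h.2 (hx 3)⟩
    have : zeroExt a f =ᶠ[𝓝 x] fun _ => 0 := by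
      filter_upwards [isClosed_Icc.isOpen_compl.mem_nhds hmem'] with y hy
      exact indicator_of_notMem (fun h => hy (Ioo_subset_Icc_self h)) f
    exact (differentiableAt_const _).congr_of_eventuallyEq this

lemma Ioo_ae_eq_union {l m r : ℝ} (h1 : l < m) (h2 : m < r) :
    (Ioo l r : Set ℝ) =ᵐ[volume] (Ioo l m ∪ Ioo m r : Set ℝ) := by
  have : ∀ᵐ y : ℝ, y ≠ m := by simp [ae_iff]
  filter_upwards [this] with y hy
  apply propext
  change y ∈ Ioo l r ↔ y ∈ (Ioo l m ∪ Ioo m r : Set ℝ)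
  simp only [mem_Ioo, mem_union]
  constructor
  · rintro ⟨h3, h4⟩
    rcases lt_or_gt_of_ne hy with h | h
    · exact Or.inl ⟨h3, h⟩
    · exact Or.inr ⟨h, h4⟩
  · rintro (⟨h3, h4⟩ | ⟨h3, h4⟩) <;> constructor <;> linarith

lemma IsEigenfunctionLS.integrableOn {a : Fin 4 → ℝ} {ev : ℂ} {f : ℝ → ℂ}
    (hf : IsEigenfunctionLS a ev f) :
    IntegrableOn f (Ioo (a 1) (a 2)) ∧ IntegrableOn f (Ioo (a 2) (a 3)) :=
  ⟨hf.1.1.2.2.1.integrable (by norm_num), hf.1.2.1.2.2.1.integrable (by norm_num)⟩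

lemma IsEigenfunctionLS.integrable_zeroExt {a : Fin 4 → ℝ} (ha : StrictMono a) {ev : ℂ} {f : ℝ → ℂ}
    (hf : IsEigenfunctionLS a ev f) : Integrable (zeroExt a f) := by
  have h12 := ha (show (1 : Fin 4) < 2 by decide)
  have h23 := ha (show (2 : Fin 4) < 3 by decide)
  obtain ⟨h1, h2⟩ := hf.integrableOn
  rw [zeroExt, integrable_indicator_iff measurableSet_Ioo, IntegrableOn,
    Measure.restrict_congr_set (Ioo_ae_eq_union h12 h23)]
  exact h1.union h2

/-- The Cauchy integral of an eigenfunction solves the differential equation off the real axis. -/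
lemma IsEigenfunctionLS.isSol_cauchy {a : Fin 4 → ℝ} (ha : StrictMono a) {ev : ℂ} {f : ℝ → ℂ}
    (hf : IsEigenfunctionLS a ev f) : ∃ W : ℂ → ℂ,
    IsSol a ev {z | z.im ≠ 0} (cauchy (zeroExt a f)) W := by
  have hI := hf.integrable_zeroExt ha
  obtain ⟨hI1, hI2⟩ := hf.integrableOn
  have h12 := ha (show (1 : Fin 4) < 2 by decide)
  have h23 := ha (show (2 : Fin 4) < 3 by decide)
  obtain ⟨hb1, hb3, ⟨c, hc1, hc2⟩, -⟩ := hf.1.2.2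
  simp only [lagrange_uFun] at hb1 hb3 hc1 hc2
  have neg_lim : ∀ (F : Filter ℝ) (c : ℂ), Tendsto (fun x => -quasiDeriv a f x) F (𝓝 c) →
      Tendsto (quasiDeriv a f) F (𝓝 (-c)) := fun F c h => by simpa using h.neg
  replace hb1 := neg_lim _ _ hb1
  replace hb3 := neg_lim _ _ hb3
  replace hc1 := neg_lim _ _ hc1
  replace hc2 := neg_lim _ _ hc2
  set F := zeroExt a f with hF
  have hpow : ∀ (z : ℂ) (n : ℕ), z.im ≠ 0 → HasDerivAt
      (fun z : ℂ => ((1 / Real.pi : ℝ) : ℂ) * ∫ y : ℝ, F y / ((y : ℂ) - z) ^ n)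
      (((1 / Real.pi : ℝ) : ℂ) * (n * ∫ y : ℝ, F y / ((y : ℂ) - z) ^ (n + 1))) z :=
    fun z n hz => (hasDerivAt_integral_div_sub_pow hI hz n).const_mul _
  have hcau : cauchy F = fun z : ℂ => ((1 / Real.pi : ℝ) : ℂ) *
      ∫ y : ℝ, F y / ((y : ℂ) - z) ^ 1 := by
    funext z; simp only [cauchy, pow_one]
  refine ⟨fun z => Pc a z * (((1 / Real.pi : ℝ) : ℂ) * ∫ y : ℝ, F y / ((y : ℂ) - z) ^ 2),
    fun z hz => ?_⟩
  have hz : z.im ≠ 0 := hz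
  constructor
  · rw [hcau, mul_div_cancel_left₀ _ (Pc_ne_zero_of_im hz)]
    simpa using hpow z 1 hz
  · refine ((hasDerivAt_Pc a z).mul (hpow z 2 hz)).congr_deriv ?_
    have hne := ofReal_sub_ne_zero hz
    -- Green's formula on both subintervals: the limits of `P f'` at `a 1` and `a 3` are zero, and
    -- the two contributions at `a 2` cancel because `[f, u]` is continuous there. The condition on
    -- `[f, v]` plays no role here.
    have key : (∫ y : ℝ, F y * (Pc a y * (2 / ((y : ℂ) - z) ^ 3) -
        dPc a y * (1 / ((y : ℂ) - z) ^ 2) + 2 * ((y : ℂ) - sigma a) ^ 2 / ((y : ℂ) - z) -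
        ev / ((y : ℂ) - z))) = 0 := by
      have hmul : ∀ K : ℝ → ℂ, (fun y => F y * K y) =
          (Ioo (a 1) (a 3)).indicator fun y => f y * K y := by
        intro K; funext y; by_cases hy : y ∈ Ioo (a 1) (a 3) <;> simp [hF, zeroExt, hy]
      -- The kernel identity replaces the coefficients in `y` by coefficients in `z`, which are
      -- constants for this integral.
      have hint : Integrable fun y : ℝ => F y * (Pc a y * (2 / ((y : ℂ) - z) ^ 3) -
        dPc a y * (1 / ((y : ℂ) - z) ^ 2) + 2 * ((y : ℂ) - sigma a) ^ 2 / ((y : ℂ) - z) -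
        ev / ((y : ℂ) - z)) := by
        have h := (((integrable_div_sub_pow hI hz 3).const_mul (2 * Pc a z)).add
          ((integrable_div_sub_pow hI hz 2).const_mul (dPc a z))).add
          ((integrable_div_sub_pow hI hz 1).const_mul (2 * (z - sigma a) ^ 2 - ev))
        refine h.congr (Eventually.of_forall fun y => ?_)
        have hk := kernel_identity a (hne y)
        simp only [Pi.add_apply, pow_one]
        linear_combination (F y) * hk
      rw [hmul] at hint ⊢
      rw [integrable_indicator_iff measurableSet_Ioo, IntegrableOn,
        Measure.restrict_congr_set (Ioo_ae_eq_union h12 h23)] at hint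
      rw [integral_indicator measurableSet_Ioo,
        setIntegral_congr_set (Ioo_ae_eq_union h12 h23), setIntegral_union _ measurableSet_Ioo
          (IntegrableOn.mono_set hint subset_union_left)
          (IntegrableOn.mono_set hint subset_union_right)]
      · have hs1 := fun x hx => hf.hasDerivAt ha (x := x) (Or.inl hx)
        have hs2 := fun x hx => hf.hasDerivAt ha (x := x) (Or.inr hx)
        rw [integral_green h12 hs1
            (fun x hx => P_ne_zero_of_mem ha (Or.inr (Or.inl hx))) hI1 hb1 hc1
            (tendsto_P_mul_nhdsGT ha h12 (fun x hx => (hs1 x hx).1) hb1)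
            (tendsto_P_mul_nhdsLT ha h12 (fun x hx => (hs1 x hx).1) hc1) hz,
          integral_green h23 hs2
            (fun x hx => P_ne_zero_of_mem ha (Or.inr (Or.inr hx))) hI2 hc2 hb3
            (tendsto_P_mul_nhdsGT ha h23 (fun x hx => (hs2 x hx).1) hc2)
            (tendsto_P_mul_nhdsLT ha h23 (fun x hx => (hs2 x hx).1) hb3) hz]
        simp
      · rw [Set.disjoint_left]
        intro y hy1 hy2
        exact absurd hy1.2 (not_lt.2 hy2.1.le)
    have key2 : (∫ y : ℝ, F y * (Pc a y * (2 / ((y : ℂ) - z) ^ 3) -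
        dPc a y * (1 / ((y : ℂ) - z) ^ 2) + 2 * ((y : ℂ) - sigma a) ^ 2 / ((y : ℂ) - z) -
        ev / ((y : ℂ) - z))) = 2 * Pc a z * (∫ y : ℝ, F y / ((y : ℂ) - z) ^ 3) +
        dPc a z * (∫ y : ℝ, F y / ((y : ℂ) - z) ^ 2) +
        (2 * (z - sigma a) ^ 2 - ev) * ∫ y : ℝ, F y / ((y : ℂ) - z) ^ 1 := by
      rw [← integral_const_mul, ← integral_const_mul, ← integral_const_mul, ← integral_add,
        ← integral_add]
      · refine integral_congr_ae (Eventually.of_forall fun y => ?_)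
        have hk := kernel_identity a (hne y)
        simp only [pow_one]
        linear_combination (-F y) * hk
      · exact ((integrable_div_sub_pow hI hz 3).const_mul _).add
          ((integrable_div_sub_pow hI hz 2).const_mul _)
      · exact (integrable_div_sub_pow hI hz 1).const_mul _
      · exact (integrable_div_sub_pow hI hz 3).const_mul _
      · exact (integrable_div_sub_pow hI hz 2).const_mul _
    rw [key] at key2
    rw [hcau]
    push_cast
    linear_combination (-(1 / (Real.pi : ℂ))) * key2

/-! ### Power series solutions at ordinary and regular singular points -/

/-- The sequence with initial values `i 0, …, i 3` given by a four-term linear recurrence. -/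
def recSeq (A : ℕ → Fin 4 → ℂ) (i : Fin 4 → ℂ) : ℕ → ℂ
  | 0 => i 0
  | 1 => i 1
  | 2 => i 2
  | 3 => i 3
  | n + 4 => A n 0 * recSeq A i n + A n 1 * recSeq A i (n + 1) + A n 2 * recSeq A i (n + 2) +
      A n 3 * recSeq A i (n + 3)

/-- Four terms, each at most `C M K ^ (n + 3)`, sum to less than `M K ^ (n + 4)` because `4 C ≤ K`.
Geometric growth is all that is needed for a positive radius of convergence. -/
lemma norm_recSeq_le {A : ℕ → Fin 4 → ℂ} (i : Fin 4 → ℂ) {C : ℝ} (hC : 0 ≤ C)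
    (hA : ∀ n j, ‖A n j‖ ≤ C) (n : ℕ) :
    ‖recSeq A i n‖ ≤ (∑ j, ‖i j‖) * (4 * C + 1) ^ n := by
  set M := ∑ j, ‖i j‖ with hM
  set K := 4 * C + 1 with hK
  have hM0 : 0 ≤ M := Finset.sum_nonneg fun _ _ => norm_nonneg _
  have hK1 : 1 ≤ K := by linarith
  have hi : ∀ j, ‖i j‖ ≤ M := fun j =>
    Finset.single_le_sum (fun k _ => norm_nonneg (i k)) (Finset.mem_univ j)
  have hinit : ∀ j m, ‖i j‖ ≤ M * K ^ m := fun j m =>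
    (hi j).trans (le_mul_of_one_le_right hM0 (one_le_pow₀ hK1))
  induction n using Nat.strong_induction_on with
  | _ n ih =>
    match n, ih with
    | 0, _ => exact hinit 0 0
    | 1, _ => exact hinit 1 1
    | 2, _ => exact hinit 2 2
    | 3, _ => exact hinit 3 3
    | n + 4, ih =>
      have hle : ∀ m, m < 4 → ∀ j, ‖A n j * recSeq A i (n + m)‖ ≤ C * (M * K ^ (n + 3)) := by
        intro m hm j
        rw [norm_mul]
        refine mul_le_mul (hA n j) ((ih (n + m) (by omega)).trans ?_) (norm_nonneg _) hC
        exact mul_le_mul_of_nonneg_left (pow_le_pow_right₀ hK1 (by omega)) hM0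
      have h0 := hle 0 (by omega) 0
      have h1 := hle 1 (by omega) 1
      have h2 := hle 2 (by omega) 2
      have h3 := hle 3 (by omega) 3
      rw [recSeq]
      refine (norm_add_le _ _).trans ?_
      have h4 := norm_add₃_le (a := A n 0 * recSeq A i n) (b := A n 1 * recSeq A i (n + 1))
        (c := A n 2 * recSeq A i (n + 2))
      have h5 : M * K ^ (n + 4) = (4 * C + 1) * (M * K ^ (n + 3)) := by rw [← hK]; ring
      have h6 : 0 ≤ M * K ^ (n + 3) := by positivity
      rw [add_zero] at h0
      linarith

lemma summable_of_norm_le_geometric {c : ℕ → ℂ} {M K : ℝ} (hK : 0 < K)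
    (hc : ∀ n, ‖c n‖ ≤ M * K ^ n) {t : ℂ} (ht : t ∈ Metric.ball (0 : ℂ) (1 / (4 * K))) :
    Summable fun n => c n * t ^ n := by
  have ht' : ‖t‖ < 1 / (4 * K) := by simpa using ht
  have hM : 0 ≤ M := by simpa using (norm_nonneg _).trans (hc 0)
  refine Summable.of_norm_bounded (g := fun n => M * (1 / 4) ^ n)
    ((summable_geometric_of_lt_one (by norm_num) (by norm_num)).mul_left M) fun n => ?_
  rw [norm_mul, norm_pow]
  calc ‖c n‖ * ‖t‖ ^ n ≤ (M * K ^ n) * (1 / (4 * K)) ^ n := by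
        gcongr; exact hc n
    _ = M * (1 / 4) ^ n := by
        rw [mul_assoc, ← mul_pow]; congr 2; field_simp

/-- On the radius `1 / (4 K)` the terms decay like `4⁻ⁿ`. The factor `n` from differentiation is
absorbed by `2ⁿ`, leaving a geometric majorant of ratio `1 / 2`. -/
lemma hasDerivAt_tsum_pow {c : ℕ → ℂ} {M K : ℝ} (hK : 0 < K)
    (hc : ∀ n, ‖c n‖ ≤ M * K ^ n) {t : ℂ} (ht : t ∈ Metric.ball (0 : ℂ) (1 / (4 * K))) :
    ∃ s, HasDerivAt (fun t => ∑' n, c n * t ^ n) s t ∧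
      HasSum (fun n : ℕ => ((n : ℂ) + 1) * c (n + 1) * t ^ n) s := by
  have hM : 0 ≤ M := by simpa using (norm_nonneg _).trans (hc 0)
  have hu : Summable fun n : ℕ => 4 * M * K * (1 / 2 : ℝ) ^ n :=
    (summable_geometric_of_lt_one (by norm_num) (by norm_num)).mul_left _
  have hbound : ∀ n : ℕ, ∀ y ∈ Metric.ball (0 : ℂ) (1 / (4 * K)),
      ‖c n * (n * y ^ (n - 1))‖ ≤ 4 * M * K * (1 / 2 : ℝ) ^ n := by
    intro n y hy
    have hy' : ‖y‖ < 1 / (4 * K) := by simpa using hy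
    rcases n with _ | n
    · simp; positivity
    · rw [norm_mul, norm_mul, norm_pow, Complex.norm_natCast, Nat.add_sub_cancel]
      have hn : ((n + 1 : ℕ) : ℝ) ≤ 2 ^ (n + 1) := by exact_mod_cast Nat.lt_two_pow_self.le
      calc ‖c (n + 1)‖ * (((n + 1 : ℕ) : ℝ) * ‖y‖ ^ n)
          ≤ (M * K ^ (n + 1)) * (2 ^ (n + 1) * (1 / (4 * K)) ^ n) := by
            gcongr; exact hc _
        _ = 4 * M * K * (1 / 2 : ℝ) ^ (n + 1) := by
            have h4 : (4 * K) ^ n = 2 ^ n * 2 ^ n * K ^ n := by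
              rw [← mul_pow, ← mul_pow]; norm_num
            rw [div_pow, div_pow, h4]
            simp only [one_pow]
            field_simp
            ring
  have h0 : (0 : ℂ) ∈ Metric.ball (0 : ℂ) (1 / (4 * K)) := Metric.mem_ball_self (by positivity)
  have hd := hasDerivAt_tsum_of_isPreconnected (g := fun n y => c n * y ^ n)
    (g' := fun n y => c n * (n * y ^ (n - 1))) hu Metric.isOpen_ball
    (convex_ball _ _).isPreconnected (fun n y _ => (hasDerivAt_pow n y).const_mul (c n)) hbound h0
    (summable_of_norm_le_geometric hK hc h0) ht
  refine ⟨_, hd, ?_⟩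
  have hs : Summable fun n : ℕ => c n * (n * t ^ (n - 1)) :=
    Summable.of_norm_bounded hu fun n => hbound n t ht
  rw [hs.tsum_eq_zero_add]
  have := ((summable_nat_add_iff 1).2 hs).hasSum
  simp only [Nat.add_sub_cancel, Nat.cast_zero, zero_mul, mul_zero, zero_add] at this ⊢
  refine this.congr_fun fun n => ?_
  push_cast
  ring

lemma hasSum_shift {x : ℕ → ℂ} {t s : ℂ} (h : HasSum (fun n => x (n + 1) * t ^ n) s)
    (h0 : x 0 = 0) : HasSum (fun n => x n * t ^ n) (t * s) := by
  rw [← hasSum_nat_add_iff' 1]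
  simp only [Finset.range_one, Finset.sum_singleton, h0, zero_mul, sub_zero]
  refine (h.mul_left t).congr_fun fun n => ?_
  rw [pow_succ]; ring

/-- A recursively defined power series solves `(p φ')' + q φ = 0` for polynomials `p`, `q` of
degrees at most `4` and `2`. -/
lemma exists_sol_of_recurrence {p : Fin 5 → ℂ} {q : Fin 3 → ℂ} {e : ℕ → ℂ} {M K : ℝ} (hK : 1 ≤ K)
    (he : ∀ n, ‖e n‖ ≤ M * K ^ n) (h0 : e 0 = 0) (h1 : e 1 = 0)
    (hrec : ∀ n : ℕ, (n + 1) * (p 0 * (n + 2) * e (n + 4) + p 1 * (n + 1) * e (n + 3) +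
      p 2 * n * e (n + 2) + p 3 * (n - 1) * e (n + 1) + p 4 * (n - 2) * e n) +
      (q 0 * e (n + 2) + q 1 * e (n + 1) + q 2 * e n) = 0) :
    ∃ r > 0, ∃ φ W : ℂ → ℂ, φ 0 = e 2 ∧ W 0 = p 0 * e 3 ∧ ∀ t ∈ Metric.ball (0 : ℂ) r,
      HasDerivAt W (-(q 0 + q 1 * t + q 2 * t ^ 2) * φ t) t ∧
      ∃ s, HasDerivAt φ s t ∧
        (p 0 + p 1 * t + p 2 * t ^ 2 + p 3 * t ^ 3 + p 4 * t ^ 4) * s = W t := by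
  have hK0 : 0 < K := by linarith
  have hM : 0 ≤ M := by simpa using (norm_nonneg _).trans (he 0)
  -- The coefficients of `φ` are `e (n + 2)`; the zeros `e 0`, `e 1` stand for the indices `-2`,
  -- `-1` and keep the recurrence uniform in `n`. The `d n` are the coefficients of `W`, obtained by
  -- integrating `-q φ` termwise from the value `p 0 * e 3` of `p φ'` at zero; `hrec` then says that
  -- `W = p φ'`.
  obtain ⟨d, hd0, hd⟩ : ∃ d : ℕ → ℂ, d 0 = p 0 * e 3 ∧ ∀ n : ℕ, d (n + 1) =
      -(q 0 * e (n + 2) + q 1 * e (n + 1) + q 2 * e n) / (n + 1) :=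
    ⟨fun n => Nat.casesOn n (p 0 * e 3) fun n =>
      -(q 0 * e (n + 2) + q 1 * e (n + 1) + q 2 * e n) / (n + 1), rfl, fun _ => rfl⟩
  have hn1 : ∀ n : ℕ, (n : ℂ) + 1 ≠ 0 := fun n => Nat.cast_add_one_ne_zero n
  have hc' : ∀ n, ‖e (n + 2)‖ ≤ (M * K ^ 2) * K ^ n := fun n => (he _).trans_eq (by ring)
  have hd' : ∀ n, ‖d n‖ ≤
      (‖p 0‖ * M * K ^ 3 + (‖q 0‖ + ‖q 1‖ + ‖q 2‖) * M * K) * K ^ n := by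
    intro n
    rcases n with _ | n
    · rw [hd0, pow_zero, mul_one, norm_mul]
      have := mul_le_mul_of_nonneg_left (he 3) (norm_nonneg (p 0))
      have h2 : 0 ≤ (‖q 0‖ + ‖q 1‖ + ‖q 2‖) * M * K := by positivity
      linarith
    · rw [hd, norm_div, norm_neg]
      have hle : ∀ (x : ℂ) m, m ≤ 2 → ‖x * e (n + m)‖ ≤ ‖x‖ * (M * K ^ (n + 2)) := by
        intro x m hm
        rw [norm_mul]
        refine mul_le_mul_of_nonneg_left ((he _).trans ?_) (norm_nonneg _)
        exact mul_le_mul_of_nonneg_left (pow_le_pow_right₀ hK (by omega)) hM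
      have h2 := norm_add₃_le (a := q 0 * e (n + 2)) (b := q 1 * e (n + 1)) (c := q 2 * e n)
      have h3 := hle (q 0) 2 le_rfl
      have h4 := hle (q 1) 1 (by omega)
      have h5 := hle (q 2) 0 (by omega)
      rw [add_zero] at h5
      have h6 : (1 : ℝ) ≤ ‖(n : ℂ) + 1‖ := by
        have : ‖(n : ℂ) + 1‖ = (n : ℝ) + 1 := by
          exact_mod_cast Complex.norm_natCast (n + 1)
        rw [this]; linarith [n.cast_nonneg (α := ℝ)]
      refine (div_le_self (norm_nonneg _) h6).trans ?_
      have h7 : (‖p 0‖ * M * K ^ 3 + (‖q 0‖ + ‖q 1‖ + ‖q 2‖) * M * K) * K ^ (n + 1) =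
        ‖p 0‖ * M * K ^ 3 * K ^ (n + 1) + (‖q 0‖ + ‖q 1‖ + ‖q 2‖) * (M * K ^ (n + 2)) := by ring
      have h8 : 0 ≤ ‖p 0‖ * M * K ^ 3 * K ^ (n + 1) := by positivity
      linarith
  have hr : (0 : ℝ) < 1 / (4 * K) := by positivity
  refine ⟨1 / (4 * K), hr, fun t => ∑' n, e (n + 2) * t ^ n, fun t => ∑' n, d n * t ^ n, ?_, ?_,
    fun t ht => ⟨?_, ?_⟩⟩
  · dsimp only
    rw [tsum_eq_single 0 (fun n hn => by simp [hn])]; simp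
  · dsimp only
    rw [tsum_eq_single 0 (fun n hn => by simp [hn])]; simp [hd0]
  · obtain ⟨s, hs1, hs2⟩ := hasDerivAt_tsum_pow hK0 hd' ht
    have hφ := (summable_of_norm_le_geometric hK0 hc' ht).hasSum
    have hφ1 := hasSum_shift (x := fun n => e (n + 1)) hφ h1
    have hφ2 := hasSum_shift (x := e) hφ1 h0
    have hq := ((hφ.mul_left (q 0)).add (hφ1.mul_left (q 1))).add (hφ2.mul_left (q 2))
    have hs3 := hq.neg
    have : s = -(q 0 + q 1 * t + q 2 * t ^ 2) * ∑' n, e (n + 2) * t ^ n := by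
      rw [hs2.unique (hs3.congr_fun fun n => ?_)]
      · ring
      · simp only [hd]
        rw [mul_div_cancel₀ _ (hn1 n)]
        ring
    rwa [← this]
  · obtain ⟨s, hs1, hs2⟩ := hasDerivAt_tsum_pow hK0 hc' ht
    refine ⟨s, hs1, ?_⟩
    have b0 : HasSum (fun n : ℕ => ((n : ℂ) + 1) * e (n + 3) * t ^ n) s := hs2
    have b1 := hasSum_shift (x := fun n => (n : ℂ) * e (n + 2)) (t := t) (s := s)
      (by simpa using b0) (by simp)
    have b2 := hasSum_shift (x := fun n => ((n : ℂ) - 1) * e (n + 1)) (t := t) (s := t * s)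
      (by simpa using b1) (by simp [h1])
    have b3 := hasSum_shift (x := fun n => ((n : ℂ) - 2) * e n) (t := t) (s := t * (t * s))
      (b2.congr_fun fun n => by push_cast; ring) (by simp [h0])
    -- The coefficient at `n` involves `e (n - 1)`, so the sequence is prefixed by an explicit zero.
    have b4 := hasSum_shift (x := fun n => Nat.casesOn n 0 fun n => ((n : ℂ) - 2) * e n) (t := t)
      (s := t * (t * (t * s))) b3 rfl
    have hsum := ((((b0.mul_left (p 0)).add (b1.mul_left (p 1))).add (b2.mul_left (p 2))).add
      (b3.mul_left (p 3))).add (b4.mul_left (p 4))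
    have hW := (summable_of_norm_le_geometric hK0 hd' ht).hasSum
    have heq := hW.unique (hsum.congr_fun fun n => ?_)
    · dsimp only
      rw [heq]; ring
    · rcases n with _ | n
      · simp [hd0, h0, h1]
      · simp only [hd]
        have hx := hrec n
        rw [div_mul_eq_mul_div, div_eq_iff (hn1 n)]
        push_cast
        linear_combination (-t ^ (n + 1)) * hx

/-- The recurrence coefficients have numerators and denominators of the same degree in `n`, hence
are bounded uniformly in `n`. For `p₀ = 0` both sides are zero by the convention for division. -/
lemma norm_coeff_le {p q p₀ x y : ℂ} (hx : ‖x‖ ≤ ‖y‖) (hy : 1 ≤ ‖y‖) :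
    ‖-(p * x + q) / (p₀ * y)‖ ≤ (‖p‖ + ‖q‖) / ‖p₀‖ := by
  rw [norm_div, norm_neg, norm_mul]
  rcases eq_or_lt_of_le (norm_nonneg p₀) with h | h
  · simp [← h]
  · rw [div_le_div_iff₀ (by positivity) h]
    have h1 := norm_add_le (p * x) q
    rw [norm_mul] at h1
    have h2 : ‖p‖ * ‖x‖ ≤ ‖p‖ * ‖y‖ := by gcongr
    have h3 : ‖q‖ ≤ ‖q‖ * ‖y‖ := le_mul_of_one_le_right (norm_nonneg _) hy
    calc ‖p * x + q‖ * ‖p₀‖ ≤ ((‖p‖ + ‖q‖) * ‖y‖) * ‖p₀‖ := by gcongr; linarith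
      _ = _ := by ring

/-- Existence of an analytic solution of `(p φ')' + q φ = 0` with `φ(0) = 1`, `(p φ')(0) = 0` when
`0` is an ordinary point or a regular singular point with both exponents zero. -/
lemma exists_analytic_sol (p : Fin 5 → ℂ) (q : Fin 3 → ℂ) (hp : p 0 ≠ 0 ∨ (p 0 = 0 ∧ p 1 ≠ 0)) :
    ∃ r > 0, ∃ φ W : ℂ → ℂ, φ 0 = 1 ∧ W 0 = 0 ∧ ∀ t ∈ Metric.ball (0 : ℂ) r,
      HasDerivAt W (-(q 0 + q 1 * t + q 2 * t ^ 2) * φ t) t ∧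
      ∃ s, HasDerivAt φ s t ∧
        (p 0 + p 1 * t + p 2 * t ^ 2 + p 3 * t ^ 3 + p 4 * t ^ 4) * s = W t := by
  set S : ℝ := (∑ j, ‖p j‖) + ∑ j, ‖q j‖ with hS
  have hSp : ∀ i j, ‖p i‖ + ‖q j‖ ≤ S := fun i j => add_le_add
    (Finset.single_le_sum (fun k _ => norm_nonneg (p k)) (Finset.mem_univ i))
    (Finset.single_le_sum (fun k _ => norm_nonneg (q k)) (Finset.mem_univ j))
  have hS0 : 0 ≤ S := by positivity
  have hnn : ∀ n m : ℕ, ‖((n : ℂ) + m)‖ = (n : ℝ) + m := by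
    intro n m; exact_mod_cast Complex.norm_natCast (n + m)
  rcases hp with hp | ⟨hp0, hp1⟩
  -- Ordinary point: the recurrence is solved for `e (n + 4)`. The initial values `e 2 = 1`, `e 3 =
  -- 0` mean `φ(0) = 1`, `φ'(0) = 0`.
  · set A : ℕ → Fin 4 → ℂ := fun n => ![
      -(p 4 * ((n - 2) * (n + 1)) + q 2) / (p 0 * ((n + 1) * (n + 2))),
      -(p 3 * ((n - 1) * (n + 1)) + q 1) / (p 0 * ((n + 1) * (n + 2))),
      -(p 2 * (n * (n + 1)) + q 0) / (p 0 * ((n + 1) * (n + 2))),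
      -(p 1 * ((n + 1) * (n + 1)) + 0) / (p 0 * ((n + 1) * (n + 2)))] with hA
    have hAb : ∀ n j, ‖A n j‖ ≤ S / ‖p 0‖ := by
      intro n j
      have hn1 : ‖(n : ℂ) + 1‖ = (n : ℝ) + 1 := by exact_mod_cast hnn n 1
      have hn2 : ‖(n : ℂ) + 2‖ = (n : ℝ) + 2 := by exact_mod_cast hnn n 2
      have hy : (1 : ℝ) ≤ ‖((n : ℂ) + 1) * (n + 2)‖ := by
        rw [norm_mul, hn1, hn2]
        nlinarith [n.cast_nonneg (α := ℝ)]
      have hx : ∀ c : ℤ, |c| ≤ 2 → ‖((n : ℂ) + c) * (n + 1)‖ ≤ ‖((n : ℂ) + 1) * (n + 2)‖ := by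
        intro c hc
        rw [mul_comm, norm_mul, norm_mul]
        refine mul_le_mul_of_nonneg_left ?_ (norm_nonneg _)
        refine (norm_add_le _ _).trans ?_
        rw [hn2, Complex.norm_natCast, Complex.norm_intCast]
        have : |(c : ℝ)| ≤ 2 := by exact_mod_cast hc
        linarith
      have hdiv : ∀ u : ℝ, u ≤ S → u / ‖p 0‖ ≤ S / ‖p 0‖ := fun u hu => by gcongr
      fin_cases j
      · exact (norm_coeff_le (by simpa [sub_eq_add_neg] using hx (-2) (by norm_num)) hy).trans
          (hdiv _ (hSp 4 2))
      · exact (norm_coeff_le (by simpa [sub_eq_add_neg] using hx (-1) (by norm_num)) hy).trans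
          (hdiv _ (hSp 3 1))
      · exact (norm_coeff_le (by simpa using hx 0 (by norm_num)) hy).trans
          (hdiv _ (hSp 2 0))
      · refine (norm_coeff_le (by simpa using hx 1 (by norm_num)) hy).trans (hdiv _ ?_)
        rw [norm_zero]
        have := hSp 1 0
        have := norm_nonneg (q 0)
        linarith
    have hC : 0 ≤ S / ‖p 0‖ := by positivity
    obtain ⟨r, hr, φ, W, h1, h2, h3⟩ := exists_sol_of_recurrence (p := p) (q := q)
      (e := recSeq A ![0, 0, 1, 0]) (K := 4 * (S / ‖p 0‖) + 1) (by linarith)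
      (norm_recSeq_le _ hC hAb) (by simp [recSeq]) (by simp [recSeq]) (fun n => by
        have hn1 : (n : ℂ) + 1 ≠ 0 := Nat.cast_add_one_ne_zero n
        have hn2 : (n : ℂ) + 2 ≠ 0 := by exact_mod_cast (show n + 2 ≠ 0 by omega)
        have h4 : ∀ e : ℕ → ℂ, e (n + 4) = -(p 4 * ((n - 2) * (n + 1)) + q 2) /
              (p 0 * ((n + 1) * (n + 2))) * e n +
            -(p 3 * ((n - 1) * (n + 1)) + q 1) / (p 0 * ((n + 1) * (n + 2))) * e (n + 1) +
            -(p 2 * (n * (n + 1)) + q 0) / (p 0 * ((n + 1) * (n + 2))) * e (n + 2) +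
            -(p 1 * ((n + 1) * (n + 1)) + 0) / (p 0 * ((n + 1) * (n + 2))) * e (n + 3) →
            (n + 1) * (p 0 * (n + 2) * e (n + 4) + p 1 * (n + 1) * e (n + 3) +
            p 2 * n * e (n + 2) + p 3 * (n - 1) * e (n + 1) + p 4 * (n - 2) * e n) +
            (q 0 * e (n + 2) + q 1 * e (n + 1) + q 2 * e n) = 0 := by
          intro e he
          rw [he]
          field_simp
          ring
        exact h4 _ rfl)
    exact ⟨r, hr, φ, W, by simpa [recSeq] using h1, by simpa [recSeq] using h2, h3⟩
  -- Singular point: the leading term drops out, so the relation of index `n + 1` determines `e (n +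
  -- 4)`, with factor `p 1 (n + 2)²`. This square, from the double exponent zero, never vanishes.
  -- The relation of index zero forces `e 3 = -q 0 / p 1`.
  · set A : ℕ → Fin 4 → ℂ := fun n => ![0,
      -(p 4 * ((n - 1) * (n + 2)) + q 2) / (p 1 * ((n + 2) * (n + 2))),
      -(p 3 * (n * (n + 2)) + q 1) / (p 1 * ((n + 2) * (n + 2))),
      -(p 2 * ((n + 1) * (n + 2)) + q 0) / (p 1 * ((n + 2) * (n + 2)))] with hA
    have hAb : ∀ n j, ‖A n j‖ ≤ S / ‖p 1‖ := by
      intro n j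
      have hn1 : ‖(n : ℂ) + 1‖ = (n : ℝ) + 1 := by exact_mod_cast hnn n 1
      have hn2 : ‖(n : ℂ) + 2‖ = (n : ℝ) + 2 := by exact_mod_cast hnn n 2
      have hy : (1 : ℝ) ≤ ‖((n : ℂ) + 2) * (n + 2)‖ := by
        rw [norm_mul, hn2]
        nlinarith [n.cast_nonneg (α := ℝ)]
      have hx : ∀ c : ℤ, |c| ≤ 2 → ‖((n : ℂ) + c) * (n + 2)‖ ≤ ‖((n : ℂ) + 2) * (n + 2)‖ := by
        intro c hc
        rw [norm_mul, norm_mul]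
        refine mul_le_mul_of_nonneg_right ?_ (norm_nonneg _)
        refine (norm_add_le _ _).trans ?_
        rw [hn2, Complex.norm_natCast, Complex.norm_intCast]
        have : |(c : ℝ)| ≤ 2 := by exact_mod_cast hc
        linarith
      have hdiv : ∀ u : ℝ, u ≤ S → u / ‖p 1‖ ≤ S / ‖p 1‖ := fun u hu => by gcongr
      fin_cases j
      · simp [hA]; positivity
      · exact (norm_coeff_le (by simpa [sub_eq_add_neg] using hx (-1) (by norm_num)) hy).trans
          (hdiv _ (hSp 4 2))
      · exact (norm_coeff_le (by simpa using hx 0 (by norm_num)) hy).trans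
          (hdiv _ (hSp 3 1))
      · exact (norm_coeff_le (by simpa using hx 1 (by norm_num)) hy).trans
          (hdiv _ (hSp 2 0))
    have hC : 0 ≤ S / ‖p 1‖ := by positivity
    obtain ⟨r, hr, φ, W, h1, h2, h3⟩ := exists_sol_of_recurrence (p := p) (q := q)
      (e := recSeq A ![0, 0, 1, -q 0 / p 1]) (K := 4 * (S / ‖p 1‖) + 1) (by linarith)
      (norm_recSeq_le _ hC hAb) (by simp [recSeq]) (by simp [recSeq]) (fun n => by
        rcases n with _ | n
        · simp [recSeq, hp0]
          field_simp
          ring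
        · have hn2 : (n : ℂ) + 2 ≠ 0 := by exact_mod_cast (show n + 2 ≠ 0 by omega)
          have h4 : ∀ e : ℕ → ℂ, e (n + 4) = 0 * e n +
              -(p 4 * ((n - 1) * (n + 2)) + q 2) / (p 1 * ((n + 2) * (n + 2))) * e (n + 1) +
              -(p 3 * (n * (n + 2)) + q 1) / (p 1 * ((n + 2) * (n + 2))) * e (n + 2) +
              -(p 2 * ((n + 1) * (n + 2)) + q 0) / (p 1 * ((n + 2) * (n + 2))) * e (n + 3) →
              ((n + 1 : ℕ) + 1) * (p 0 * ((n + 1 : ℕ) + 2) * e (n + 1 + 4) +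
              p 1 * ((n + 1 : ℕ) + 1) * e (n + 1 + 3) +
              p 2 * (n + 1 : ℕ) * e (n + 1 + 2) + p 3 * ((n + 1 : ℕ) - 1) * e (n + 1 + 1) +
              p 4 * ((n + 1 : ℕ) - 2) * e (n + 1)) +
              (q 0 * e (n + 1 + 2) + q 1 * e (n + 1 + 1) + q 2 * e (n + 1)) = 0 := by
            intro e he
            rw [show n + 1 + 3 = n + 4 by ring, show n + 1 + 2 = n + 3 by ring,
              show n + 1 + 1 = n + 2 by ring, he, hp0]
            push_cast
            field_simp
            ring
          exact h4 _ rfl)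
    exact ⟨r, hr, φ, W, by simpa [recSeq] using h1, by simpa [recSeq, hp0] using h2, h3⟩

/-- Near `c`, the function `φ` is the analytic solution with `φ(c) = 1`, `W = P φ'`, `W(c) = 0`. -/
structure IsLocalSol (a : Fin 4 → ℝ) (ev c : ℂ) (r : ℝ) (φ W : ℂ → ℂ) : Prop where
  r_pos : 0 < r
  map_center : φ c = 1
  quasi_center : W c = 0
  ne_zero : ∀ z ∈ Metric.ball c r, φ z ≠ 0
  differentiableAt : ∀ z ∈ Metric.ball c r, DifferentiableAt ℂ φ z
  hasDerivAt_quasi : ∀ z ∈ Metric.ball c r,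
    HasDerivAt W ((ev - 2 * (z - sigma a) ^ 2) * φ z) z
  Pc_ne_zero : ∀ z ∈ Metric.ball c r, z ≠ c → Pc a z ≠ 0
  hasDerivAt : ∀ z ∈ Metric.ball c r, Pc a z ≠ 0 → HasDerivAt φ (W z / Pc a z) z

lemma Pc_add (a : Fin 4 → ℝ) (c t : ℂ) : Pc a (c + t) = Pc a c + dPc a c * t +
    ((c - a 0) * (c - a 1) + (c - a 0) * (c - a 2) + (c - a 0) * (c - a 3) +
      (c - a 1) * (c - a 2) + (c - a 1) * (c - a 3) + (c - a 2) * (c - a 3)) * t ^ 2 +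
    ((c - a 0) + (c - a 1) + (c - a 2) + (c - a 3)) * t ^ 3 + 1 * t ^ 4 := by
  rw [dPc_eq, Pc, Pc, Fin.prod_univ_four, Fin.prod_univ_four]
  ring

/-- The coefficients of the equation are expanded at `c`, and the radius is then shrunk until `φ`
has no zeros and `P` has none except possibly `c`; the reduction of order divides by both. -/
lemma exists_isLocalSol (a : Fin 4 → ℝ) (ev c : ℂ)
    (hc : Pc a c ≠ 0 ∨ (Pc a c = 0 ∧ dPc a c ≠ 0)) : ∃ r φ W, IsLocalSol a ev c r φ W := by
  obtain ⟨r, hr, φ, W, h1, h2, h3⟩ := exists_analytic_sol ![Pc a c, dPc a c,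
    ((c - a 0) * (c - a 1) + (c - a 0) * (c - a 2) + (c - a 0) * (c - a 3) +
      (c - a 1) * (c - a 2) + (c - a 1) * (c - a 3) + (c - a 2) * (c - a 3)),
    ((c - a 0) + (c - a 1) + (c - a 2) + (c - a 3)), 1]
    ![2 * (c - sigma a) ^ 2 - ev, 4 * (c - sigma a), 2] (by simpa using hc)
  simp only [Matrix.cons_val] at h3
  have hφ : ContinuousAt φ 0 := by
    obtain ⟨s, hs, -⟩ := (h3 0 (Metric.mem_ball_self hr)).2
    exact hs.continuousAt
  have hφ0 : ∀ᶠ t in 𝓝 (0 : ℂ), φ t ≠ 0 := hφ.eventually_ne (by rw [h1]; exact one_ne_zero)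
  have hP0 : ∀ᶠ t in 𝓝 (0 : ℂ), t ≠ 0 → Pc a (c + t) ≠ 0 := by
    have hd := hasDerivAt_Pc a c
    rcases hc with hc | ⟨-, hc⟩
    · have hcont : ContinuousAt (fun t : ℂ => Pc a (c + t)) 0 := by
        unfold Pc; fun_prop
      filter_upwards [hcont.eventually_ne (by simpa using hc)] with t ht _ using ht
    · have h4 := hd.eventually_ne (c := 0) hc
      rw [eventually_nhdsWithin_iff] at h4
      have h5 : Tendsto (fun t : ℂ => c + t) (𝓝 0) (𝓝 c) := by
        simpa using (continuous_const.add continuous_id).tendsto (0 : ℂ) (f := fun t : ℂ => c + t)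
      filter_upwards [h5.eventually h4] with t ht ht0
      exact ht (by simpa using ht0)
  obtain ⟨δ, hδ, hball⟩ := Metric.eventually_nhds_iff_ball.1 (hφ0.and hP0)
  have hmem : ∀ z ∈ Metric.ball c (min r δ), z - c ∈ Metric.ball (0 : ℂ) r ∧
      z - c ∈ Metric.ball (0 : ℂ) δ := by
    intro z hz
    rw [Metric.mem_ball, dist_eq_norm, lt_min_iff] at hz
    simpa using hz
  have hsub : ∀ z : ℂ, HasDerivAt (fun z => z - c) 1 z := fun z => (hasDerivAt_id z).sub_const c
  refine ⟨min r δ, fun z => φ (z - c), fun z => W (z - c), lt_min hr hδ, by simpa using h1,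
    by simpa using h2, fun z hz => (hball _ (hmem z hz).2).1, fun z hz => ?_, fun z hz => ?_,
    fun z hz hzc => ?_, fun z hz hPz => ?_⟩
  · obtain ⟨s, hs, -⟩ := (h3 _ (hmem z hz).1).2
    exact (hs.comp z (hsub z)).differentiableAt
  · refine ((h3 _ (hmem z hz).1).1.comp z (hsub z)).congr_deriv ?_
    ring
  · simpa using (hball _ (hmem z hz).2).2 (sub_ne_zero.2 hzc)
  · obtain ⟨s, hs, hs2⟩ := (h3 _ (hmem z hz).1).2
    refine (hs.comp z (hsub z)).congr_deriv ?_
    rw [← Pc_add, add_sub_cancel] at hs2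
    rw [← hs2, mul_div_cancel_left₀ _ hPz, mul_one]

/-! ### Reduction of order -/

lemma exists_const_of_hasDerivAt_zero {U : Set ℂ} (hU : Convex ℝ U) {g : ℂ → ℂ}
    (h : ∀ z ∈ U, HasDerivAt g 0 z) : ∃ C, ∀ z ∈ U, g z = C := by
  rcases U.eq_empty_or_nonempty with rfl | ⟨x, hx⟩
  · exact ⟨0, fun z hz => hz.elim⟩
  · refine ⟨g x, fun z hz => ?_⟩
    have := hU.norm_image_sub_le_of_norm_hasDerivWithin_le (f := g) (f' := fun _ => 0) (C := 0)
      (fun z hz => (h z hz).hasDerivWithinAt) (fun z _ => by simp) hx hz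
    simpa [sub_eq_zero] using this

/-- Reduction of order: every solution has the form `φ (A + B T)` with `T' = 1 / (P φ²)`. -/
lemma IsSol.eq_combination {a : Fin 4 → ℝ} {ev : ℂ} {U : Set ℂ} (hU : Convex ℝ U)
    {φ W s w T : ℂ → ℂ} (hφ : IsSol a ev U φ W) (hs : IsSol a ev U s w)
    (hP : ∀ z ∈ U, Pc a z ≠ 0) (hφ0 : ∀ z ∈ U, φ z ≠ 0)
    (hT : ∀ z ∈ U, HasDerivAt T (1 / (Pc a z * φ z ^ 2)) z) :
    ∃ A B : ℂ, ∀ z ∈ U, s z = φ z * (A + B * T z) := by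
  -- The Wronskian is a constant `B`, so `s / φ` has derivative `B / (P φ²) = B T'`.
  obtain ⟨B, hB⟩ := exists_const_of_hasDerivAt_zero hU (g := fun z => φ z * w z - s z * W z)
    (fun z hz => by
      have h0 := hP z hz
      refine (((hφ z hz).1.mul (hs z hz).2).sub ((hs z hz).1.mul (hφ z hz).2)).congr_deriv ?_
      field_simp
      ring)
  obtain ⟨A, hA⟩ := exists_const_of_hasDerivAt_zero hU (g := fun z => s z / φ z - B * T z)
    (fun z hz => by
      have h0 := hP z hz
      have h1 := hφ0 z hz
      refine (((hs z hz).1.div (hφ z hz).1 h1).sub ((hT z hz).const_mul B)).congr_deriv ?_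
      rw [← hB z hz]
      field_simp
      ring)
  refine ⟨A, B, fun z hz => ?_⟩
  have h1 := hφ0 z hz
  rw [← hA z hz]
  field_simp
  ring

lemma IsSol.combination {a : Fin 4 → ℝ} {ev : ℂ} {U : Set ℂ} {φ W T : ℂ → ℂ}
    (hφ : IsSol a ev U φ W) (hP : ∀ z ∈ U, Pc a z ≠ 0) (hφ0 : ∀ z ∈ U, φ z ≠ 0)
    (hT : ∀ z ∈ U, HasDerivAt T (1 / (Pc a z * φ z ^ 2)) z) (A B : ℂ) :
    IsSol a ev U (fun z => φ z * (A + B * T z)) (fun z => W z * (A + B * T z) + B / φ z) := by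
  intro z hz
  have h0 := hP z hz
  have h1 := hφ0 z hz
  have hAB := ((hT z hz).const_mul B).const_add A
  constructor
  · refine ((hφ z hz).1.mul hAB).congr_deriv ?_
    field_simp
  · refine (((hφ z hz).2.mul hAB).add ((hasDerivAt_const z B).div (hφ z hz).1 h1)).congr_deriv ?_
    field_simp
    ring

lemma IsLocalSol.isSol {a : Fin 4 → ℝ} {ev c : ℂ} {r : ℝ} {φ W : ℂ → ℂ}
    (h : IsLocalSol a ev c r φ W) {U : Set ℂ} (hU : U ⊆ Metric.ball c r)
    (hP : ∀ z ∈ U, Pc a z ≠ 0) : IsSol a ev U φ W := fun z hz =>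
  ⟨h.hasDerivAt z (hU hz) (hP z hz), h.hasDerivAt_quasi z (hU hz)⟩

lemma differentiable_Pc (a : Fin 4 → ℝ) : Differentiable ℂ (Pc a) := fun z =>
  (hasDerivAt_Pc a z).differentiableAt

lemma IsLocalSol.exists_primitive {a : Fin 4 → ℝ} {ev c : ℂ} {r : ℝ} {φ W : ℂ → ℂ}
    (h : IsLocalSol a ev c r φ W) (hc : Pc a c ≠ 0) :
    (∀ z ∈ Metric.ball c r, Pc a z ≠ 0) ∧
    ∃ T : ℂ → ℂ, ∀ z ∈ Metric.ball c r, HasDerivAt T (1 / (Pc a z * φ z ^ 2)) z := by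
  have hP : ∀ z ∈ Metric.ball c r, Pc a z ≠ 0 := by
    intro z hz
    by_cases hzc : z = c
    · rwa [hzc]
    · exact h.Pc_ne_zero z hz hzc
  refine ⟨hP, DifferentiableOn.isExactOn_ball fun z hz => ?_⟩
  exact ((differentiableAt_const _).div ((differentiable_Pc a z).mul
    ((h.differentiableAt z hz).pow 2))
    (mul_ne_zero (hP z hz) (pow_ne_zero 2 (h.ne_zero z hz)))).differentiableWithinAt

/-- At a zero of `P`, the regular part `H` of the primitive of `P'(c) / (P φ²)`. -/
lemma IsLocalSol.exists_regular_part {a : Fin 4 → ℝ} {ev c : ℂ} {r : ℝ} {φ W : ℂ → ℂ}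
    (h : IsLocalSol a ev c r φ W) (hc : Pc a c = 0) (hd : dPc a c ≠ 0) :
    ∃ H : ℂ → ℂ, (∀ z ∈ Metric.ball c r, DifferentiableAt ℂ H z) ∧
      ∀ z ∈ Metric.ball c r, z ≠ c →
        HasDerivAt H (dPc a c / (Pc a z * φ z ^ 2) - 1 / (z - c)) z := by
  set Q := dslope (Pc a) c with hQ
  have hPQ : ∀ z, Pc a z = (z - c) * Q z := by
    intro z
    have := sub_smul_dslope (Pc a) c z
    rw [hc, sub_zero, smul_eq_mul] at this
    exact this.symm
  have hQc : Q c = dPc a c := by rw [hQ, dslope_same, (hasDerivAt_Pc a c).deriv]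
  have hQ0 : ∀ z ∈ Metric.ball c r, Q z ≠ 0 := by
    intro z hz
    by_cases hzc : z = c
    · rwa [hzc, hQc]
    · have := h.Pc_ne_zero z hz hzc
      rw [hPQ] at this
      exact right_ne_zero_of_mul this
  have hball : Metric.ball c r ∈ 𝓝 c := Metric.ball_mem_nhds c h.r_pos
  have hQd : DifferentiableOn ℂ Q (Metric.ball c r) :=
    (Complex.differentiableOn_dslope hball).2 (differentiable_Pc a).differentiableOn
  -- Since `K c = 1`, the function `P'(c) / (P φ²) - 1 / (z - c)` is the difference quotient of `K`
  -- at `c`. It extends analytically to `c` and has a primitive on the disc.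
  set K : ℂ → ℂ := fun z => dPc a c / (Q z * φ z ^ 2) with hK
  have hKd : DifferentiableOn ℂ K (Metric.ball c r) := by
    intro z hz
    exact (differentiableWithinAt_const _).div ((hQd z hz).mul
      ((h.differentiableAt z hz).differentiableWithinAt.pow 2))
      (mul_ne_zero (hQ0 z hz) (pow_ne_zero 2 (h.ne_zero z hz)))
  obtain ⟨H, hH⟩ := DifferentiableOn.isExactOn_ball
    ((Complex.differentiableOn_dslope hball).2 hKd)
  refine ⟨H, fun z hz => (hH z hz).differentiableAt, fun z hz hzc => ?_⟩
  refine (hH z hz).congr_deriv ?_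
  have h1 : z - c ≠ 0 := sub_ne_zero.2 hzc
  have h2 := hQ0 z hz
  have h3 := h.ne_zero z hz
  rw [dslope_of_ne _ hzc, slope_def_field, hPQ, hK]
  simp only [hQc, h.map_center]
  field_simp

/-! ### Branches of the logarithm -/

/-- The branch of the logarithm that is analytic on the upper half plane and real for `z > 0`. -/
def logUp (z : ℂ) : ℂ := Complex.log (-Complex.I * z) + Complex.I * (Real.pi / 2)

/-- The branch of the logarithm that is analytic on the lower half plane and real for `z > 0`. -/
def logDown (z : ℂ) : ℂ := Complex.log (Complex.I * z) - Complex.I * (Real.pi / 2)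

/-- The cut runs along the negative imaginary axis. Nonzero real points are thus interior to the
domain of analyticity, and boundary values can be read off by continuity. -/
lemma hasDerivAt_logUp {z : ℂ} (hz : 0 < z.im ∨ (z.im = 0 ∧ z.re ≠ 0)) :
    HasDerivAt logUp (1 / z) z := by
  have hs : -Complex.I * z ∈ Complex.slitPlane := by
    rw [Complex.mem_slitPlane_iff]
    simpa using hz.imp id fun h => h.2
  have hz0 : z ≠ 0 := by rintro rfl; simp at hz
  refine ((((hasDerivAt_id z).const_mul (-Complex.I)).clog hs).add_const _).congr_deriv ?_
  simp only [id]
  field_simp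

lemma hasDerivAt_logDown {z : ℂ} (hz : z.im < 0 ∨ (z.im = 0 ∧ z.re ≠ 0)) :
    HasDerivAt logDown (1 / z) z := by
  have hs : Complex.I * z ∈ Complex.slitPlane := by
    rw [Complex.mem_slitPlane_iff]
    simpa using hz.imp id fun h => h.2
  have hz0 : z ≠ 0 := by rintro rfl; simp at hz
  refine ((((hasDerivAt_id z).const_mul Complex.I).clog hs).sub_const _).congr_deriv ?_
  simp only [id]
  field_simp

lemma log_I_mul (x : ℝ) : Complex.log (Complex.I * x) =
    Real.log |x| + Complex.I * Complex.arg (Complex.I * x) := by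
  rw [Complex.log, norm_mul, Complex.norm_I, one_mul, Complex.norm_real, Real.norm_eq_abs]
  ring

lemma log_neg_I_mul (x : ℝ) : Complex.log (-Complex.I * x) =
    Real.log |x| + Complex.I * Complex.arg (-Complex.I * x) := by
  have := log_I_mul (-x)
  rw [abs_neg] at this
  push_cast at this
  rwa [mul_neg, ← neg_mul] at this

lemma arg_I_mul_of_pos {x : ℝ} (hx : 0 < x) : Complex.arg (Complex.I * x) = Real.pi / 2 := by
  rw [mul_comm, Complex.arg_real_mul _ hx, Complex.arg_I]

lemma arg_neg_I_mul_of_pos {x : ℝ} (hx : 0 < x) :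
    Complex.arg (-Complex.I * x) = -(Real.pi / 2) := by
  rw [mul_comm, Complex.arg_real_mul _ hx, Complex.arg_neg_I]

lemma arg_I_mul_of_neg {x : ℝ} (hx : x < 0) : Complex.arg (Complex.I * x) = -(Real.pi / 2) := by
  have := arg_neg_I_mul_of_pos (neg_pos.2 hx)
  push_cast at this
  rwa [neg_mul_neg] at this

lemma arg_neg_I_mul_of_neg {x : ℝ} (hx : x < 0) :
    Complex.arg (-Complex.I * x) = Real.pi / 2 := by
  have := arg_I_mul_of_pos (neg_pos.2 hx)
  push_cast at this
  rwa [mul_neg, ← neg_mul] at this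

lemma logUp_of_pos {x : ℝ} (hx : 0 < x) : logUp x = Real.log |x| := by
  rw [logUp, log_neg_I_mul, arg_neg_I_mul_of_pos hx]; push_cast; ring

lemma logDown_of_pos {x : ℝ} (hx : 0 < x) : logDown x = Real.log |x| := by
  rw [logDown, log_I_mul, arg_I_mul_of_pos hx]; push_cast; ring

/-- This `iπ`, and its opposite from below, is the only source of the coupling between `f` and `g`
across a zero of `P`. -/
lemma logUp_of_neg {x : ℝ} (hx : x < 0) : logUp x = Real.log |x| + Complex.I * Real.pi := by
  rw [logUp, log_neg_I_mul, arg_neg_I_mul_of_neg hx]; push_cast; ring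

lemma logDown_of_neg {x : ℝ} (hx : x < 0) : logDown x = Real.log |x| - Complex.I * Real.pi := by
  rw [logDown, log_I_mul, arg_I_mul_of_neg hx]; push_cast; ring

/-! ### Boundary values and their local forms -/

/-- `g ± i f` are the boundary values on the real axis of `G`, which solves `L G = ev G` off the
real axis. -/
structure IsBoundaryPair (a : Fin 4 → ℝ) (ev : ℂ) (G : ℂ → ℂ) (f g : ℝ → ℂ) : Prop where
  exists_isSol : ∃ W, IsSol a ev {z | z.im ≠ 0} G W
  tendsto_up : ∀ x : ℝ, P a x ≠ 0 → Tendsto (fun η : ℝ => G (x + η * Complex.I)) (𝓝[>] 0)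
    (𝓝 (g x + Complex.I * f x))
  tendsto_down : ∀ x : ℝ, P a x ≠ 0 → Tendsto (fun η : ℝ => G (x - η * Complex.I)) (𝓝[>] 0)
    (𝓝 (g x - Complex.I * f x))

lemma tendsto_add_mul_I (x : ℝ) (s : ℂ) :
    Tendsto (fun η : ℝ => (x : ℂ) + η * s) (𝓝[>] 0) (𝓝 x) := by
  have : Tendsto (fun η : ℝ => (x : ℂ) + η * s) (𝓝 0) (𝓝 ((x : ℂ) + ((0 : ℝ) : ℂ) * s)) :=
    (by fun_prop : Continuous fun η : ℝ => (x : ℂ) + η * s).tendsto 0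
  simpa using this.mono_left nhdsWithin_le_nhds

/-- An explicit formula for `G` in the upper half of a disc passes to the real axis wherever it is
continuous, by uniqueness of the vertical limit. -/
lemma IsBoundaryPair.eq_up {a : Fin 4 → ℝ} {ev : ℂ} {G F : ℂ → ℂ} {f g : ℝ → ℂ}
    (h : IsBoundaryPair a ev G f g) {c : ℂ} {r : ℝ}
    (hG : ∀ z ∈ Metric.ball c r ∩ {z | 0 < z.im}, G z = F z) {x : ℝ}
    (hx : (x : ℂ) ∈ Metric.ball c r) (hF : ContinuousAt F x) (hP : P a x ≠ 0) :
    g x + Complex.I * f x = F x := by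
  have ht := tendsto_add_mul_I x Complex.I
  refine tendsto_nhds_unique (h.tendsto_up x hP) ((hF.tendsto.comp ht).congr' ?_)
  filter_upwards [ht.eventually (Metric.isOpen_ball.mem_nhds hx), self_mem_nhdsWithin] with η h1 h2
  have h2 : 0 < η := h2
  exact (hG _ ⟨h1, by simpa using h2⟩).symm

lemma IsBoundaryPair.eq_down {a : Fin 4 → ℝ} {ev : ℂ} {G F : ℂ → ℂ} {f g : ℝ → ℂ}
    (h : IsBoundaryPair a ev G f g) {c : ℂ} {r : ℝ}
    (hG : ∀ z ∈ Metric.ball c r ∩ {z | z.im < 0}, G z = F z) {x : ℝ}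
    (hx : (x : ℂ) ∈ Metric.ball c r) (hF : ContinuousAt F x) (hP : P a x ≠ 0) :
    g x - Complex.I * f x = F x := by
  have ht := tendsto_add_mul_I x (-Complex.I)
  have hd := h.tendsto_down x hP
  simp only [sub_eq_add_neg, ← mul_neg] at hd ⊢
  rw [mul_neg, ← neg_mul, neg_mul, ← mul_neg] at hd ⊢
  refine tendsto_nhds_unique hd ((hF.tendsto.comp ht).congr' ?_)
  filter_upwards [ht.eventually (Metric.isOpen_ball.mem_nhds hx), self_mem_nhdsWithin] with η h1 h2
  have h2 : 0 < η := h2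
  exact (hG _ ⟨h1, by simpa using h2⟩).symm

lemma convex_ball_inter_im_pos (c : ℂ) (r : ℝ) : Convex ℝ (Metric.ball c r ∩ {z | 0 < z.im}) :=
  (convex_ball c r).inter (convex_halfSpace_im_gt 0)

lemma convex_ball_inter_im_neg (c : ℂ) (r : ℝ) : Convex ℝ (Metric.ball c r ∩ {z | z.im < 0}) :=
  (convex_ball c r).inter (convex_halfSpace_im_lt 0)

/-- Near an ordinary point, both members of a boundary pair are restrictions of analytic
solutions. -/
lemma IsBoundaryPair.exists_isSol_of_ne_zero {a : Fin 4 → ℝ} {ev : ℂ} {G : ℂ → ℂ} {f g : ℝ → ℂ}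
    (h : IsBoundaryPair a ev G f g) {x₀ : ℝ} (hx₀ : P a x₀ ≠ 0) :
    ∃ r > 0, ∃ s w t u : ℂ → ℂ, IsSol a ev (Metric.ball x₀ r) s w ∧
      IsSol a ev (Metric.ball x₀ r) t u ∧ (∀ z ∈ Metric.ball (x₀ : ℂ) r, Pc a z ≠ 0) ∧
      ∀ x : ℝ, (x : ℂ) ∈ Metric.ball (x₀ : ℂ) r → g x = s x ∧ f x = t x := by
  have hc : Pc a x₀ ≠ 0 := by rw [Pc_ofReal]; exact_mod_cast hx₀
  obtain ⟨r, φ, W, hφ⟩ := exists_isLocalSol a ev x₀ (Or.inl hc)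
  obtain ⟨hP, T, hT⟩ := hφ.exists_primitive hc
  obtain ⟨w, hw⟩ := h.exists_isSol
  have hsol := hφ.isSol subset_rfl hP
  obtain ⟨A, B, hAB⟩ := IsSol.eq_combination (convex_ball_inter_im_pos x₀ r)
    (hφ.isSol inter_subset_left fun z hz => hP z hz.1)
    (fun z hz => hw z (ne_of_gt hz.2)) (fun z hz => hP z hz.1) (fun z hz => hφ.ne_zero z hz.1)
    (fun z hz => hT z hz.1)
  obtain ⟨A', B', hAB'⟩ := IsSol.eq_combination (convex_ball_inter_im_neg x₀ r)
    (hφ.isSol inter_subset_left fun z hz => hP z hz.1)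
    (fun z hz => hw z (ne_of_lt hz.2)) (fun z hz => hP z hz.1) (fun z hz => hφ.ne_zero z hz.1)
    (fun z hz => hT z hz.1)
  -- `g` and `f` are half the sum and `1 / (2i)` times the difference of the boundary values, so
  -- their coefficients arise likewise from those in the two half planes.
  refine ⟨r, hφ.r_pos, _, _, _, _,
    hsol.combination hP hφ.ne_zero hT ((A + A') / 2) ((B + B') / 2),
    hsol.combination hP hφ.ne_zero hT ((A - A') / (2 * Complex.I)) ((B - B') / (2 * Complex.I)),
    hP, fun x hx => ?_⟩
  have hPx : P a x ≠ 0 := by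
    have := hP x hx
    rw [Pc_ofReal] at this
    exact_mod_cast this
  have hcont : ∀ A B : ℂ, ContinuousAt (fun z => φ z * (A + B * T z)) x := fun A B =>
    (hφ.differentiableAt x hx).continuousAt.mul
      (continuousAt_const.add (continuousAt_const.mul (hT x hx).continuousAt))
  have h1 := h.eq_up hAB hx (hcont A B) hPx
  have h2 := h.eq_down hAB' hx (hcont A' B') hPx
  have hI := Complex.I_ne_zero
  constructor
  · linear_combination (h1 + h2) / 2
  · field_simp
    linear_combination h1 - h2

/-- The real form of the second solution divided by the first, near the zero `c` of `P`. -/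
def tau (p : ℂ) (c : ℝ) (H : ℂ → ℂ) (x : ℝ) : ℂ := ((Real.log |x - c| : ℝ) + H x) / p

/-- The form of a boundary pair on the two sides of a zero of `P`. -/
lemma IsBoundaryPair.exists_local_form {a : Fin 4 → ℝ} (ha : StrictMono a) {ev : ℂ} {G : ℂ → ℂ}
    {f g : ℝ → ℂ} (h : IsBoundaryPair a ev G f g) (i : Fin 4) :
    ∃ r φ W H, IsLocalSol a ev (a i) r φ W ∧
      (∀ z ∈ Metric.ball (a i : ℂ) r, DifferentiableAt ℂ H z) ∧
      (∀ z ∈ Metric.ball (a i : ℂ) r, z ≠ a i →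
        HasDerivAt H (dPc a (a i) / (Pc a z * φ z ^ 2) - 1 / (z - a i)) z) ∧
      ∃ αg βg αf βf : ℂ, ∀ x : ℝ, (x : ℂ) ∈ Metric.ball (a i : ℂ) r →
        (a i < x → g x = φ x * (αg + βg * tau (dPc a (a i)) (a i) H x) ∧
          f x = φ x * (αf + βf * tau (dPc a (a i)) (a i) H x)) ∧
        (x < a i →
          g x = φ x * (αg - Real.pi * βf / dPc a (a i) + βg * tau (dPc a (a i)) (a i) H x) ∧
          f x = φ x * (αf + Real.pi * βg / dPc a (a i) + βf * tau (dPc a (a i)) (a i) H x)) := by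
  have hd := dPc_ne_zero ha i
  have hc : Pc a (a i) = 0 := Finset.prod_eq_zero (Finset.mem_univ i) (sub_self _)
  obtain ⟨r, φ, W, hφ⟩ := exists_isLocalSol a ev (a i) (Or.inr ⟨hc, hd⟩)
  obtain ⟨H, hH, hH'⟩ := hφ.exists_regular_part hc hd
  obtain ⟨w, hw⟩ := h.exists_isSol
  set p := dPc a (a i) with hp
  have hT : ∀ (ℓ : ℂ → ℂ), ∀ z ∈ Metric.ball (a i : ℂ) r, z ≠ a i →
      HasDerivAt ℓ (1 / (z - a i)) (z - a i) →
      HasDerivAt (fun z => (ℓ (z - a i) + H z) / p) (1 / (Pc a z * φ z ^ 2)) z := by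
    intro ℓ z hz hzc hℓ
    have h1 : HasDerivAt (fun z : ℂ => z - a i) 1 z := (hasDerivAt_id z).sub_const _
    refine (((hℓ.comp z h1).add (hH' z hz hzc)).div_const p).congr_deriv ?_
    have h2 := hφ.Pc_ne_zero z hz hzc
    have h3 := hφ.ne_zero z hz
    have h4 : z - a i ≠ 0 := sub_ne_zero.2 hzc
    field_simp
    ring
  have hne : ∀ z : ℂ, z.im ≠ 0 → z ≠ a i := fun z hz hzc => hz (by rw [hzc]; simp)
  have hup : ∀ z ∈ Metric.ball (a i : ℂ) r ∩ {z | 0 < z.im},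
      HasDerivAt (fun z => (logUp (z - a i) + H z) / p) (1 / (Pc a z * φ z ^ 2)) z := by
    intro z hz
    have hz2 : 0 < z.im := hz.2
    exact hT logUp z hz.1 (hne z hz2.ne') (hasDerivAt_logUp (Or.inl (by simpa using hz2)))
  have hdown : ∀ z ∈ Metric.ball (a i : ℂ) r ∩ {z | z.im < 0},
      HasDerivAt (fun z => (logDown (z - a i) + H z) / p) (1 / (Pc a z * φ z ^ 2)) z := by
    intro z hz
    have hz2 : z.im < 0 := hz.2
    exact hT logDown z hz.1 (hne z hz2.ne) (hasDerivAt_logDown (Or.inl (by simpa using hz2)))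
  obtain ⟨A, B, hAB⟩ := IsSol.eq_combination (convex_ball_inter_im_pos (a i) r)
    (hφ.isSol inter_subset_left fun z hz => Pc_ne_zero_of_im (ne_of_gt hz.2))
    (fun z hz => hw z (ne_of_gt hz.2)) (fun z hz => Pc_ne_zero_of_im (ne_of_gt hz.2))
    (fun z hz => hφ.ne_zero z hz.1) hup
  obtain ⟨A', B', hAB'⟩ := IsSol.eq_combination (convex_ball_inter_im_neg (a i) r)
    (hφ.isSol inter_subset_left fun z hz => Pc_ne_zero_of_im (ne_of_lt hz.2))
    (fun z hz => hw z (ne_of_lt hz.2)) (fun z hz => Pc_ne_zero_of_im (ne_of_lt hz.2))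
    (fun z hz => hφ.ne_zero z hz.1) hdown
  have hI := Complex.I_ne_zero
  have hI2 := Complex.I_sq
  have hbd : ∀ x : ℝ, (x : ℂ) ∈ Metric.ball (a i : ℂ) r → x ≠ a i →
      g x + Complex.I * f x = φ x * (A + B * ((logUp ((x - a i : ℝ) : ℂ) + H x) / p)) ∧
      g x - Complex.I * f x = φ x * (A' + B' * ((logDown ((x - a i : ℝ) : ℂ) + H x) / p)) := by
    intro x hx hxi
    have hxc : (x : ℂ) ≠ a i := by exact_mod_cast hxi
    have hPx : P a x ≠ 0 := by
      have := hφ.Pc_ne_zero x hx hxc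
      rw [Pc_ofReal] at this
      exact_mod_cast this
    have him : ((x : ℂ) - a i).im = 0 ∧ ((x : ℂ) - a i).re ≠ 0 := by
      simpa [sub_ne_zero] using hxi
    have hφc := (hφ.differentiableAt x hx).continuousAt
    have c1 := (hT logUp x hx hxc (hasDerivAt_logUp (Or.inr him))).continuousAt
    have c2 := (hT logDown x hx hxc (hasDerivAt_logDown (Or.inr him))).continuousAt
    push_cast
    exact ⟨h.eq_up hAB hx (hφc.mul (continuousAt_const.add (continuousAt_const.mul c1))) hPx,
      h.eq_down hAB' hx (hφc.mul (continuousAt_const.add (continuousAt_const.mul c2))) hPx⟩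
  -- These are the coefficients on the right, where both logarithms are real. On the left, `±iπ`
  -- adds `iπ (B - B') / (2 p) = -π βf / p` to the constant of `g` and `π (B + B') / (2 p) = π βg /
  -- p` to that of `f`.
  refine ⟨r, φ, W, H, hφ, hH, hH', (A + A') / 2, (B + B') / 2, (A - A') / (2 * Complex.I),
    (B - B') / (2 * Complex.I), fun x hx => ⟨fun hlt => ?_, fun hlt => ?_⟩⟩
  · obtain ⟨h1, h2⟩ := hbd x hx hlt.ne'
    rw [logUp_of_pos (sub_pos.2 hlt)] at h1
    rw [logDown_of_pos (sub_pos.2 hlt)] at h2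
    rw [tau]
    constructor
    · linear_combination (h1 + h2) / 2
    · rw [← mul_right_inj' (mul_ne_zero two_ne_zero hI)]
      have e1 : (A - A') / (2 * Complex.I) * (2 * Complex.I) = A - A' :=
        div_mul_cancel₀ _ (mul_ne_zero two_ne_zero hI)
      have e2 : (B - B') / (2 * Complex.I) * (2 * Complex.I) = B - B' :=
        div_mul_cancel₀ _ (mul_ne_zero two_ne_zero hI)
      linear_combination h1 - h2 - φ x * e1 -
        φ x * (((Real.log |x - a i| : ℝ) + H x) / p) * e2
  · obtain ⟨h1, h2⟩ := hbd x hx hlt.ne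
    rw [logUp_of_neg (sub_neg.2 hlt)] at h1
    rw [logDown_of_neg (sub_neg.2 hlt)] at h2
    rw [tau]
    have e1 : (A - A') / (2 * Complex.I) * (2 * Complex.I) = A - A' :=
      div_mul_cancel₀ _ (mul_ne_zero two_ne_zero hI)
    have e2 : (B - B') / (2 * Complex.I) * (2 * Complex.I) = B - B' :=
      div_mul_cancel₀ _ (mul_ne_zero two_ne_zero hI)
    constructor
    · have e3 : (B - B') / (2 * Complex.I) = -Complex.I * (B - B') / 2 := by
        field_simp; linear_combination (B - B') * hI2
      rw [e3]
      linear_combination (h1 + h2) / 2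
    · rw [← mul_right_inj' (mul_ne_zero two_ne_zero hI)]
      linear_combination h1 - h2 - φ x * e1 -
        φ x * (((Real.log |x - a i| : ℝ) + H x) / p) * e2

/-! ### Limits of the Lagrange forms at the zeros of `P` -/

lemma hasDerivAt_log_abs_sub {c x : ℝ} (hx : x ≠ c) :
    HasDerivAt (fun x : ℝ => Real.log |x - c|) (1 / (x - c)) x := by
  simp only [Real.log_abs]
  exact ((hasDerivAt_id x).sub_const c).log (sub_ne_zero.2 hx)

/-- Partial fractions of `1 / P`. They make `v` a primitive of `1 / P`, so `P v' = 1` and `[ψ, v]`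
reduces to `ψ - v P ψ'`. -/
lemma sum_residues {a : Fin 4 → ℝ} (ha : StrictMono a) {x : ℝ} (hx : P a x ≠ 0) :
    ∑ i, (∏ j ∈ Finset.univ.erase i, 1 / (a i - a j)) * (1 / (x - a i)) = 1 / P a x := by
  have h0 : (Finset.univ.erase 0 : Finset (Fin 4)) = {1, 2, 3} := by decide
  have h1 : (Finset.univ.erase 1 : Finset (Fin 4)) = {0, 2, 3} := by decide
  have h2 : (Finset.univ.erase 2 : Finset (Fin 4)) = {0, 1, 3} := by decide
  have h3 : (Finset.univ.erase 3 : Finset (Fin 4)) = {0, 1, 2} := by decide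
  have hne : ∀ i j : Fin 4, i ≠ j → a i - a j ≠ 0 := fun i j h =>
    sub_ne_zero.2 fun h' => h (ha.injective h')
  rw [P_ne_zero_iff] at hx
  have hx0 := sub_ne_zero.2 (hx 0)
  have hx1 := sub_ne_zero.2 (hx 1)
  have hx2 := sub_ne_zero.2 (hx 2)
  have hx3 := sub_ne_zero.2 (hx 3)
  have h01 := hne 0 1 (by decide)
  have h02 := hne 0 2 (by decide)
  have h03 := hne 0 3 (by decide)
  have h12 := hne 1 2 (by decide)
  have h13 := hne 1 3 (by decide)
  have h23 := hne 2 3 (by decide)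
  rw [Fin.sum_univ_four, h0, h1, h2, h3, P, Fin.prod_univ_four]
  simp only [Finset.mem_insert, Finset.mem_singleton, Fin.reduceEq, or_self, not_false_eq_true,
    Finset.prod_insert, Finset.prod_singleton]
  rw [show a 1 - a 0 = -(a 0 - a 1) by ring, show a 2 - a 0 = -(a 0 - a 2) by ring,
    show a 3 - a 0 = -(a 0 - a 3) by ring, show a 2 - a 1 = -(a 1 - a 2) by ring,
    show a 3 - a 1 = -(a 1 - a 3) by ring, show a 3 - a 2 = -(a 2 - a 3) by ring]
  field_simp
  ring

lemma hasDerivAt_vFun {a : Fin 4 → ℝ} (ha : StrictMono a) {x : ℝ} (hx : P a x ≠ 0) :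
    HasDerivAt (vFun a) (1 / P a x) x := by
  have h : HasDerivAt (fun y => ∑ i, (∏ j ∈ Finset.univ.erase i, 1 / (a i - a j)) *
      Real.log |y - a i|) (1 / P a x) x := by
    rw [← sum_residues ha hx]
    exact HasDerivAt.fun_sum fun i _ =>
      (hasDerivAt_log_abs_sub (P_ne_zero_iff.1 hx i)).const_mul _
  refine h.ofReal_comp.congr_deriv ?_
  push_cast
  rfl

lemma lagrange_vFun {a : Fin 4 → ℝ} (ha : StrictMono a) (ψ : ℝ → ℂ) {x : ℝ} (hx : P a x ≠ 0) :
    lagrange a ψ (vFun a) x = ψ x - vFun a x * quasiDeriv a ψ x := by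
  have hc : (fun y => starRingEnd ℂ (vFun a y)) = vFun a := by
    funext y; rw [vFun, Complex.conj_ofReal]
  have hP : (P a x : ℂ) ≠ 0 := by exact_mod_cast hx
  have hcx : starRingEnd ℂ (vFun a x) = vFun a x := congrFun hc x
  rw [lagrange, hc, hcx, quasiDeriv, (hasDerivAt_vFun ha hx).deriv, mul_one_div_cancel hP, mul_one]

/-- The regular part of `v` at `a i`. -/
def vReg (a : Fin 4 → ℝ) (i : Fin 4) (x : ℝ) : ℂ :=
  ((∑ k ∈ Finset.univ.erase i, (∏ j ∈ Finset.univ.erase k, 1 / (a k - a j)) *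
    Real.log |x - a k| : ℝ) : ℂ)

lemma dPc_apply (a : Fin 4 → ℝ) (i : Fin 4) :
    dPc a (a i) = ∏ j ∈ Finset.univ.erase i, ((a i : ℂ) - a j) := by
  rw [dPc]
  refine Finset.sum_eq_single i (fun k _ hk => ?_) (by simp)
  exact Finset.prod_eq_zero (Finset.mem_erase.2 ⟨hk.symm, Finset.mem_univ i⟩) (sub_self _)

/-- The logarithm in `v` has the coefficient `1 / P'(a i)`, the same as in `tau`; hence the
logarithms cancel to leading order in `[ψ, v]`. -/
lemma vFun_eq (a : Fin 4 → ℝ) (i : Fin 4) (x : ℝ) :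
    vFun a x = (Real.log |x - a i| : ℝ) / dPc a (a i) + vReg a i x := by
  rw [vFun, vReg, ← Finset.add_sum_erase _ _ (Finset.mem_univ i), dPc_apply]
  push_cast
  simp only [one_div, Finset.prod_inv_distrib]
  ring

lemma continuousAt_vReg {a : Fin 4 → ℝ} (ha : StrictMono a) (i : Fin 4) :
    ContinuousAt (vReg a i) (a i) := by
  refine Complex.continuous_ofReal.continuousAt.comp ?_
  refine tendsto_finsetSum _ fun k hk => ?_
  have hk' : a i - a k ≠ 0 := sub_ne_zero.2 fun h => (Finset.mem_erase.1 hk).1 (ha.injective h).symm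
  have : ContinuousAt (fun x : ℝ => Real.log |x - a k|) (a i) :=
    ContinuousAt.log (by fun_prop) (abs_ne_zero.2 hk')
  exact (continuousAt_const.mul this).tendsto

lemma tendsto_mul_log_pow (c : ℝ) :
    Tendsto (fun x : ℝ => ((x - c : ℝ) : ℂ) * (Real.log |x - c| : ℝ)) (𝓝[≠] c) (𝓝 0) ∧
    Tendsto (fun x : ℝ => ((x - c : ℝ) : ℂ) * (Real.log |x - c| : ℝ) ^ 2) (𝓝[≠] c) (𝓝 0) := by
  have habs : Tendsto (fun x : ℝ => |x - c|) (𝓝[≠] c) (𝓝[>] 0) := by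
    rw [tendsto_nhdsWithin_iff]
    constructor
    · have : Tendsto (fun x : ℝ => |x - c|) (𝓝 c) (𝓝 |c - c|) :=
        (by fun_prop : Continuous fun x : ℝ => |x - c|).tendsto c
      simpa using this.mono_left nhdsWithin_le_nhds
    · filter_upwards [self_mem_nhdsWithin] with x hx
      exact abs_pos.2 (sub_ne_zero.2 hx)
  have h1 := (tendsto_log_mul_rpow_nhdsGT_zero (r := 1) one_pos).comp habs
  have h2 := ((tendsto_log_mul_rpow_nhdsGT_zero (r := 1 / 2) (by norm_num)).comp habs).pow 2
  constructor <;> rw [tendsto_zero_iff_norm_tendsto_zero]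
  · refine h1.norm.congr' ?_ |>.trans (by simp)
    filter_upwards with x
    simp only [Function.comp, Real.rpow_one, norm_mul, Complex.norm_real, Real.norm_eq_abs,
      abs_abs, mul_comm]
  · refine h2.congr' ?_ |>.trans (by simp)
    filter_upwards with x
    simp only [Function.comp, mul_pow, norm_mul, norm_pow, Complex.norm_real, Real.norm_eq_abs,
      sq_abs]
    rw [← Real.rpow_natCast (|x - c| ^ (1 / 2 : ℝ)), ← Real.rpow_mul (abs_nonneg _)]
    norm_num
    ring

/-- A differentiable function with a zero at `c` is `O(x - c)`, which beats any power of the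
logarithm. The square is needed since both `v` and `P ψ'` contribute a logarithm to `[ψ, v]`. -/
lemma tendsto_mul_log_of_differentiableAt {F : ℂ → ℂ} {c : ℝ} (hF : DifferentiableAt ℂ F c)
    (h0 : F c = 0) :
    Tendsto (fun x : ℝ => F x * (Real.log |x - c| : ℝ)) (𝓝[≠] c) (𝓝 0) ∧
    Tendsto (fun x : ℝ => F x * (Real.log |x - c| : ℝ) ^ 2) (𝓝[≠] c) (𝓝 0) := by
  have hs := hasDerivAt_iff_tendsto_slope.1 hF.hasDerivAt.comp_ofReal
  have key : ∀ k : ℕ, Tendsto (fun x : ℝ => ((x - c : ℝ) : ℂ) * (Real.log |x - c| : ℝ) ^ k)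
      (𝓝[≠] c) (𝓝 0) →
      Tendsto (fun x : ℝ => F x * (Real.log |x - c| : ℝ) ^ k) (𝓝[≠] c) (𝓝 0) := by
    intro k hk
    have h1 := hs.mul hk
    rw [mul_zero] at h1
    refine h1.congr' ?_
    filter_upwards [self_mem_nhdsWithin] with x hx
    have hx' : ((x - c : ℝ) : ℂ) ≠ 0 := by exact_mod_cast sub_ne_zero.2 hx
    rw [slope_def_module, h0, sub_zero, Complex.real_smul, Complex.ofReal_inv]
    field_simp
  obtain ⟨h1, h2⟩ := tendsto_mul_log_pow c
  exact ⟨by simpa using key 1 (by simpa using h1), key 2 h2⟩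

section

variable {a : Fin 4 → ℝ} {ev : ℂ} {i : Fin 4} {r : ℝ} {φ W H : ℂ → ℂ}

lemma IsLocalSol.P_ne_zero (hφ : IsLocalSol a ev (a i) r φ W) {x : ℝ}
    (hx : (x : ℂ) ∈ Metric.ball (a i : ℂ) r) (hxi : x ≠ a i) : P a x ≠ 0 := by
  have := hφ.Pc_ne_zero x hx (by exact_mod_cast hxi)
  rw [Pc_ofReal] at this
  exact_mod_cast this

lemma IsLocalSol.hasDerivAt_combination (ha : StrictMono a) (hφ : IsLocalSol a ev (a i) r φ W)
    (hH : ∀ z ∈ Metric.ball (a i : ℂ) r, z ≠ a i →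
      HasDerivAt H (dPc a (a i) / (Pc a z * φ z ^ 2) - 1 / (z - a i)) z) (α β : ℂ) {x : ℝ}
    (hx : (x : ℂ) ∈ Metric.ball (a i : ℂ) r) (hxi : x ≠ a i) :
    HasDerivAt (fun x : ℝ => φ x * (α + β * tau (dPc a (a i)) (a i) H x))
      ((W x * (α + β * tau (dPc a (a i)) (a i) H x) + β / φ x) / P a x) x := by
  have hxc : (x : ℂ) ≠ a i := by exact_mod_cast hxi
  have hP := hφ.Pc_ne_zero x hx hxc
  have hφ0 := hφ.ne_zero x hx
  have hd := dPc_ne_zero ha i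
  have hsub : (x : ℂ) - a i ≠ 0 := sub_ne_zero.2 hxc
  have h1 := (hφ.hasDerivAt x hx hP).comp_ofReal
  have h2 := (hH x hx hxc).comp_ofReal
  have h3 := (hasDerivAt_log_abs_sub hxi).ofReal_comp
  have h4 : HasDerivAt (fun x : ℝ => tau (dPc a (a i)) (a i) H x)
      (1 / (Pc a x * φ x ^ 2)) x := by
    refine ((h3.add h2).div_const (dPc a (a i))).congr_deriv ?_
    push_cast
    field_simp
    ring
  refine (h1.mul ((h4.const_mul β).const_add α)).congr_deriv ?_
  rw [← Pc_ofReal]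
  field_simp

/-- The limit of `[ψ, v]` for a function with a logarithmic singularity is `α + β κ`, with this
`κ`. -/
def kappa (a : Fin 4 → ℝ) (i : Fin 4) (H : ℂ → ℂ) : ℂ := H (a i) / dPc a (a i) - vReg a i (a i)

/-- Here `P ψ' = W (α + β τ) + β / φ`, and `W` vanishes at `a i`, so the limit is `β`. In `ψ - v P
ψ'` the logarithm is multiplied by `φ - 1 / φ`, which vanishes at `a i`, up to terms with the factor
`W`. Since `kappa` does not depend on the side, comparing both limits across `a i` compares `β` and
`α`. -/
lemma IsLocalSol.tendsto_lagrange (ha : StrictMono a) (hφ : IsLocalSol a ev (a i) r φ W)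
    (hH : ∀ z ∈ Metric.ball (a i : ℂ) r, DifferentiableAt ℂ H z)
    (hH' : ∀ z ∈ Metric.ball (a i : ℂ) r, z ≠ a i →
      HasDerivAt H (dPc a (a i) / (Pc a z * φ z ^ 2) - 1 / (z - a i)) z) {α β : ℂ}
    {ψ : ℝ → ℂ} {S : Set ℝ} (hS : IsOpen S) (hSi : a i ∉ S)
    (hψ : ∀ x ∈ S, (x : ℂ) ∈ Metric.ball (a i : ℂ) r →
      ψ x = φ x * (α + β * tau (dPc a (a i)) (a i) H x)) :
    Tendsto (quasiDeriv a ψ) (𝓝[S] (a i)) (𝓝 β) ∧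
    Tendsto (lagrange a ψ uFun) (𝓝[S] (a i)) (𝓝 (-β)) ∧
    Tendsto (lagrange a ψ (vFun a)) (𝓝[S] (a i)) (𝓝 (α + β * kappa a i H)) := by
  have hd := dPc_ne_zero ha i
  set p := dPc a (a i) with hp
  have hc := Metric.mem_ball_self hφ.r_pos (x := (a i : ℂ))
  have hball : ∀ᶠ x : ℝ in 𝓝[S] (a i), x ∈ S ∧ (x : ℂ) ∈ Metric.ball (a i : ℂ) r ∧ x ≠ a i := by
    have h1 := (Complex.continuous_ofReal.tendsto (a i)).eventually
      (Metric.isOpen_ball.mem_nhds hc)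
    filter_upwards [self_mem_nhdsWithin, nhdsWithin_le_nhds h1] with x h2 h3
    exact ⟨h2, h3, fun h => hSi (h ▸ h2)⟩
  have hle : 𝓝[S] (a i) ≤ 𝓝[≠] (a i) := nhdsWithin_mono _ fun x hx h => hSi (h ▸ hx)
  have hq : ∀ᶠ x in 𝓝[S] (a i), quasiDeriv a ψ x = W x * (α + β * tau p (a i) H x) + β / φ x := by
    filter_upwards [hball] with x hx
    obtain ⟨h1, h2, h3⟩ := hx
    have hP := hφ.P_ne_zero h2 h3
    have hev : ψ =ᶠ[𝓝 x] fun x : ℝ => φ x * (α + β * tau p (a i) H x) := by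
      filter_upwards [hS.mem_nhds h1, (Complex.continuous_ofReal.tendsto x).eventually
        (Metric.isOpen_ball.mem_nhds h2)] with y hy1 hy2
      exact hψ y hy1 hy2
    have hder := (hφ.hasDerivAt_combination ha hH' α β h2 h3).congr_of_eventuallyEq hev
    rw [quasiDeriv, hder.deriv, mul_div_cancel₀]
    exact_mod_cast hP
  have hco : ∀ F : ℂ → ℂ, DifferentiableAt ℂ F (a i) →
      Tendsto (fun x : ℝ => F x) (𝓝[S] (a i)) (𝓝 (F (a i))) := fun F hF =>
    (hF.continuousAt.tendsto.comp (Complex.continuous_ofReal.tendsto (a i))).mono_left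
      nhdsWithin_le_nhds
  have hWd := (hφ.hasDerivAt_quasi _ hc).differentiableAt
  have hφd := hφ.differentiableAt _ hc
  have hφ1 := hφ.map_center
  have hW0 := hφ.quasi_center
  have tφ := hco φ hφd
  have tW := hco W hWd
  have tH := hco H (hH _ hc)
  rw [hφ1] at tφ
  rw [hW0] at tW
  obtain ⟨W1, W2⟩ := tendsto_mul_log_of_differentiableAt hWd hW0
  replace W1 := W1.mono_left hle
  replace W2 := W2.mono_left hle
  have tquasi : Tendsto (quasiDeriv a ψ) (𝓝[S] (a i)) (𝓝 β) := by
    have h1 := ((tW.mul_const α).add ((W1.add (tW.mul tH)).mul_const (β / p))).add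
      ((tendsto_const_nhds (x := β)).div tφ one_ne_zero)
    have e : (0 : ℂ) * α + (0 + 0 * H (a i)) * (β / p) + β / 1 = β := by ring
    rw [e] at h1
    refine h1.congr' ?_
    filter_upwards [hq] with x hx
    rw [hx, tau]
    simp only [Pi.div_apply]
    ring
  refine ⟨tquasi, ?_, ?_⟩
  · rw [lagrange_uFun]
    exact tquasi.neg
  · have hFd : DifferentiableAt ℂ (fun z => φ z - 1 / φ z) (a i) :=
      hφd.sub ((differentiableAt_const _).div hφd (hφ.ne_zero _ hc))
    have F1 := (tendsto_mul_log_of_differentiableAt hFd (by simp [hφ1])).1.mono_left hle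
    have tv := (continuousAt_vReg ha i).tendsto.mono_left (nhdsWithin_le_nhds (s := S))
    have t1 := tφ.mul_const α
    have t2 := (F1.add (tφ.mul tH)).div_const p
    have t3 := tv.div tφ one_ne_zero
    have t4 := (W1.div_const p).add (tv.mul tW)
    have t5 := ((W2.add (W1.mul tH)).div_const p).add (tv.mul (W1.add (tW.mul tH)))
    have h1 := ((t1.add ((t2.sub t3).mul_const β)).sub (t4.mul_const α)).sub (t5.mul_const (β / p))
    have e : 1 * α + ((0 + 1 * H (a i)) / p - vReg a i (a i) / 1) * β -
        (0 / p + vReg a i (a i) * 0) * α - ((0 + 0 * H (a i)) / p +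
          vReg a i (a i) * (0 + 0 * H (a i))) * (β / p) = α + β * kappa a i H := by
      rw [kappa]; ring
    rw [e] at h1
    refine h1.congr' ?_
    filter_upwards [hq, hball] with x hx hx2
    obtain ⟨h2, h3, h4⟩ := hx2
    have hφ0 := hφ.ne_zero x h3
    rw [lagrange_vFun ha ψ (hφ.P_ne_zero h3 h4), hx, hψ x h2 h3, vFun_eq a i, tau, ← hp]
    simp only [Pi.div_apply]
    field_simp
    ring

end

/-! ### The boundary pair `(f, H_T f)` and matching across the zeros of `P` -/

lemma truncIntegral_eq (a : Fin 4 → ℝ) (f : ℝ → ℂ) (x ε : ℝ) :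
    truncIntegral a f x ε = ((1 / Real.pi : ℝ) : ℂ) *
      ∫ y in {y : ℝ | ε ≤ |y - x|}, zeroExt a f y / ((y - x : ℝ) : ℂ) := by
  have h : (fun y : ℝ => zeroExt a f y / ((y - x : ℝ) : ℂ)) =
      (Ioo (a 1) (a 3)).indicator fun y => f y / ((y - x : ℝ) : ℂ) := by
    funext y
    by_cases hy : y ∈ Ioo (a 1) (a 3) <;> simp [zeroExt, hy]
  rw [truncIntegral, h, setIntegral_indicator measurableSet_Ioo, inter_comm]
  rfl

lemma IsEigenfunctionLS.tendsto_truncIntegral {a : Fin 4 → ℝ} (ha : StrictMono a) {ev : ℂ}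
    {f : ℝ → ℂ} (hf : IsEigenfunctionLS a ev f) {x : ℝ} (hx : P a x ≠ 0) :
    Tendsto (truncIntegral a f x) (𝓝[>] 0) (𝓝 (HT a f x)) ∧
    Tendsto (fun η : ℝ => cauchy (zeroExt a f) (x + η * Complex.I)) (𝓝[>] 0)
      (𝓝 (HT a f x + Complex.I * zeroExt a f x)) ∧
    Tendsto (fun η : ℝ => cauchy (zeroExt a f) (x - η * Complex.I)) (𝓝[>] 0)
      (𝓝 (HT a f x - Complex.I * zeroExt a f x)) := by
  obtain ⟨g, h1, h2, h3⟩ := exists_plemelj (hf.integrable_zeroExt ha)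
    (hf.differentiableAt_zeroExt ha hx)
  have h4 : Tendsto (truncIntegral a f x) (𝓝[>] 0) (𝓝 g) := by
    simpa only [← truncIntegral_eq] using h1
  have h5 : HT a f x = g := h4.limUnder_eq
  rw [h5]
  exact ⟨h4, h2, h3⟩

lemma IsEigenfunctionLS.isBoundaryPair {a : Fin 4 → ℝ} (ha : StrictMono a) {ev : ℂ}
    {f : ℝ → ℂ} (hf : IsEigenfunctionLS a ev f) :
    IsBoundaryPair a ev (cauchy (zeroExt a f)) (zeroExt a f) (HT a f) where
  exists_isSol := hf.isSol_cauchy ha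
  tendsto_up _ hx := (hf.tendsto_truncIntegral ha hx).2.1
  tendsto_down _ hx := (hf.tendsto_truncIntegral ha hx).2.2

lemma analyticAt_comp_ofReal {F : ℂ → ℂ} {c : ℂ} {r : ℝ}
    (hF : ∀ z ∈ Metric.ball c r, DifferentiableAt ℂ F z) {x : ℝ}
    (hx : (x : ℂ) ∈ Metric.ball c r) : AnalyticAt ℝ (fun y : ℝ => F y) x := by
  have h1 : AnalyticAt ℂ F (x : ℂ) := DifferentiableOn.analyticAt
    (fun z hz => (hF z hz).differentiableWithinAt) (Metric.isOpen_ball.mem_nhds hx)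
  have h2 : AnalyticAt ℝ F (Complex.ofRealCLM x) := h1.restrictScalars
  exact h2.comp (Complex.ofRealCLM.analyticAt x)

lemma IsSol.analyticAt {a : Fin 4 → ℝ} {ev : ℂ} {x₀ r : ℝ} (hr : 0 < r) {s w : ℂ → ℂ}
    (hs : IsSol a ev (Metric.ball (x₀ : ℂ) r) s w)
    {g : ℝ → ℂ} (hg : ∀ x : ℝ, (x : ℂ) ∈ Metric.ball (x₀ : ℂ) r → g x = s x) :
    AnalyticAt ℝ g x₀ := by
  have h0 := Metric.mem_ball_self hr (x := (x₀ : ℂ))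
  refine (analyticAt_comp_ofReal (fun z hz => (hs z hz).1.differentiableAt) h0).congr ?_
  filter_upwards [(Complex.continuous_ofReal.tendsto x₀).eventually
    (Metric.isOpen_ball.mem_nhds h0)] with x hx
  exact (hg x hx).symm

lemma IsSol.L_eq {a : Fin 4 → ℝ} {ev : ℂ} {x₀ r : ℝ} (hr : 0 < r) {s w : ℂ → ℂ}
    (hs : IsSol a ev (Metric.ball (x₀ : ℂ) r) s w)
    (hP : ∀ z ∈ Metric.ball (x₀ : ℂ) r, Pc a z ≠ 0)
    {g : ℝ → ℂ} (hg : ∀ x : ℝ, (x : ℂ) ∈ Metric.ball (x₀ : ℂ) r → g x = s x) :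
    L a g x₀ = ev * g x₀ := by
  have h0 := Metric.mem_ball_self hr (x := (x₀ : ℂ))
  have hnear : ∀ x : ℝ, (x : ℂ) ∈ Metric.ball (x₀ : ℂ) r →
      ∀ᶠ y : ℝ in 𝓝 x, (y : ℂ) ∈ Metric.ball (x₀ : ℂ) r := fun x hx =>
    (Complex.continuous_ofReal.tendsto x).eventually (Metric.isOpen_ball.mem_nhds hx)
  have hq : quasiDeriv a g =ᶠ[𝓝 x₀] fun x : ℝ => w x := by
    filter_upwards [hnear x₀ h0] with x hx
    have h1 : HasDerivAt g (w x / Pc a x) x := by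
      refine (hs x hx).1.comp_ofReal.congr_of_eventuallyEq ?_
      filter_upwards [hnear x hx] with y hy using hg y hy
    rw [quasiDeriv, h1.deriv, ← Pc_ofReal, mul_div_cancel₀ _ (hP x hx)]
  rw [L, hq.deriv_eq, (hs x₀ h0).2.comp_ofReal.deriv, hg x₀ h0]
  push_cast
  ring

section

variable {a : Fin 4 → ℝ} {ev : ℂ} {G : ℂ → ℂ} {f g : ℝ → ℂ}

lemma IsBoundaryPair.analyticAt (h : IsBoundaryPair a ev G f g) {x : ℝ} (hx : P a x ≠ 0) :
    AnalyticAt ℝ g x ∧ AnalyticAt ℝ f x ∧ L a g x = ev * g x := by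
  obtain ⟨r, hr, s, w, t, u, hs, ht, hP, hgf⟩ := h.exists_isSol_of_ne_zero hx
  exact ⟨hs.analyticAt hr fun x hx => (hgf x hx).1, ht.analyticAt hr fun x hx => (hgf x hx).2,
    hs.L_eq hr hP fun x hx => (hgf x hx).1⟩

lemma eventually_mem_ball {c : ℂ} {r x : ℝ} (hx : (x : ℂ) ∈ Metric.ball c r) (S : Set ℝ) :
    ∀ᶠ y : ℝ in 𝓝[S] x, y ∈ S ∧ (y : ℂ) ∈ Metric.ball c r := by
  filter_upwards [self_mem_nhdsWithin, nhdsWithin_le_nhds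
    ((Complex.continuous_ofReal.tendsto x).eventually (Metric.isOpen_ball.mem_nhds hx))]
    with y h1 h2 using ⟨h1, h2⟩

/-- If `[f, v]` is continuous across `a i`, then `g` is bounded near `a i` and `[g, u]` vanishes
there. -/
lemma IsBoundaryPair.regular_of_tendsto_lagrange (h : IsBoundaryPair a ev G f g)
    (ha : StrictMono a) {i : Fin 4} {c : ℂ}
    (hl : Tendsto (lagrange a f (vFun a)) (𝓝[<] (a i)) (𝓝 c))
    (hr : Tendsto (lagrange a f (vFun a)) (𝓝[>] (a i)) (𝓝 c)) :
    ((∃ C, ∀ᶠ x in 𝓝[>] (a i), ‖g x‖ ≤ C) ∧ ∃ C, ∀ᶠ x in 𝓝[<] (a i), ‖g x‖ ≤ C) ∧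
    Tendsto (lagrange a g uFun) (𝓝[>] (a i)) (𝓝 0) ∧
    Tendsto (lagrange a g uFun) (𝓝[<] (a i)) (𝓝 0) := by
  obtain ⟨r, φ, W, H, hφ, hH, hH', αg, βg, αf, βf, hform⟩ := h.exists_local_form ha i
  have hd := dPc_ne_zero ha i
  set p := dPc a (a i) with hp
  have h0 := Metric.mem_ball_self hφ.r_pos (x := (a i : ℂ))
  -- The jump of `[f, v]` across `a i` is `π βg / p` up to sign, since `βf` is the same on both
  -- sides.
  have hβ : βg = 0 := by
    have h1 := tendsto_nhds_unique hr (hφ.tendsto_lagrange ha hH hH' isOpen_Ioi self_notMem_Ioi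
      fun x hx hxb => ((hform x hxb).1 hx).2).2.2
    have h2 := tendsto_nhds_unique hl (hφ.tendsto_lagrange ha hH hH' isOpen_Iio self_notMem_Iio
      fun x hx hxb => ((hform x hxb).2 hx).2).2.2
    have h3 : (Real.pi : ℂ) * βg / p = 0 := by linear_combination h1 - h2
    have hpi : (Real.pi : ℂ) ≠ 0 := by exact_mod_cast Real.pi_ne_zero
    simpa [hpi, hd] using h3
  have hbd : ∀ (S : Set ℝ) (γ : ℂ), (∀ x ∈ S, (x : ℂ) ∈ Metric.ball (a i : ℂ) r →
      g x = φ x * (γ + 0 * tau p (a i) H x)) → ∃ C, ∀ᶠ x in 𝓝[S] (a i), ‖g x‖ ≤ C := by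
    intro S γ hS
    have h1 : Tendsto (fun x : ℝ => ‖φ x * γ‖) (𝓝[S] (a i)) (𝓝 ‖φ (a i) * γ‖) :=
      (((hφ.differentiableAt _ h0).continuousAt.tendsto.comp
        (Complex.continuous_ofReal.tendsto (a i))).mono_left nhdsWithin_le_nhds
        |>.mul_const γ).norm
    refine ⟨‖φ (a i) * γ‖ + 1, ?_⟩
    filter_upwards [h1.eventually (gt_mem_nhds (lt_add_one _)), eventually_mem_ball h0 S]
      with x hx1 hx2
    rw [hS x hx2.1 hx2.2, zero_mul, add_zero]
    exact hx1.le
  subst hβ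
  have hR := fun x hx hxb => ((hform x hxb).1 hx).1
  have hL := fun x hx hxb => ((hform x hxb).2 hx).1
  refine ⟨⟨hbd (Ioi (a i)) _ hR, hbd (Iio (a i)) _ hL⟩, ?_, ?_⟩
  · simpa using (hφ.tendsto_lagrange ha hH hH' isOpen_Ioi self_notMem_Ioi hR).2.1
  · simpa using (hφ.tendsto_lagrange ha hH hH' isOpen_Iio self_notMem_Iio hL).2.1

lemma lagrange_congr {ψ ψ' v : ℝ → ℂ} {x : ℝ} (h : ψ =ᶠ[𝓝 x] ψ') :
    lagrange a ψ v x = lagrange a ψ' v x := by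
  simp only [lagrange, quasiDeriv, h.deriv_eq, h.eq_of_nhds]

/-- Openness of `S` matters: the form contains a derivative, so agreement is needed on a full
neighbourhood of each nearby point of `S`. -/
lemma lagrange_eventuallyEq {ψ ψ' : ℝ → ℂ} {c : ℝ} {S : Set ℝ} (hS : IsOpen S)
    (h : ψ =ᶠ[𝓝[S] c] ψ') (v : ℝ → ℂ) : lagrange a ψ v =ᶠ[𝓝[S] c] lagrange a ψ' v := by
  obtain ⟨U, hU, hcU, hUS⟩ := mem_nhdsWithin.1 h
  filter_upwards [self_mem_nhdsWithin, mem_nhdsWithin_of_mem_nhds (hU.mem_nhds hcU)] with x hx1 hx2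
  refine lagrange_congr ?_
  filter_upwards [(hU.inter hS).mem_nhds ⟨hx2, hx1⟩] with y hy using hUS hy

lemma lagrange_zero (v : ℝ → ℂ) : lagrange a (fun _ => 0) v = fun _ => 0 := by
  funext x; simp [lagrange, quasiDeriv]

/-- If `f` vanishes to the left of `a i`, then `g` has a logarithmic singularity at `a i` whose
coefficient determines `f` to the right of `a i`. -/
lemma IsBoundaryPair.log_of_eventually_zero (h : IsBoundaryPair a ev G f g)
    (ha : StrictMono a) {i : Fin 4} (hl : f =ᶠ[𝓝[<] (a i)] fun _ => 0) :
    ∃ r φ W H, IsLocalSol a ev (a i) r φ W ∧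
      (∀ z ∈ Metric.ball (a i : ℂ) r, DifferentiableAt ℂ H z) ∧
      (∀ z ∈ Metric.ball (a i : ℂ) r, z ≠ a i →
        HasDerivAt H (dPc a (a i) / (Pc a z * φ z ^ 2) - 1 / (z - a i)) z) ∧
      ∃ α β : ℂ, (∀ x : ℝ, (x : ℂ) ∈ Metric.ball (a i : ℂ) r → x ≠ a i →
          g x = φ x * (α + β * tau (dPc a (a i)) (a i) H x)) ∧
        (β = 0 → f =ᶠ[𝓝[>] (a i)] fun _ => 0) ∧
        (Tendsto (lagrange a f (vFun a)) (𝓝[>] (a i)) (𝓝 0) → β = 0) := by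
  obtain ⟨r, φ, W, H, hφ, hH, hH', αg, βg, αf, βf, hform⟩ := h.exists_local_form ha i
  have hd := dPc_ne_zero ha i
  set p := dPc a (a i) with hp
  have h0 := Metric.mem_ball_self hφ.r_pos (x := (a i : ℂ))
  obtain ⟨-, hu, hv⟩ := hφ.tendsto_lagrange ha hH hH' isOpen_Iio self_notMem_Iio
      fun x hx hxb => ((hform x hxb).2 hx).2
  have hz : ∀ v, Tendsto (lagrange a f v) (𝓝[<] (a i)) (𝓝 0) := fun v => by
    refine Tendsto.congr' (lagrange_eventuallyEq isOpen_Iio hl v).symm ?_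
    rw [lagrange_zero]
    exact tendsto_const_nhds
  -- The zero limits on the left give `βf = 0` and `αf = -π βg / p`. So the constant of `g` does not
  -- jump, and on the right `f` is `φ` times a multiple of `βg`.
  have hβf : βf = 0 := neg_eq_zero.1 (tendsto_nhds_unique hu (hz _))
  have hαf := tendsto_nhds_unique hv (hz _)
  subst hβf
  have hpi : (Real.pi : ℂ) ≠ 0 := by exact_mod_cast Real.pi_ne_zero
  refine ⟨r, φ, W, H, hφ, hH, hH', αg, βg, fun x hx hxi => ?_, fun hβ => ?_, fun ht => ?_⟩
  · rcases lt_or_gt_of_ne hxi with hlt | hlt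
    · rw [((hform x hx).2 hlt).1]; ring
    · exact ((hform x hx).1 hlt).1
  · subst hβ
    have hαf0 : αf = 0 := by simpa using hαf
    filter_upwards [eventually_mem_ball h0 (Ioi (a i))] with x hx
    rw [((hform x hx.2).1 hx.1).2, hαf0]
    ring
  · have h1 := tendsto_nhds_unique (hφ.tendsto_lagrange ha hH hH' isOpen_Ioi self_notMem_Ioi
      fun x hx hxb => ((hform x hxb).1 hx).2).2.2 ht
    have h3 : (Real.pi : ℂ) * βg / p = 0 := by linear_combination hαf - h1
    simpa [hpi, hd] using h3

end

/-! ### Scaling and square integrability -/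

lemma ACLoc.of_analyticAt {f : ℝ → ℂ} {l r : ℝ} (hf : ∀ x ∈ Ioo l r, AnalyticAt ℝ f x) :
    ACLoc f l r := by
  intro c d hc hcd hd
  refine ContDiffOn.absolutelyContinuousOnInterval fun x hx => ?_
  rw [uIcc_of_le hcd] at hx
  exact (hf x ⟨hc.trans_le hx.1, hx.2.trans_lt hd⟩).contDiffAt.contDiffWithinAt

lemma analyticAt_quasiDeriv {a : Fin 4 → ℝ} {f : ℝ → ℂ} {x : ℝ} (hf : AnalyticAt ℝ f x) :
    AnalyticAt ℝ (quasiDeriv a f) x := by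
  have hP : AnalyticAt ℝ (fun x : ℝ => (P a x : ℂ)) x := by
    simp only [← Pc_ofReal]
    exact analyticAt_comp_ofReal (c := x) (r := 1) (fun z _ => differentiable_Pc a z)
      (Metric.mem_ball_self one_pos)
  exact hP.mul hf.deriv

/-- Scaling an eigenfunction. -/
lemma IsEigenfunction.const_mul {a : Fin 4 → ℝ} {l m r : ℝ} {ev : ℂ} {ψ : ℝ → ℂ}
    (h : IsEigenfunction a l m r ev ψ) {k : ℂ} (hk : k ≠ 0) :
    IsEigenfunction a l m r ev fun x => k * ψ x := by
  have hq : quasiDeriv a (fun x => k * ψ x) = fun x => k * quasiDeriv a ψ x := by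
    funext x; rw [quasiDeriv, quasiDeriv, deriv_const_mul_field]; ring
  have hL : L a (fun x => k * ψ x) = fun x => k * L a ψ x := by
    funext x; rw [L, L, hq, deriv_const_mul_field]; ring
  have hlag : ∀ v, lagrange a (fun x => k * ψ x) v = fun x => k * lagrange a ψ v x := by
    intro v; funext x; rw [lagrange, lagrange, hq]; ring
  have hD : ∀ {l r}, ψ ∈ DMax a l r → (fun x => k * ψ x) ∈ DMax a l r := by
    rintro l r ⟨h1, h2, h3, h4⟩
    refine ⟨fun c d hc hcd hd => (h1 c d hc hcd hd).const_smul k, ?_, h3.const_mul k, ?_⟩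
    · rw [hq]
      exact fun c d hc hcd hd => (h2 c d hc hcd hd).const_smul k
    · rw [hL]
      exact h4.const_mul k
  obtain ⟨⟨h1, h2, h3, h4, ⟨c, h5, h6⟩, ⟨d, h7, h8⟩⟩, hne, heq⟩ := h
  refine ⟨⟨hD h1, hD h2, ?_, ?_, ⟨k * c, ?_, ?_⟩, ⟨k * d, ?_, ?_⟩⟩, fun h0 => hne ?_, ?_⟩
  · rw [hlag]; simpa using h3.const_mul k
  · rw [hlag]; simpa using h4.const_mul k
  · rw [hlag]; exact h5.const_mul k
  · rw [hlag]; exact h6.const_mul k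
  · rw [hlag]; exact h7.const_mul k
  · rw [hlag]; exact h8.const_mul k
  · filter_upwards [h0] with x hx
    simpa [hk] using hx
  · filter_upwards [heq] with x hx
    rw [hL]
    simp only [hx]
    ring

lemma HasLogSingularity.const_mul {g : ℝ → ℂ} {c : ℝ} (h : HasLogSingularity g c) {k : ℂ}
    (hk : k ≠ 0) : HasLogSingularity (fun x => k * g x) c := by
  obtain ⟨p₁, p₂, q₁, q₂, h1, h2, h3, h4, h5, h6, h7, h8, h9⟩ := h
  refine ⟨fun x => k * p₁ x, fun x => k * p₂ x, fun x => k * q₁ x, fun x => k * q₂ x,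
    analyticAt_const.mul h1, analyticAt_const.mul h2, analyticAt_const.mul h3,
    analyticAt_const.mul h4, ?_, ?_, by simp only [h7], by simp only [h8], mul_ne_zero hk h9⟩
  · filter_upwards [h5] with x hx
    rw [hx]; ring
  · filter_upwards [h6] with x hx
    rw [hx]; ring

/-- The exponent `-1/4` squares to the locally integrable `-1/2`, and this power dominates a
logarithm; it serves as a majorant near `a 1`. -/
lemma memLp_two_abs_rpow (l m r : ℝ) :
    MemLp (fun x : ℝ => |x - m| ^ (-(1 / 4) : ℝ)) 2 (volume.restrict (Ioo l r)) := by
  rcases le_or_gt r l with hlr | hlr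
  · simp [Ioo_eq_empty hlr.not_gt]
  have hloc : LocallyIntegrable (fun x : ℝ => |x| ^ (-(1 / 2) : ℝ)) := by
    refine locallyIntegrable_of_norm_le_rpow (C := 1) (α := 1 / 2) (by simp) (by simp; norm_num)
      (Eventually.of_forall fun x => ?_) (by fun_prop : Measurable _).aestronglyMeasurable
    rw [one_mul, Real.norm_eq_abs, abs_of_nonneg (by positivity), Real.norm_eq_abs]
  have h1 : IntervalIntegrable (fun x : ℝ => |x| ^ (-(1 / 2) : ℝ)) volume (l - m) (r - m) :=
    (intervalIntegrable_iff_integrableOn_Icc_of_le (by linarith)).2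
      (hloc.integrableOn_isCompact isCompact_Icc)
  have h2 := h1.comp_sub_right m
  rw [sub_add_cancel, sub_add_cancel,
    intervalIntegrable_iff_integrableOn_Ioo_of_le hlr.le] at h2
  rw [memLp_two_iff_integrable_sq (by fun_prop : Measurable _).aestronglyMeasurable]
  refine h2.congr (Eventually.of_forall fun x => ?_)
  dsimp only
  rw [← Real.rpow_natCast, ← Real.rpow_mul (abs_nonneg _)]
  norm_num

lemma exists_bound_Ioo {u : ℝ → ℝ} {l r : ℝ} (hu : ContinuousOn u (Ioo l r))
    (hl : ∃ C, ∀ᶠ x in 𝓝[>] l, u x ≤ C) (hr : ∃ C, ∀ᶠ x in 𝓝[<] r, u x ≤ C) :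
    ∃ C, ∀ x ∈ Ioo l r, u x ≤ C := by
  rcases le_or_gt r l with hlr | hlr
  · exact ⟨0, fun x hx => absurd (hx.1.trans hx.2) hlr.not_gt⟩
  obtain ⟨C₁, h1⟩ := hl
  obtain ⟨C₂, h2⟩ := hr
  obtain ⟨b, hb, h1⟩ := (mem_nhdsGT_iff_exists_Ioo_subset' hlr).1 h1
  obtain ⟨c, hc, h2⟩ := (mem_nhdsLT_iff_exists_Ioo_subset' hlr).1 h2
  obtain ⟨C₃, h3⟩ := isCompact_Icc.exists_bound_of_continuousOn (s := Icc b c) (f := u)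
    (hu.mono fun x hx => ⟨hb.trans_le hx.1, hx.2.trans_lt hc⟩)
  refine ⟨max C₁ (max C₂ C₃), fun x hx => ?_⟩
  rcases lt_or_ge x b with hxb | hxb
  · exact le_trans (h1 ⟨hx.1, hxb⟩) (le_max_left _ _)
  rcases lt_or_ge c x with hxc | hxc
  · exact (le_trans (h2 ⟨hxc, hx.2⟩) (le_max_left _ _)).trans (le_max_right _ _)
  · exact ((le_abs_self _).trans (h3 x ⟨hxb, hxc⟩)).trans
      ((le_max_right _ _).trans (le_max_right _ _))

/-- Square integrability of functions with at most a mild singularity at `m`. -/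
lemma memLp_two_of_mul_rpow_bounded {g : ℝ → ℂ} {l m r : ℝ} (hm : m ∉ Ioo l r)
    (hg : ContinuousOn g (Ioo l r))
    (hl : ∃ C, ∀ᶠ x in 𝓝[>] l, ‖g x‖ * |x - m| ^ (1 / 4 : ℝ) ≤ C)
    (hr : ∃ C, ∀ᶠ x in 𝓝[<] r, ‖g x‖ * |x - m| ^ (1 / 4 : ℝ) ≤ C) :
    MemLp g 2 (volume.restrict (Ioo l r)) := by
  have hc : Continuous fun x : ℝ => |x - m| ^ (1 / 4 : ℝ) :=
    (by fun_prop : Continuous fun x : ℝ => |x - m|).rpow_const fun x => Or.inr (by norm_num)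
  obtain ⟨C, hC⟩ := exists_bound_Ioo (hg.norm.mul hc.continuousOn) hl hr
  refine (memLp_two_abs_rpow l m r).of_le_mul (c := C)
    (hg.aestronglyMeasurable measurableSet_Ioo) ?_
  filter_upwards [ae_restrict_mem measurableSet_Ioo] with x hx
  have hpos : 0 < |x - m| := abs_pos.2 (sub_ne_zero.2 fun h => hm (h ▸ hx))
  rw [Real.norm_of_nonneg (by positivity), Real.rpow_neg hpos.le, ← div_eq_mul_inv,
    le_div_iff₀ (by positivity)]
  exact hC x hx

lemma exists_bound_mul_rpow {g : ℝ → ℂ} {m : ℝ} {F : Filter ℝ} {c : ℝ} (hF : F ≤ 𝓝 c)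
    (hg : ∃ C, ∀ᶠ x in F, ‖g x‖ ≤ C) :
    ∃ C, ∀ᶠ x in F, ‖g x‖ * |x - m| ^ (1 / 4 : ℝ) ≤ C := by
  obtain ⟨C, hC⟩ := hg
  have hc : Continuous fun x : ℝ => |x - m| ^ (1 / 4 : ℝ) :=
    (by fun_prop : Continuous fun x : ℝ => |x - m|).rpow_const fun x => Or.inr (by norm_num)
  refine ⟨|C| * (|c - m| ^ (1 / 4 : ℝ) + 1), ?_⟩
  filter_upwards [hC, ((hc.tendsto c).mono_left hF).eventually (gt_mem_nhds (lt_add_one _))]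
    with x h1 h2
  exact mul_le_mul (h1.trans (le_abs_self _)) h2.le (by positivity) (abs_nonneg _)

lemma tendsto_norm_mul_rpow_of_log {A B : ℂ → ℂ} {c : ℝ} (hA : ContinuousAt A c)
    (hB : ContinuousAt B c) :
    Tendsto (fun x : ℝ => ‖A x + B x * (Real.log |x - c| : ℝ)‖ * |x - c| ^ (1 / 4 : ℝ))
      (𝓝[≠] c) (𝓝 0) := by
  have habs0 : Tendsto (fun x : ℝ => |x - c|) (𝓝[≠] c) (𝓝 0) := by
    have : Tendsto (fun x : ℝ => |x - c|) (𝓝 c) (𝓝 |c - c|) :=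
      (by fun_prop : Continuous fun x : ℝ => |x - c|).tendsto c
    simpa using this.mono_left nhdsWithin_le_nhds
  have habs : Tendsto (fun x : ℝ => |x - c|) (𝓝[≠] c) (𝓝[>] 0) := by
    refine tendsto_nhdsWithin_iff.2 ⟨habs0, ?_⟩
    filter_upwards [self_mem_nhdsWithin] with x hx
    exact abs_pos.2 (sub_ne_zero.2 hx)
  have h1 := ((tendsto_log_mul_rpow_nhdsGT_zero (r := 1 / 4) (by norm_num)).comp habs).norm
  have h2 : Tendsto (fun x : ℝ => |x - c| ^ (1 / 4 : ℝ)) (𝓝[≠] c) (𝓝 0) := by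
    have := habs0.rpow_const (p := 1 / 4) (Or.inr (by norm_num))
    rwa [Real.zero_rpow (by norm_num)] at this
  have hofR := (Complex.continuous_ofReal.tendsto c).mono_left
    (nhdsWithin_le_nhds (s := {c}ᶜ))
  have tA := (hA.tendsto.comp hofR).norm
  have tB := (hB.tendsto.comp hofR).norm
  have h3 := (tA.mul h2).add (tB.mul h1)
  simp only [norm_zero, mul_zero, add_zero] at h3
  refine squeeze_zero (fun x => by positivity) (fun x => ?_) h3
  have h4 := norm_add_le (A x) (B x * (Real.log |x - c| : ℝ))
  rw [norm_mul, Complex.norm_real] at h4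
  simp only [Function.comp, norm_mul]
  rw [Real.norm_of_nonneg (show 0 ≤ |x - c| ^ (1 / 4 : ℝ) by positivity)]
  calc _ ≤ (‖A x‖ + ‖B x‖ * ‖Real.log |x - c|‖) * |x - c| ^ (1 / 4 : ℝ) := by gcongr
    _ = _ := by ring

lemma eqOn_zero_of_eventually_nhdsGT {f : ℝ → ℂ} {l r : ℝ} (hlr : l < r)
    (hf : ∀ x ∈ Ioo l r, AnalyticAt ℝ f x) (h0 : f =ᶠ[𝓝[>] l] fun _ => 0) :
    EqOn f 0 (Ioo l r) := by
  obtain ⟨b, hb, hsub⟩ := (mem_nhdsGT_iff_exists_Ioo_subset' hlr).1 h0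
  have hb : l < b := hb
  obtain ⟨y, hy1, hy2⟩ := exists_between (lt_min hb hlr)
  refine AnalyticOnNhd.eqOn_zero_of_preconnected_of_eventuallyEq_zero hf isPreconnected_Ioo
    ⟨hy1, hy2.trans_le (min_le_right _ _)⟩ ?_
  filter_upwards [Ioo_mem_nhds hy1 (hy2.trans_le (min_le_left _ _))] with x hx using hsub hx

/-- The shape of `H_T f` near `a_2`, with a nonvanishing logarithmic coefficient. -/
lemma IsEigenfunctionLS.exists_log_form {a : Fin 4 → ℝ} (ha : StrictMono a) {ev : ℂ}
    {f : ℝ → ℂ} (hf : IsEigenfunctionLS a ev f) :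
    ∃ r φ W H, IsLocalSol a ev (a 1) r φ W ∧
      (∀ z ∈ Metric.ball (a 1 : ℂ) r, DifferentiableAt ℂ H z) ∧
      (∀ z ∈ Metric.ball (a 1 : ℂ) r, z ≠ a 1 →
        HasDerivAt H (dPc a (a 1) / (Pc a z * φ z ^ 2) - 1 / (z - a 1)) z) ∧
      ∃ α β : ℂ, β ≠ 0 ∧ ∀ x : ℝ, (x : ℂ) ∈ Metric.ball (a 1 : ℂ) r → x ≠ a 1 →
          HT a f x = φ x * (α + β * tau (dPc a (a 1)) (a 1) H x) := by
  have h12 := ha (show (1 : Fin 4) < 2 by decide)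
  have h23 := ha (show (2 : Fin 4) < 3 by decide)
  have hB := hf.isBoundaryPair ha
  have hleft : zeroExt a f =ᶠ[𝓝[<] (a 1)] fun _ => 0 := by
    filter_upwards [self_mem_nhdsWithin] with x hx
    exact indicator_of_notMem (fun h => lt_asymm h.1 hx) f
  obtain ⟨r, φ, W, H, hφ, hH, hH', α, β, hform, hzero, -⟩ := hB.log_of_eventually_zero ha hleft
  refine ⟨r, φ, W, H, hφ, hH, hH', α, β, fun hβ => ?_, hform⟩
  -- If `β = 0`, then `f` vanishes to the right of `a 1`, hence on all of `(a 1, a 2)` by the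
  -- identity theorem. The same argument is then repeated at `a 2`.
  have hz1 := eqOn_zero_of_eventually_nhdsGT h12 (fun x hx =>
    (hB.analyticAt (P_ne_zero_of_mem ha (Or.inr (Or.inl hx)))).2.1) (hzero hβ)
  have hleft2 : zeroExt a f =ᶠ[𝓝[<] (a 2)] fun _ => 0 := by
    filter_upwards [Ioo_mem_nhdsLT h12] with x hx using hz1 hx
  obtain ⟨r', φ', W', H', -, -, -, α', β', -, hzero', hβ'⟩ :=
    hB.log_of_eventually_zero ha hleft2
  obtain ⟨-, -, -, -, -, ⟨c, hc1, hc2⟩⟩ := hf.1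
  have hext : ∀ x ∈ Ioo (a 1) (a 3), zeroExt a f x = f x := fun x hx => indicator_of_mem hx f
  have hfl : f =ᶠ[𝓝[<] (a 2)] fun _ => 0 := by
    filter_upwards [Ioo_mem_nhdsLT h12] with x hx
    rw [← hext x ⟨hx.1, hx.2.trans h23⟩]
    exact hz1 hx
  -- The transmission condition on `[f, v]` transports the vanishing from the left of `a 2` to the
  -- right.
  have hc0 : c = 0 := by
    refine tendsto_nhds_unique (hc1.congr' (lagrange_eventuallyEq isOpen_Iio hfl _)) ?_
    rw [lagrange_zero]
    exact tendsto_const_nhds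
  have hfr : f =ᶠ[𝓝[>] (a 2)] zeroExt a f := by
    filter_upwards [Ioo_mem_nhdsGT h23] with x hx
    exact (hext x ⟨h12.trans hx.1, hx.2⟩).symm
  rw [hc0] at hc2
  have hz2 := eqOn_zero_of_eventually_nhdsGT h23 (fun x hx =>
    (hB.analyticAt (P_ne_zero_of_mem ha (Or.inr (Or.inr hx)))).2.1)
    (hzero' (hβ' (hc2.congr' (lagrange_eventuallyEq isOpen_Ioi hfr _))))
  refine hf.2.1 ?_
  have hne : ∀ᵐ x ∂(volume.restrict (Ioo (a 1) (a 3))), x ≠ a 2 :=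
    ae_restrict_of_ae (by simp [ae_iff])
  filter_upwards [ae_restrict_mem measurableSet_Ioo, hne] with x hx hx2
  rw [← hext x hx]
  rcases lt_or_gt_of_ne hx2 with h | h
  · exact hz1 ⟨hx.1, h⟩
  · exact hz2 ⟨h, hx.2⟩

/-- The extended `f` vanishes on both sides of `a 0`, so `[f, v]` has no jump there and `g` no
logarithm. -/
lemma IsEigenfunctionLS.regular_zero {a : Fin 4 → ℝ} (ha : StrictMono a) {ev : ℂ}
    {f : ℝ → ℂ} (hf : IsEigenfunctionLS a ev f) :
    (∃ C, ∀ᶠ x in 𝓝[>] (a 0), ‖HT a f x‖ ≤ C) ∧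
    Tendsto (lagrange a (HT a f) uFun) (𝓝[>] (a 0)) (𝓝 0) := by
  have h01 := ha (show (0 : Fin 4) < 1 by decide)
  have hz : ∀ S : Set ℝ, IsOpen S → Tendsto (lagrange a (zeroExt a f) (vFun a)) (𝓝[S] (a 0))
      (𝓝 0) := by
    intro S hS
    have h0 : zeroExt a f =ᶠ[𝓝[S] (a 0)] fun _ => 0 := by
      filter_upwards [nhdsWithin_le_nhds (Iio_mem_nhds h01)] with x hx
      exact indicator_of_notMem (fun h => lt_asymm h.1 hx) f
    refine Tendsto.congr' (lagrange_eventuallyEq hS h0 _).symm ?_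
    rw [lagrange_zero]
    exact tendsto_const_nhds
  obtain ⟨⟨h1, -⟩, h2, -⟩ := (hf.isBoundaryPair ha).regular_of_tendsto_lagrange ha
    (hz _ isOpen_Iio) (hz _ isOpen_Ioi)
  exact ⟨h1, h2⟩

/-- The continuity of `[f, v]` at `a 2`, which excludes a logarithm in `g`, is the second
transmission condition of `L_S`. -/
lemma IsEigenfunctionLS.regular_two {a : Fin 4 → ℝ} (ha : StrictMono a) {ev : ℂ}
    {f : ℝ → ℂ} (hf : IsEigenfunctionLS a ev f) :
    (∃ C, ∀ᶠ x in 𝓝[<] (a 2), ‖HT a f x‖ ≤ C) ∧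
    Tendsto (lagrange a (HT a f) uFun) (𝓝[<] (a 2)) (𝓝 0) := by
  have h12 := ha (show (1 : Fin 4) < 2 by decide)
  have h23 := ha (show (2 : Fin 4) < 3 by decide)
  obtain ⟨-, -, -, -, -, ⟨c, hc1, hc2⟩⟩ := hf.1
  have hz : ∀ S : Set ℝ, f =ᶠ[𝓝[S] (a 2)] zeroExt a f := by
    intro S
    filter_upwards [nhdsWithin_le_nhds (Ioo_mem_nhds h12 h23)] with x hx
    exact (indicator_of_mem hx f).symm
  obtain ⟨⟨-, h1⟩, -, h2⟩ := (hf.isBoundaryPair ha).regular_of_tendsto_lagrange ha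
    (hc1.congr' (lagrange_eventuallyEq isOpen_Iio (hz _) _))
    (hc2.congr' (lagrange_eventuallyEq isOpen_Ioi (hz _) _))
  exact ⟨h1, h2⟩

/-- The transform of an eigenfunction of `L_S` is an eigenfunction of `L̃_S`. -/
lemma IsEigenfunctionLS.isEigenfunctionLSTilde_HT {a : Fin 4 → ℝ} (ha : StrictMono a) {ev : ℂ}
    {f : ℝ → ℂ} (hf : IsEigenfunctionLS a ev f) :
    MemLp (HT a f) 2 (volume.restrict (Ioo (a 0) (a 2))) ∧
    IsEigenfunctionLSTilde a ev (HT a f) ∧ HasLogSingularity (HT a f) (a 1) := by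
  have h01 := ha (show (0 : Fin 4) < 1 by decide)
  have h12 := ha (show (1 : Fin 4) < 2 by decide)
  have hB := hf.isBoundaryPair ha
  obtain ⟨r, φ, W, H, hφ, hH, hH', α, β, hβ, hform⟩ := hf.exists_log_form ha
  obtain ⟨hb0, hu0⟩ := hf.regular_zero ha
  obtain ⟨hb2, hu2⟩ := hf.regular_two ha
  have hd := dPc_ne_zero ha 1
  set p := dPc a (a 1) with hp
  have hc := Metric.mem_ball_self hφ.r_pos (x := (a 1 : ℂ))
  have han1 : ∀ x ∈ Ioo (a 0) (a 1), AnalyticAt ℝ (HT a f) x ∧ L a (HT a f) x = ev * HT a f x :=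
    fun x hx => have h := hB.analyticAt (P_ne_zero_of_mem ha (Or.inl hx)); ⟨h.1, h.2.2⟩
  have han2 : ∀ x ∈ Ioo (a 1) (a 2), AnalyticAt ℝ (HT a f) x ∧ L a (HT a f) x = ev * HT a f x :=
    fun x hx => have h := hB.analyticAt (P_ne_zero_of_mem ha (Or.inr (Or.inl hx))); ⟨h.1, h.2.2⟩
  -- the logarithmic form
  set A : ℂ → ℂ := fun z => φ z * (α + β * H z / p) with hA
  set B : ℂ → ℂ := fun z => φ z * β / p with hBdef
  have hAd : ∀ z ∈ Metric.ball (a 1 : ℂ) r, DifferentiableAt ℂ A z := fun z hz =>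
    (hφ.differentiableAt z hz).mul (((hH z hz).const_mul β).div_const p |>.const_add α)
  have hBd : ∀ z ∈ Metric.ball (a 1 : ℂ) r, DifferentiableAt ℂ B z := fun z hz =>
    ((hφ.differentiableAt z hz).mul_const β).div_const p
  have hAB : ∀ x : ℝ, (x : ℂ) ∈ Metric.ball (a 1 : ℂ) r → x ≠ a 1 →
      HT a f x = A x + B x * (Real.log |x - a 1| : ℝ) := by
    intro x hx hx1
    rw [hform x hx hx1, tau, hA, hBdef]
    ring
  have hB1 : B (a 1) ≠ 0 := by
    simp only [hBdef, hφ.map_center, one_mul]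
    exact div_ne_zero hβ hd
  have hlog : HasLogSingularity (HT a f) (a 1) := by
    -- The same pair serves on both sides, because the coefficients of `g` do not jump at `a 1`.
    refine ⟨fun x => A x, fun x => B x, fun x => A x, fun x => B x, analyticAt_comp_ofReal hAd hc,
      analyticAt_comp_ofReal hBd hc, analyticAt_comp_ofReal hAd hc, analyticAt_comp_ofReal hBd hc,
      ?_, ?_, rfl, rfl, hB1⟩
    · filter_upwards [eventually_mem_ball hc (Iio (a 1))] with x hx
      exact hAB x hx.2 (ne_of_lt hx.1)
    · filter_upwards [eventually_mem_ball hc (Ioi (a 1))] with x hx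
      exact hAB x hx.2 (ne_of_gt hx.1)
  -- square integrability
  have hbd1 : ∀ S : Set ℝ, a 1 ∉ S → ∃ C, ∀ᶠ x in 𝓝[S] (a 1),
      ‖HT a f x‖ * |x - a 1| ^ (1 / 4 : ℝ) ≤ C := by
    intro S hS
    have h1 := (tendsto_norm_mul_rpow_of_log (hAd _ hc).continuousAt
      (hBd _ hc).continuousAt).mono_left
      (nhdsWithin_mono (a 1) fun x hx h => hS (h ▸ hx) : 𝓝[S] (a 1) ≤ 𝓝[≠] (a 1))
    refine ⟨1, ?_⟩
    filter_upwards [h1.eventually (gt_mem_nhds one_pos), eventually_mem_ball hc S] with x hx1 hx2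
    rw [hAB x hx2.2 fun h => hS (h ▸ hx2.1)]
    exact hx1.le
  have hcont1 : ContinuousOn (HT a f) (Ioo (a 0) (a 1)) := fun x hx =>
    (han1 x hx).1.continuousAt.continuousWithinAt
  have hcont2 : ContinuousOn (HT a f) (Ioo (a 1) (a 2)) := fun x hx =>
    (han2 x hx).1.continuousAt.continuousWithinAt
  have hmem1 : MemLp (HT a f) 2 (volume.restrict (Ioo (a 0) (a 1))) :=
    memLp_two_of_mul_rpow_bounded (m := a 1) right_notMem_Ioo hcont1
      (exists_bound_mul_rpow nhdsWithin_le_nhds hb0) (hbd1 _ self_notMem_Iio)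
  have hmem2 : MemLp (HT a f) 2 (volume.restrict (Ioo (a 1) (a 2))) :=
    memLp_two_of_mul_rpow_bounded (m := a 1) left_notMem_Ioo hcont2
      (hbd1 _ self_notMem_Ioi) (exists_bound_mul_rpow nhdsWithin_le_nhds hb2)
  have hmem : MemLp (HT a f) 2 (volume.restrict (Ioo (a 0) (a 2))) := by
    rw [Measure.restrict_congr_set (Ioo_ae_eq_union h01 h12)]
    have hm := aestronglyMeasurable_union_iff.2 ⟨hmem1.1, hmem2.1⟩
    exact (memLp_two_iff_integrable_sq_norm hm).2
      (IntegrableOn.union ((memLp_two_iff_integrable_sq_norm hmem1.1).1 hmem1)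
        ((memLp_two_iff_integrable_sq_norm hmem2.1).1 hmem2))
  -- maximal domains
  have hL1 : ∀ x ∈ Ioo (a 0) (a 1), L a (HT a f) x = ev * HT a f x := fun x hx => (han1 x hx).2
  have hL2 : ∀ x ∈ Ioo (a 1) (a 2), L a (HT a f) x = ev * HT a f x := fun x hx => (han2 x hx).2
  have hD : ∀ l r : ℝ, (∀ x ∈ Ioo l r, AnalyticAt ℝ (HT a f) x ∧
      L a (HT a f) x = ev * HT a f x) → MemLp (HT a f) 2 (volume.restrict (Ioo l r)) →
      HT a f ∈ DMax a l r := by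
    intro l r h1 h2
    refine ⟨ACLoc.of_analyticAt fun x hx => (h1 x hx).1,
      ACLoc.of_analyticAt fun x hx => analyticAt_quasiDeriv (h1 x hx).1, h2, ?_⟩
    refine (h2.const_mul ev).ae_eq ?_
    filter_upwards [ae_restrict_mem measurableSet_Ioo] with x hx
    exact (h1 x hx).2.symm
  -- transmission conditions
  obtain ⟨hql, hul, hvl⟩ := hφ.tendsto_lagrange ha hH hH' isOpen_Iio self_notMem_Iio
    fun x hx hxb => hform x hxb (ne_of_lt hx)
  obtain ⟨hqr, hur, hvr⟩ := hφ.tendsto_lagrange ha hH hH' isOpen_Ioi self_notMem_Ioi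
    fun x hx hxb => hform x hxb (ne_of_gt hx)
  refine ⟨hmem, ⟨⟨hD _ _ han1 hmem1, hD _ _ han2 hmem2, hu0, hu2, ⟨_, hul, hur⟩, ⟨_, hvl, hvr⟩⟩,
    fun h0 => ?_, ?_⟩, hlog⟩
  -- If `H_T f` were zero almost everywhere, it would vanish on `(a 1, a 2)` by continuity, and the
  -- limit `-β` of `[H_T f, u]` at `a 1` would be zero.
  · have hz : EqOn (HT a f) 0 (Ioo (a 1) (a 2)) :=
      Measure.eqOn_open_of_ae_eq (ae_mono (Measure.restrict_mono (Ioo_subset_Ioo_left h01.le)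
        le_rfl) h0) isOpen_Ioo hcont2 continuousOn_const
    have hz' : HT a f =ᶠ[𝓝[>] (a 1)] fun _ => 0 := by
      filter_upwards [Ioo_mem_nhdsGT h12] with x hx using hz hx
    have h1 := hur.congr' (lagrange_eventuallyEq isOpen_Ioi hz' _)
    rw [lagrange_zero] at h1
    exact hβ (neg_eq_zero.1 (tendsto_nhds_unique h1 tendsto_const_nhds))
  · have hne : ∀ᵐ x ∂(volume.restrict (Ioo (a 0) (a 2))), x ≠ a 1 :=
      ae_restrict_of_ae (by simp [ae_iff])
    filter_upwards [ae_restrict_mem measurableSet_Ioo, hne] with x hx hx1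
    rcases lt_or_gt_of_ne hx1 with h | h
    · exact hL1 x ⟨hx.1, h⟩
    · exact hL2 x ⟨h, hx.2⟩

end

end TruncHilbert

open TruncHilbert in
theorem mainTheorem10 (a : Fin 4 → ℝ) (ha : StrictMono a) (ev : ℂ) (f : ℝ → ℂ)
    (hf : TruncHilbert.IsEigenfunctionLS a ev f) :
    -- the principal value defining `H_T f` exists on `(a_1, a_2) ∪ (a_2, a_3)`
    (∀ x ∈ Ioo (a 0) (a 2), x ≠ a 1 →
      Tendsto (TruncHilbert.truncIntegral a f x) (𝓝[>] 0) (𝓝 (TruncHilbert.HT a f x))) ∧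
    -- `H_T f` is a nonzero element of `L²(a_1, a_3)`, so that `g` is well defined
    MemLp (TruncHilbert.HT a f) 2 (volume.restrict (Ioo (a 0) (a 2))) ∧
    0 < TruncHilbert.normL2 a (TruncHilbert.HT a f) ∧
    -- `g` lies in the domain of `L̃_S` and is an eigenfunction with the same eigenvalue
    TruncHilbert.IsEigenfunctionLSTilde a ev (TruncHilbert.normalizedHT a f) ∧
    -- the behaviour of `g` at the three points
    TruncHilbert.HasLogSingularity (TruncHilbert.normalizedHT a f) (a 1) ∧
    (∃ C : ℝ, ∀ᶠ x in 𝓝[>] (a 0), ‖TruncHilbert.normalizedHT a f x‖ ≤ C) ∧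
    (∃ C : ℝ, ∀ᶠ x in 𝓝[<] (a 2), ‖TruncHilbert.normalizedHT a f x‖ ≤ C) := by
  obtain ⟨hmem, heig, hlog⟩ := hf.isEigenfunctionLSTilde_HT ha
  have hpos : 0 < normL2 a (HT a f) := by
    refine ENNReal.toReal_pos (fun h => heig.2.1 ?_) hmem.2.ne
    exact (eLpNorm_eq_zero_iff hmem.1 two_ne_zero).1 h
  set k : ℂ := ((normL2 a (HT a f) : ℝ) : ℂ)⁻¹ with hk
  have hk0 : k ≠ 0 := inv_ne_zero (by exact_mod_cast hpos.ne')
  have hnorm : normalizedHT a f = fun x => k * HT a f x := by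
    funext x
    rw [normalizedHT, hk, div_eq_inv_mul]
  have hbd : ∀ F : Filter ℝ, (∃ C, ∀ᶠ x in F, ‖HT a f x‖ ≤ C) →
      ∃ C : ℝ, ∀ᶠ x in F, ‖k * HT a f x‖ ≤ C := by
    rintro F ⟨C, hC⟩
    refine ⟨‖k‖ * C, hC.mono fun x hx => ?_⟩
    rw [norm_mul]
    gcongr
  rw [hnorm]
  refine ⟨fun x hx hx1 => (hf.tendsto_truncIntegral ha (P_ne_zero_of_mem ha ?_)).1, hmem, hpos,
    IsEigenfunction.const_mul heig hk0, hlog.const_mul hk0, hbd _ (hf.regular_zero ha).1,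
    hbd _ (hf.regular_two ha).1⟩
  rcases lt_or_gt_of_ne hx1 with h | h
  · exact Or.inl ⟨hx.1, h⟩
  · exact Or.inr (Or.inl ⟨h, hx.2⟩)
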